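/- Let $\gamma,R$ be real numbers with $R>0$ and $0<\gamma^2<4$. For $0<l\le R$ and $d\ge 0$ let $$k_l(d)=\begin{cases}\gamma^2\ln\frac Rl+2\gamma^2\Big(1-\sqrt{d/l}\Big), & d\le l,\\ \gamma^2\ln^+\frac Rd, & d>l.\end{cases}$$ Let $(X_l(x))_{0<l\le R,\ x\in\mathbb R^2}$ be a centered Gaussian family on a probability space $(\Omega,\mathbb P)$ with $$\mathbb E[X_l(x)X_{l'}(y)]=k_{\max(l,l')}(|x-y|)$$ and such that, for every $l$, almost surely $x\mapsto X_l(x)$ is continuous. (Thus, as $l$ decreases to $0$, the fields $X_l$ have independent increments and their covariances increase to $\gamma^2\ln^+\frac{R}{|x-y|}$.) Put $$M_l(dx)=e^{X_l(x)-\frac12\mathbb E[X_l(x)^2]}\,dx ,$$ and let $M$ be the log-normal multifractal random measure (Gaussian multiplicative chaos) with kernel $\gamma^2\ln^+\frac R{|x|}$, that is, the almost sure limit of $M_l$ as $l\to0$ in the space of Radon measures on $\mathbb R^2$ (convergence against continuous functions with compact support). Here the limit is taken along an arbitrary deterministic sequence $l_n\to0$ in $(0,R]$, and its almost sure existence is part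 of the assertion. Let $$\zeta(q)=\Big(2+\frac{\gamma^2}2\Big)q-\frac{\gamma^2}2q^2 .$$ For a measure $\mu$ on $\mathbb R^2$, a set $K\subset\mathbb R^2$ and $s\ge0$, let $$C^s_\mu(K)=\inf\Big\{\sum_i\mu(B(x_i,r_i))^s:\ (B(x_i,r_i))_i\text{ is a countable cover of }K\text{ by open balls with radii } r_i>0\Big\},$$ $$\dim_H^\mu(K)=\inf\{s\ge0:\ C^s_\mu(K)=0\}.$$ **Theorem.** Let $K$ be a deterministic nonempty Borel subset of the closed ball of radius $R$ centered at $0$ in $\mathbb R^2$, and let $\delta_0$ be its Hausdorff dimension with respect to the Euclidean metric. Then the equation $\zeta(\delta)=\delta_0$ has a unique solution $\delta$ in $[0,1]$, and $\mathbb P$-almost surely $M$ exists and $\dim_H^M(K)=\delta$. -/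

import Mathlib

open MeasureTheory ProbabilityTheory Filter Topology Set
open scoped NNReal ENNReal

noncomputable section

/-- The Euclidean plane. -/
abbrev Plane : Type := EuclideanSpace ℝ (Fin 2)

/-- The covariance `γ² ln⁺(R/|z|)`, regularised at scale `l`, as a function of `d = |z|`. -/
def cutoffCovariance (γ R l d : ℝ) : ℝ :=
  if d ≤ l then γ ^ 2 * Real.log (R / l) + 2 * γ ^ 2 * (1 - √(d / l))
  else γ ^ 2 * max 0 (Real.log (R / d))

/-- `X l x`, for `0 < l ≤ R` and `x` in the plane, is a family of centered, jointly Gaussian fields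
with (almost surely) continuous sample paths, whose covariance at scale `l` is
`cutoffCovariance γ R l`. The fields at different scales are coupled in the usual way for
multiplicative chaos: as `l` decreases, the increments `X l' - X l` are independent of the fields
at the larger scales, which for jointly Gaussian fields means that the covariance of `X l x` and
`X l' y` is that of the larger of the two scales. -/
structure IsCutoffFieldFamily {Ω : Type*} [MeasurableSpace Ω] (P : Measure Ω) (γ R : ℝ)
    (X : ℝ → Plane → Ω → ℝ) : Prop where
  gaussian : IsGaussianProcess (fun (p : Ioc 0 R × Plane) => X p.1 p.2) P
  centered : ∀ l ∈ Ioc 0 R, ∀ x, ∫ ω, X l x ω ∂P = 0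
  covariance : ∀ l ∈ Ioc 0 R, ∀ l' ∈ Ioc 0 R, ∀ x y,
    ∫ ω, X l x ω * X l' y ω ∂P = cutoffCovariance γ R (max l l') (dist x y)
  continuous_paths : ∀ l ∈ Ioc 0 R, ∀ᵐ ω ∂P, Continuous (fun x => X l x ω)

/-- The measure `exp (Y x - E[(Y x)²] / 2) dx` of a random field `Y` on the plane, at the
outcome `ω`. -/
def expFieldMeasure {Ω : Type*} [MeasurableSpace Ω] (P : Measure Ω)
    (Y : Plane → Ω → ℝ) (ω : Ω) : Measure Plane :=
  volume.withDensity fun x =>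
    ENNReal.ofReal (Real.exp (Y x ω - (1 / 2) * ∫ ω', (Y x ω') ^ 2 ∂P))

/-- `M` is a Radon measure on the plane (that is, finite on compact sets) and `μ n` converges to it
in the space of Radon measures, that is, against continuous functions with compact support. -/
def IsRadonLimit (μ : ℕ → Measure Plane) (M : Measure Plane) : Prop :=
  IsFiniteMeasureOnCompacts M ∧
    ∀ f : Plane → ℝ, Continuous f → HasCompactSupport f →
      Tendsto (fun n => ∫ x, f x ∂(μ n)) atTop (𝓝 (∫ x, f x ∂M))

/-- The `s`-dimensional Hausdorff content of `K` with respect to the measure `μ`: the infimum of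
`∑ μ(B(xᵢ, rᵢ)) ^ s` over the countable (finite or infinite) covers of `K` by balls with positive
radii. -/
def measureHausdorffContent {E : Type*} [PseudoMetricSpace E] [MeasurableSpace E]
    (μ : Measure E) (s : ℝ≥0) (K : Set E) : ℝ≥0∞ :=
  ⨅ (I : Set ℕ) (x : ℕ → E) (r : ℕ → ℝ) (_ : ∀ i ∈ I, 0 < r i)
    (_ : K ⊆ ⋃ i ∈ I, Metric.ball (x i) (r i)),
    ∑' i : I, μ (Metric.ball (x i) (r i)) ^ (s : ℝ)

/-- The Hausdorff dimension of `K` with respect to the measure `μ`: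
`inf {s ≥ 0 | C^s(K) = 0}`, with `inf ∅ = ∞`. -/
def measureDimH {E : Type*} [PseudoMetricSpace E] [MeasurableSpace E]
    (μ : Measure E) (K : Set E) : ℝ≥0∞ :=
  ⨅ (s : ℝ≥0) (_ : measureHausdorffContent μ s K = 0), (s : ℝ≥0∞)

/-- The scaling exponent `ζ(q)` of the measure, characterised by
`E[M(B(0, λ))^q] = (λ / R) ^ ζ(q) * E[M(B(0, R))^q]`. -/
def scalingExponent (γ q : ℝ) : ℝ :=
  (2 + γ ^ 2 / 2) * q - γ ^ 2 / 2 * q ^ 2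

end

/-! Along the scales `R / 2 ^ n` the fields form a Gaussian sequence with independent increments.
For every `q` and every finite measure `ν`, the masses of `chaos κ Y q ν n` are therefore positive
martingales. About the covariances the proof uses only that they grow by `L = γ² log 2` per level up
to a bounded error, and that the level-`m` covariance is final beyond distance `R / 2 ^ m`
(`LogKernel`, `DyadicKernel`). Exact scale invariance is never needed.

Upper bound. For `s < 1` the moment of order `s` of the mass of a ball of radius `r` is at most a
constant times `r ^ ζ(s)`. If `ζ(s)` exceeds the Euclidean dimension of `K`, then `K` has covers
with arbitrarily small `∑ r ^ ζ(s)`, and Fatou's lemma makes the content of order `s` vanish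
(`ae_content_eq_zero`). If `δ = 1`, exponents `1 + θ` are used instead, and `γ² < 4` makes those
moments decay faster than `r²`.

Lower bound. For `q < δ` choose `t` strictly between `ζ(q)` and the dimension of `K`. Frostman's
lemma gives a probability measure `ν` on a compact subset of `K` with `ν(B(x, r)) ≤ D r ^ t`. Let
`Z` be the chaos over `ν` with parameter `q`. Under the probability tilted by `expWeight` at `x`,
`Z(B(x, r))` is typically at most of order `r ^ (t - q² γ² / 2)`, and the mass of a ball near `x` is
typically of order `r ^ (2 + γ² / 2 - q γ²)`. The inequality `ζ(q) < t` says exactly that the first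
is below the `q`-th power of the second. Failures are summable over well-chosen scales
(`exists_bad_events`), so a positive part of `Z` sits on points where the comparison holds at all
small scales. A mass distribution argument then gives dimension at least `q`
(`IsRadonLimit.exists_pos_le_tsum_ball_rpow`). It is carried out at finite levels, with no limit
measure for `Z`; only the limit of its total mass is needed, and a zero-one law makes that positive.

Frostman's lemma is proved for Borel sets on a tree of dyadic squares: capacitability of the net
content reduces it to a compact set, and a random walk with content-driven transition weights builds
the measure. An arbitrary sequence of scales is finally merged with the dyadic one, so both have the
same limit. -/

open scoped CompactlySupported

/-! ### Gaussian scale fields and their exponential moments. -/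

/-- A process whose values are finite linear combinations of the values of a Gaussian process is
Gaussian. -/
theorem ProbabilityTheory.IsGaussianProcess.of_linear_combinations {S T Ω : Type*}
    [MeasurableSpace Ω] {P : Measure Ω} {X : T → Ω → ℝ} {Z : S → Ω → ℝ}
    (hX : IsGaussianProcess X P)
    (h : ∀ s, ∃ I : Finset T, ∃ A : (I → ℝ) →L[ℝ] ℝ, ∀ ω, Z s ω = A (I.restrict (X · ω))) :
    IsGaussianProcess Z P where
  hasGaussianLaw I := by
    choose J A hA using h
    classical
    let B : (I.biUnion J → ℝ) →L[ℝ] I → ℝ :=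
      ContinuousLinearMap.pi fun s => (A s).comp (ContinuousLinearMap.pi fun t =>
        ContinuousLinearMap.proj ⟨t.1, Finset.mem_biUnion.2 ⟨s.1, s.2, t.2⟩⟩)
    have hB : (fun ω => I.restrict (Z · ω)) = B ∘ (fun ω => (I.biUnion J).restrict (X · ω)) := by
      ext ω s
      simp only [Finset.restrict_def, hA]
      rfl
    rw [hB]
    exact (hX.hasGaussianLaw _).map _

/-- A sequence of continuous centered Gaussian fields `Y n` on the plane with independent
stationary increments, the covariance at level `n` being `κ n`. -/
structure IsScaleField {Ω : Type*} [MeasurableSpace Ω] (P : Measure Ω) (κ : ℕ → ℝ → ℝ)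
    (Y : ℕ → Plane → Ω → ℝ) : Prop where
  gaussian : IsGaussianProcess (fun p : ℕ × Plane => Y p.1 p.2) P
  measurable : ∀ n x, Measurable (Y n x)
  continuous : ∀ n ω, Continuous (fun x => Y n x ω)
  centered : ∀ n x, ∫ ω, Y n x ω ∂P = 0
  covariance : ∀ m n x y, ∫ ω, Y m x ω * Y n y ω ∂P = κ (min m n) (dist x y)

/-- The normalised exponential `exp (q Y - q² E[Y²] / 2)` of a field at level `n`. -/
noncomputable def expWeight {Ω : Type*} (κ : ℕ → ℝ → ℝ) (Y : ℕ → Plane → Ω → ℝ) (q : ℝ) (n : ℕ)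
    (x : Plane) (ω : Ω) : ℝ≥0∞ :=
  ENNReal.ofReal (Real.exp (q * Y n x ω - q ^ 2 / 2 * κ n 0))

/-- The measure `exp (q Y - q² E[Y²] / 2) dν`. -/
noncomputable def chaos {Ω : Type*} (κ : ℕ → ℝ → ℝ) (Y : ℕ → Plane → Ω → ℝ) (q : ℝ)
    (ν : Measure Plane) (n : ℕ) (ω : Ω) : Measure Plane :=
  ν.withDensity fun x => expWeight κ Y q n x ω

namespace IsScaleField

variable {Ω : Type*} [MeasurableSpace Ω] {P : Measure Ω} {κ : ℕ → ℝ → ℝ}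
  {Y : ℕ → Plane → Ω → ℝ}

theorem isProbabilityMeasure (h : IsScaleField P κ Y) : IsProbabilityMeasure P :=
  h.gaussian.isProbabilityMeasure

theorem memLp_two (h : IsScaleField P κ Y) (n : ℕ) (x : Plane) : MemLp (Y n x) 2 P :=
  (h.gaussian.hasGaussianLaw_eval (n, x)).memLp_two

theorem cov_eq (h : IsScaleField P κ Y) (m n : ℕ) (x y : Plane) :
    cov[Y m x, Y n y; P] = κ (min m n) (dist x y) := by
  have := h.isProbabilityMeasure
  rw [covariance_eq_sub (h.memLp_two m x) (h.memLp_two n y), h.centered, h.centered]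
  simpa using h.covariance m n x y

theorem hasGaussianLaw_sum (h : IsScaleField P κ Y) {k : ℕ} (c : Fin k → ℝ) (i : Fin k → ℕ)
    (x : Fin k → Plane) : HasGaussianLaw (fun ω => ∑ j, c j * Y (i j) (x j) ω) P := by
  have h1 := (h.gaussian.comp_right (fun j : Fin k => (i j, x j))).smul c
  exact h1.hasGaussianLaw_fun_sum (I := Finset.univ)

theorem variance_sum (h : IsScaleField P κ Y) {k : ℕ} (c : Fin k → ℝ) (i : Fin k → ℕ)
    (x : Fin k → Plane) :
    Var[fun ω => ∑ j, c j * Y (i j) (x j) ω; P]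
      = ∑ j, ∑ j', c j * c j' * κ (min (i j) (i j')) (dist (x j) (x j')) := by
  have := h.isProbabilityMeasure
  have hm : ∀ j, MemLp (fun ω => c j * Y (i j) (x j) ω) 2 P := fun j =>
    (h.memLp_two (i j) (x j)).const_mul (c j)
  rw [← covariance_self (by exact Finset.aemeasurable_fun_sum _ fun j _ =>
    ((h.measurable _ _).const_mul _).aemeasurable), covariance_fun_sum_fun_sum hm hm]
  refine Finset.sum_congr rfl fun j _ => Finset.sum_congr rfl fun j' _ => ?_
  rw [covariance_const_mul_left, covariance_const_mul_right, h.cov_eq]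
  ring

theorem lintegral_exp_sum (h : IsScaleField P κ Y) {k : ℕ} (c : Fin k → ℝ) (i : Fin k → ℕ)
    (x : Fin k → Plane) (b : ℝ) :
    ∫⁻ ω, ENNReal.ofReal (Real.exp (∑ j, c j * Y (i j) (x j) ω + b)) ∂P
      = ENNReal.ofReal (Real.exp
        ((∑ j, ∑ j', c j * c j' * κ (min (i j) (i j')) (dist (x j) (x j'))) / 2 + b)) := by
  have hP := h.isProbabilityMeasure
  have hg := h.hasGaussianLaw_sum c i x
  have hmap := hg.map_eq_gaussianReal
  have hmean : ∫ ω, (∑ j, c j * Y (i j) (x j) ω) ∂P = 0 := by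
    rw [integral_finsetSum]
    · refine Finset.sum_eq_zero fun j _ => ?_
      rw [integral_const_mul, h.centered, mul_zero]
    · exact fun j _ => ((h.memLp_two _ _).integrable one_le_two).const_mul _
  have hint : Integrable (fun ω => Real.exp (∑ j, c j * Y (i j) (x j) ω)) P := by
    have h1 : Integrable (fun y : ℝ => Real.exp (1 * y))
        (P.map (fun ω => ∑ j, c j * Y (i j) (x j) ω)) := by
      rw [hmap]; exact integrable_exp_mul_gaussianReal 1
    have := (integrable_map_measure (by fun_prop) hg.aemeasurable).1 h1
    simpa [Function.comp_def] using this
  have hmgf := mgf_gaussianReal hmap 1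
  rw [hmean, mgf] at hmgf
  rw [Real.coe_toNNReal _ (variance_nonneg _ _), h.variance_sum] at hmgf
  simp only [one_mul, zero_add, one_pow, mul_one] at hmgf
  rw [← ofReal_integral_eq_lintegral_ofReal]
  · simp_rw [Real.exp_add]
    rw [integral_mul_const, hmgf]
  · simp_rw [Real.exp_add]
    exact hint.mul_const _
  · exact ae_of_all _ fun _ => (Real.exp_pos _).le

/-- The exponential moments of combinations of three values of the field. -/
theorem lintegral_exp_three (h : IsScaleField P κ Y) (a b c e : ℝ) (i j k : ℕ) (x y z : Plane) :
    ∫⁻ ω, ENNReal.ofReal (Real.exp (a * Y i x ω + b * Y j y ω + c * Y k z ω + e)) ∂P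
      = ENNReal.ofReal (Real.exp
        ((a ^ 2 * κ i 0 + b ^ 2 * κ j 0 + c ^ 2 * κ k 0) / 2 + a * b * κ (min i j) (dist x y)
          + a * c * κ (min i k) (dist x z) + b * c * κ (min j k) (dist y z) + e)) := by
  have := h.lintegral_exp_sum ![a, b, c] ![i, j, k] ![x, y, z] e
  simp only [Fin.sum_univ_three, Matrix.cons_val_zero, Matrix.cons_val_one, Matrix.cons_val] at this
  rw [this]
  congr 2
  rw [dist_comm y x, dist_comm z x, dist_comm z y, min_comm j i, min_comm k i, min_comm k j]
  simp only [dist_self, min_self]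
  ring

/-- The exponential moments of combinations of two values of the field. -/
theorem lintegral_exp_two (h : IsScaleField P κ Y) (a b e : ℝ) (i j : ℕ) (x y : Plane) :
    ∫⁻ ω, ENNReal.ofReal (Real.exp (a * Y i x ω + b * Y j y ω + e)) ∂P
      = ENNReal.ofReal (Real.exp
        ((a ^ 2 * κ i 0 + b ^ 2 * κ j 0) / 2 + a * b * κ (min i j) (dist x y) + e)) := by
  have := h.lintegral_exp_three a b 0 e i j 0 x y 0
  simpa using this

theorem measurable_uncurry (h : IsScaleField P κ Y) (n : ℕ) :
    Measurable (Function.uncurry (Y n)) :=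
  measurable_uncurry_of_continuous_of_measurable (h.continuous n) (h.measurable n)

theorem measurable_expWeight (h : IsScaleField P κ Y) (q : ℝ) (n : ℕ) :
    Measurable (fun p : Plane × Ω => expWeight κ Y q n p.1 p.2) := by
  have := h.measurable_uncurry n
  unfold expWeight
  exact (Real.measurable_exp.comp ((this.const_mul q).sub_const _)).ennreal_ofReal

theorem measurable_expWeight_right (h : IsScaleField P κ Y) (q : ℝ) (n : ℕ) (x : Plane) :
    Measurable (expWeight κ Y q n x) :=
  (h.measurable_expWeight q n).comp measurable_prodMk_left

theorem measurable_expWeight_left (h : IsScaleField P κ Y) (q : ℝ) (n : ℕ) (ω : Ω) :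
    Measurable (fun x => expWeight κ Y q n x ω) :=
  (h.measurable_expWeight q n).comp measurable_prodMk_right

theorem lintegral_expWeight (h : IsScaleField P κ Y) (q : ℝ) (n : ℕ) (x : Plane) :
    ∫⁻ ω, expWeight κ Y q n x ω ∂P = 1 := by
  have := h.lintegral_exp_two q 0 (-(q ^ 2 / 2 * κ n 0)) n n x x
  simp only [expWeight, sub_eq_add_neg]
  simp only [zero_mul, add_zero] at this
  rw [this]
  simp only [ENNReal.ofReal_eq_one, Real.exp_eq_one_iff]
  ring

theorem measurable_chaos_apply (h : IsScaleField P κ Y) (q : ℝ) (ν : Measure Plane) [SFinite ν]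
    (n : ℕ) {A : Set Plane} (hA : MeasurableSet A) :
    Measurable (fun ω => chaos κ Y q ν n ω A) := by
  simp only [chaos, withDensity_apply _ hA]
  exact Measurable.lintegral_prod_left (h.measurable_expWeight q n)

/-- Fubini for the expectation of a chaos against a nonnegative weight. -/
theorem lintegral_mul_chaos (h : IsScaleField P κ Y) (q : ℝ) (ν : Measure Plane) [SFinite ν]
    (n : ℕ) {A : Set Plane} (hA : MeasurableSet A) {f : Ω → ℝ≥0∞} (hf : Measurable f) :
    ∫⁻ ω, f ω * chaos κ Y q ν n ω A ∂P = ∫⁻ x in A, ∫⁻ ω, f ω * expWeight κ Y q n x ω ∂P ∂ν := by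
  have := h.isProbabilityMeasure
  rw [lintegral_lintegral_swap]
  · refine lintegral_congr fun ω => ?_
    rw [chaos, withDensity_apply _ hA, lintegral_const_mul _ (h.measurable_expWeight_left q n ω)]
  · exact ((hf.comp measurable_snd).mul (h.measurable_expWeight q n)).aemeasurable

theorem lintegral_chaos (h : IsScaleField P κ Y) (q : ℝ) (ν : Measure Plane) [SFinite ν]
    (n : ℕ) {A : Set Plane} (hA : MeasurableSet A) :
    ∫⁻ ω, chaos κ Y q ν n ω A ∂P = ν A := by
  have := h.lintegral_mul_chaos q ν n hA (f := fun _ => 1) measurable_const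
  simpa [h.lintegral_expWeight] using this

/-- The increments above level `m` form a scale field. -/
theorem increments (h : IsScaleField P κ Y) (m : ℕ) :
    IsScaleField P (fun n d => κ (n + m) d - κ m d) (fun n x ω => Y (n + m) x ω - Y m x ω) where
  gaussian := by
    classical
    refine h.gaussian.of_linear_combinations fun s => ⟨{(s.1 + m, s.2), (m, s.2)},
      { toFun := fun f => f ⟨(s.1 + m, s.2), by simp⟩ - f ⟨(m, s.2), by simp⟩
        map_add' := fun f g => by simp; abel
        map_smul' := fun c f => by simp; ring
        cont := by fun_prop }, by simp⟩
  measurable n x := (h.measurable _ x).sub (h.measurable _ x)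
  continuous n ω := (h.continuous _ ω).sub (h.continuous _ ω)
  centered n x := by
    have := h.isProbabilityMeasure
    rw [integral_sub ((h.memLp_two _ _).integrable one_le_two)
      ((h.memLp_two _ _).integrable one_le_two), h.centered, h.centered, sub_zero]
  covariance i j x y := by
    have hi : ∀ a b, Integrable (fun ω => Y a x ω * Y b y ω) P := fun a b =>
      (h.memLp_two a x).integrable_mul (h.memLp_two b y)
    have hi2 : ∀ a b c d, Integrable (fun ω => Y a x ω * Y b y ω - Y c x ω * Y d y ω) P :=
      fun a b c d => (hi a b).sub (hi c d)
    have : ∀ ω, (Y (i + m) x ω - Y m x ω) * (Y (j + m) y ω - Y m y ω)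
        = (Y (i + m) x ω * Y (j + m) y ω - Y (i + m) x ω * Y m y ω)
          - (Y m x ω * Y (j + m) y ω - Y m x ω * Y m y ω) := fun ω => by ring
    simp_rw [this]
    rw [integral_sub (hi2 _ _ _ _) (hi2 _ _ _ _),
      integral_sub (hi _ _) (hi _ _), integral_sub (hi _ _) (hi _ _)]
    simp only [h.covariance, min_add_add_right, min_self]
    rw [min_eq_right (Nat.le_add_left m i), min_eq_left (Nat.le_add_left m j)]
    ring

/-- Restriction of a scale field to a monotone sequence of levels. -/
theorem comp_monotone (h : IsScaleField P κ Y) {τ : ℕ → ℕ} (hτ : Monotone τ) :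
    IsScaleField P (fun n => κ (τ n)) (fun n => Y (τ n)) where
  gaussian := h.gaussian.comp_right (fun p : ℕ × Plane => (τ p.1, p.2))
  measurable n x := h.measurable _ x
  continuous n ω := h.continuous _ ω
  centered n x := h.centered _ x
  covariance i j x y := by rw [h.covariance, hτ.map_min]

end IsScaleField

/-! ### Logarithmic kernels and moments of the chaos. -/

/-- The covariances `κ n` approximate `L * log₂ (r₀ / d)` down to scale `r₀ / 2 ^ n`, up to the
additive constant `C`. -/
structure LogKernel (L C r₀ : ℝ) (κ : ℕ → ℝ → ℝ) : Prop where
  L_nonneg : 0 ≤ L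
  C_nonneg : 0 ≤ C
  r₀_pos : 0 < r₀
  upper : ∀ n d, 0 ≤ d → κ n d ≤ n * L + C
  upper_off : ∀ (j n : ℕ) (d : ℝ), j ≤ n → r₀ / 2 ^ j ≤ d → κ n d ≤ j * L + C
  -- The margin 4 lets a ball of radius `4 * (r₀ / 2 ^ j)` be treated at level `j`, the form in
  -- which balls and annuli occur below.
  lower : ∀ (j : ℕ) (d : ℝ), 0 ≤ d → d < 4 * (r₀ / 2 ^ j) → j * L - C ≤ κ j d

theorem ENNReal.ofReal_exp_rpow (a s : ℝ) :
    ENNReal.ofReal (Real.exp a) ^ s = ENNReal.ofReal (Real.exp (a * s)) := by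
  rw [ENNReal.ofReal_rpow_of_pos (Real.exp_pos _), Real.exp_mul]

theorem ENNReal.ofReal_exp_mul (a b : ℝ) :
    ENNReal.ofReal (Real.exp a) * ENNReal.ofReal (Real.exp b)
      = ENNReal.ofReal (Real.exp (a + b)) := by
  rw [← ENNReal.ofReal_mul (Real.exp_pos _).le, Real.exp_add]

namespace IsScaleField

variable {Ω : Type*} [MeasurableSpace Ω] {P : Measure Ω} {κ : ℕ → ℝ → ℝ}
  {Y : ℕ → Plane → Ω → ℝ} {L C r₀ : ℝ}

/-- Fractional moments of the chaos of a small set, weighted by the exponential of the field at a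
nearby point. -/
theorem lintegral_expWeight_mul_chaos_rpow (h : IsScaleField P κ Y) (hκ : LogKernel L C r₀ κ)
    {q w s : ℝ} (hq : q ∈ Icc 0 1) (hw : w ∈ Icc 0 1) (hs : s ∈ Ioo 0 1) (ν : Measure Plane)
    [SFinite ν] {A : Set Plane} (hA : MeasurableSet A) (x : Plane) {j n : ℕ} (hjn : j ≤ n)
    (hAx : ∀ y ∈ A, dist x y < 4 * (r₀ / 2 ^ j))
    -- The factor `w` makes this condition void for `w = 0`, the case of moments under `P` itself.
    (hAw : ∀ y ∈ A, w * κ n (dist x y) ≤ w * (j * L + C)) :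
    ∫⁻ ω, expWeight κ Y w n x ω * chaos κ Y q ν n ω A ^ s ∂P
      ≤ ENNReal.ofReal (Real.exp ((s * w * q - s * (1 - s) * q ^ 2 / 2) * (j * L) + 6 * C))
        * ν A ^ s := by
  obtain ⟨hq0, hq1⟩ := hq
  obtain ⟨hw0, hw1⟩ := hw
  obtain ⟨hs0, hs1⟩ := hs
  have hC := hκ.C_nonneg
  have hr : 0 < r₀ / 2 ^ j := div_pos hκ.r₀_pos (by positivity)
  have hv1 : κ j 0 ≤ j * L + C := hκ.upper j 0 le_rfl
  have hv2 : j * L - C ≤ κ j 0 := hκ.lower j 0 le_rfl (by linarith)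
  -- The level-`j` field at `x` stands for the part common to all points of `A`. It is inserted with
  -- exponents `-(1 - s) * q` in `u` and `s * q` in `g`, so that it cancels in `f ^ s * g ^ (1 -
  -- s)`. Hölder's inequality then yields the sharp exponent, and replacing the field on `A` by its
  -- value at `x` costs only a multiple of `C`.
  set u : Ω → ℝ≥0∞ := fun ω => ENNReal.ofReal
    (Real.exp (w * Y n x ω + (-((1 - s) * q)) * Y j x ω + -(w ^ 2 / 2 * κ n 0))) with hu
  set f : Ω → ℝ≥0∞ := fun ω => u ω * chaos κ Y q ν n ω A with hf
  set g : Ω → ℝ≥0∞ := fun ω => ENNReal.ofReal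
    (Real.exp (w * Y n x ω + (s * q) * Y j x ω + -(w ^ 2 / 2 * κ n 0))) with hg
  have hYn := h.measurable n x
  have hYj := h.measurable j x
  have hum : Measurable u := by
    rw [hu]; fun_prop
  have hgm : Measurable g := by
    rw [hg]; fun_prop
  have hfm : Measurable f := hum.mul (h.measurable_chaos_apply q ν n hA)
  have hfg : ∀ ω, expWeight κ Y w n x ω * chaos κ Y q ν n ω A ^ s = f ω ^ s * g ω ^ (1 - s) := by
    intro ω
    rw [hf, hg, hu]
    simp only
    rw [ENNReal.mul_rpow_of_nonneg _ _ hs0.le, ENNReal.ofReal_exp_rpow, ENNReal.ofReal_exp_rpow,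
      mul_right_comm, ENNReal.ofReal_exp_mul, expWeight]
    congr 3
    ring
  simp_rw [hfg]
  refine (ENNReal.lintegral_mul_norm_pow_le hfm.aemeasurable hgm.aemeasurable hs0.le
    (by linarith) (by ring)).trans ?_
  have h1 : ∫⁻ ω, f ω ∂P ≤ ENNReal.ofReal (Real.exp
      (((1 - s) ^ 2 * q ^ 2 / 2 + w * q - w * (1 - s) * q - (1 - s) * q ^ 2) * (j * L) + 4 * C))
      * ν A := by
    rw [hf, h.lintegral_mul_chaos q ν n hA hum, ← setLIntegral_const]
    refine setLIntegral_mono' hA fun y hy => ?_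
    have : ∀ ω, u ω * expWeight κ Y q n y ω = ENNReal.ofReal (Real.exp
        (w * Y n x ω + (-((1 - s) * q)) * Y j x ω + q * Y n y ω
          + (-(w ^ 2 / 2 * κ n 0) - q ^ 2 / 2 * κ n 0))) := by
      intro ω
      rw [hu, expWeight, ENNReal.ofReal_exp_mul]
      congr 2
      ring
    simp_rw [this]
    rw [h.lintegral_exp_three]
    apply ENNReal.ofReal_le_ofReal
    apply Real.exp_le_exp.2
    rw [min_eq_right hjn, min_eq_left hjn, min_self, dist_self]
    have e1 := hAw y hy
    have e2 := hκ.lower j (dist x y) dist_nonneg (hAx y hy)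
    have e3 : q * (w * κ n (dist x y)) ≤ q * (w * (j * L + C)) := mul_le_mul_of_nonneg_left e1 hq0
    have e4 : (1 - s) * q ^ 2 * (j * L - C) ≤ (1 - s) * q ^ 2 * κ j (dist x y) :=
      mul_le_mul_of_nonneg_left e2 (by have : 0 ≤ 1 - s := by linarith
                                       positivity)
    have e5 : w * ((1 - s) * q) * (j * L - C) ≤ w * ((1 - s) * q) * κ j 0 :=
      mul_le_mul_of_nonneg_left hv2 (by have : 0 ≤ 1 - s := by linarith
                                        positivity)
    have e6 : ((1 - s) * q) ^ 2 / 2 * κ j 0 ≤ ((1 - s) * q) ^ 2 / 2 * (j * L + C) :=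
      mul_le_mul_of_nonneg_left hv1 (by positivity)
    have b1 : (1 - s) * q ≤ 1 := mul_le_one₀ (by linarith) hq0 hq1
    have b0 : 0 ≤ (1 - s) * q := mul_nonneg (by linarith) hq0
    have b2 : ((1 - s) * q) ^ 2 ≤ 1 := pow_le_one₀ b0 b1
    have b3 : w * q ≤ 1 := mul_le_one₀ hw1 hq0 hq1
    have b4 : w * ((1 - s) * q) ≤ 1 := mul_le_one₀ hw1 b0 b1
    have b5 : (1 - s) * q * q ≤ 1 := mul_le_one₀ b1 hq0 hq1
    have c2 := mul_le_mul_of_nonneg_right b2 hC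
    have c3 := mul_le_mul_of_nonneg_right b3 hC
    have c4 := mul_le_mul_of_nonneg_right b4 hC
    have c5 := mul_le_mul_of_nonneg_right b5 hC
    linarith
  have h2 : ∫⁻ ω, g ω ∂P ≤ ENNReal.ofReal (Real.exp
      ((s ^ 2 * q ^ 2 / 2 + w * s * q) * (j * L) + 2 * C)) := by
    rw [hg, h.lintegral_exp_two]
    apply ENNReal.ofReal_le_ofReal
    apply Real.exp_le_exp.2
    rw [min_eq_right hjn, dist_self]
    have b1 : s * q ≤ 1 := mul_le_one₀ hs1.le hq0 hq1
    have b0 : 0 ≤ s * q := mul_nonneg hs0.le hq0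
    have b2 : (s * q) ^ 2 ≤ 1 := pow_le_one₀ b0 b1
    have b3 : w * (s * q) ≤ 1 := mul_le_one₀ hw1 b0 b1
    have c2 := mul_le_mul_of_nonneg_right b2 hC
    have c3 := mul_le_mul_of_nonneg_right b3 hC
    have e6 : (s * q) ^ 2 / 2 * κ j 0 ≤ (s * q) ^ 2 / 2 * (j * L + C) :=
      mul_le_mul_of_nonneg_left hv1 (by positivity)
    have e7 : w * (s * q) * κ j 0 ≤ w * (s * q) * (j * L + C) :=
      mul_le_mul_of_nonneg_left hv1 (by positivity)
    linarith
  refine (mul_le_mul' (ENNReal.rpow_le_rpow h1 hs0.le)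
    (ENNReal.rpow_le_rpow h2 (by linarith : 0 ≤ 1 - s))).trans ?_
  rw [ENNReal.mul_rpow_of_nonneg _ _ hs0.le, ENNReal.ofReal_exp_rpow, ENNReal.ofReal_exp_rpow,
    mul_right_comm, ENNReal.ofReal_exp_mul]
  refine mul_le_mul' (ENNReal.ofReal_le_ofReal (Real.exp_le_exp.2 ?_)) le_rfl
  have h3 : s * (4 * C) + (1 - s) * (2 * C) ≤ 6 * C := by
    linarith [mul_le_mul_of_nonneg_right hs1.le hC]
  linear_combination h3

end IsScaleField

namespace IsScaleField

variable {Ω : Type*} [MeasurableSpace Ω] {P : Measure Ω} {κ : ℕ → ℝ → ℝ}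
  {Y : ℕ → Plane → Ω → ℝ} {L C r₀ : ℝ}

/-- Fractional moments of the chaos of a ball, weighted by the exponential of the field at its
centre. -/
theorem lintegral_expWeight_mul_chaos_ball_rpow (h : IsScaleField P κ Y)
    (hκ : LogKernel L C r₀ κ) {q θ t D b : ℝ} (hq : q ∈ Icc 0 1) (hθ : θ ∈ Ioo 0 1)
    (hD : 0 ≤ D) (ν : Measure Plane) [SFinite ν] (x : Plane)
    (hν : ∀ r, 0 < r → ν (Metric.ball x r) ≤ ENNReal.ofReal (D * r ^ t))
    (hb : b = t * Real.log 2 - q ^ 2 * (1 + θ) / 2 * L) (hb0 : 0 < b) {k n : ℕ} (hkn : k ≤ n) :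
    ∫⁻ ω, expWeight κ Y q n x ω * chaos κ Y q ν n ω (Metric.ball x (4 * (r₀ / 2 ^ k))) ^ θ ∂P
      ≤ ENNReal.ofReal (Real.exp (6 * C) * (D * (4 * r₀) ^ t) ^ θ
          * Real.exp (-(θ * b)) ^ k / (1 - Real.exp (-(θ * b)))) := by
  have hθ0 := hθ.1
  have hr₀ := hκ.r₀_pos
  set ρ := Real.exp (-(θ * b)) with hρ
  have hρ0 : 0 < ρ := Real.exp_pos _
  have hρ1 : ρ < 1 := Real.exp_lt_one_iff.2 (neg_neg_of_pos (mul_pos hθ0 hb0))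
  set c := Real.exp (6 * C) * (D * (4 * r₀) ^ t) ^ θ with hc
  have hc0 : 0 ≤ c := by positivity
  -- With `w = q` and `s = θ` the exponential factor grows by `θ q² (1 + θ) / 2 * L` per level,
  -- while the bound on `ν A ^ θ` loses `θ t log 2`. The balance is the ratio `ρ`.
  have key : ∀ j ≤ n, ∀ A : Set Plane, MeasurableSet A → A ⊆ Metric.ball x (4 * (r₀ / 2 ^ j)) →
      (∀ y ∈ A, κ n (dist x y) ≤ j * L + C) →
      ∫⁻ ω, expWeight κ Y q n x ω * chaos κ Y q ν n ω A ^ θ ∂P ≤ ENNReal.ofReal (c * ρ ^ j) := by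
    intro j hj A hA hAs hAκ
    have hrj : 0 < r₀ / 2 ^ j := by positivity
    refine (h.lintegral_expWeight_mul_chaos_rpow hκ hq hq hθ ν hA x hj
      (fun y hy => by simpa [dist_comm] using hAs hy)
      (fun y hy => mul_le_mul_of_nonneg_left (hAκ y hy) hq.1)).trans ?_
    have h1 : ν A ^ θ ≤ ENNReal.ofReal ((D * (4 * (r₀ / 2 ^ j)) ^ t) ^ θ) := by
      rw [← ENNReal.ofReal_rpow_of_nonneg (by positivity) hθ0.le]
      exact ENNReal.rpow_le_rpow ((measure_mono hAs).trans (hν _ (by positivity))) hθ0.le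
    refine (mul_le_mul' le_rfl h1).trans ?_
    rw [← ENNReal.ofReal_mul (Real.exp_pos _).le]
    apply ENNReal.ofReal_le_ofReal
    apply le_of_eq
    have h2 : 4 * (r₀ / 2 ^ j) = (4 * r₀) * Real.exp (-(j * Real.log 2)) := by
      rw [Real.exp_neg, mul_comm (j : ℝ), Real.exp_mul, Real.exp_log two_pos, Real.rpow_natCast]
      field_simp
    rw [h2, Real.mul_rpow (by positivity) (Real.exp_pos _).le, ← Real.exp_mul, ← mul_assoc D,
      Real.mul_rpow (by positivity) (Real.exp_pos _).le, ← Real.exp_mul, hc, hρ, ← Real.exp_nat_mul,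
      mul_left_comm, ← Real.exp_add, mul_right_comm (Real.exp _), ← Real.exp_add,
      mul_comm (Real.exp _)]
    congr 2
    rw [hb]
    ring
  -- Downward induction on `k`. A ball is the next smaller ball and an annulus on which the
  -- covariance with the centre stops at level `k`. As `θ ≤ 1`, the power `θ` is subadditive, and
  -- the annuli sum to a geometric series.
  have step : ∀ i k, k + i = n →
      ∫⁻ ω, expWeight κ Y q n x ω * chaos κ Y q ν n ω (Metric.ball x (4 * (r₀ / 2 ^ k))) ^ θ ∂P
        ≤ ENNReal.ofReal (c * ρ ^ k / (1 - ρ)) := by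
    intro i
    induction i with
    | zero =>
      intro k hk
      obtain rfl : k = n := by omega
      refine (key k le_rfl _ measurableSet_ball subset_rfl
        (fun y _ => hκ.upper k _ dist_nonneg)).trans ?_
      apply ENNReal.ofReal_le_ofReal
      rw [le_div_iff₀ (by linarith)]
      have : 0 ≤ c * ρ ^ k := by positivity
      nlinarith
    | succ i ih =>
      intro k hk
      have h1 := ih (k + 1) (by omega)
      set B := Metric.ball x (4 * (r₀ / 2 ^ k))
      set B' := Metric.ball x (4 * (r₀ / 2 ^ (k + 1)))
      have h2 := key k (by omega) (B \ B') (measurableSet_ball.diff measurableSet_ball)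
        sdiff_subset (fun y hy => hκ.upper_off k n _ (by omega) (by
          have := hy.2
          simp only [B', Metric.mem_ball, not_lt, dist_comm y x] at this
          refine le_trans ?_ this
          have : 4 * (r₀ / 2 ^ (k + 1)) = 2 * (r₀ / 2 ^ k) := by rw [pow_succ]; field_simp; ring
          have : 0 < r₀ / 2 ^ k := by positivity
          linarith))
      have h3 : ∀ ω, expWeight κ Y q n x ω * chaos κ Y q ν n ω B ^ θ
          ≤ expWeight κ Y q n x ω * chaos κ Y q ν n ω B' ^ θ
            + expWeight κ Y q n x ω * chaos κ Y q ν n ω (B \ B') ^ θ := by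
        intro ω
        rw [← mul_add]
        refine mul_le_mul' le_rfl ?_
        refine le_trans (ENNReal.rpow_le_rpow ?_ hθ0.le)
          (ENNReal.rpow_add_le_add_rpow _ _ hθ0.le hθ.2.le)
        exact (measure_mono (by rw [union_sdiff_self]; exact subset_union_right)).trans
          (measure_union_le _ _)
      refine (lintegral_mono h3).trans ?_
      rw [lintegral_add_left]
      · refine (add_le_add h1 h2).trans ?_
        rw [← ENNReal.ofReal_add (div_nonneg (by positivity) (by linarith)) (by positivity)]
        apply ENNReal.ofReal_le_ofReal
        apply le_of_eq
        have : 1 - ρ ≠ 0 := by linarith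
        field_simp
        ring
      · exact (h.measurable_expWeight_right q n x).mul
          ((h.measurable_chaos_apply q ν n measurableSet_ball).pow_const _)
  exact step (n - k) k (by omega)

/-- Moments of order `1 + θ` of the chaos of a set of diameter less than `4 r₀ / 2 ^ k`. -/
theorem lintegral_chaos_rpow_one_add (h : IsScaleField P κ Y)
    (hκ : LogKernel L C r₀ κ) {q θ t D b : ℝ} (hq : q ∈ Icc 0 1) (hθ : θ ∈ Ioo 0 1)
    (hD : 0 ≤ D) (ν : Measure Plane) [SFinite ν] {S : Set Plane} (hS : MeasurableSet S)
    (hν : ∀ x ∈ S, ∀ r, 0 < r → ν (Metric.ball x r) ≤ ENNReal.ofReal (D * r ^ t))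
    (hb : b = t * Real.log 2 - q ^ 2 * (1 + θ) / 2 * L) (hb0 : 0 < b) {k n : ℕ} (hkn : k ≤ n)
    (hSk : ∀ x ∈ S, S ⊆ Metric.ball x (4 * (r₀ / 2 ^ k))) :
    ∫⁻ ω, chaos κ Y q ν n ω S ^ (1 + θ) ∂P
      ≤ ENNReal.ofReal (Real.exp (6 * C) * (D * (4 * r₀) ^ t) ^ θ
          * Real.exp (-(θ * b)) ^ k / (1 - Real.exp (-(θ * b)))) * ν S := by
  -- Fubini turns one factor of the mass into an integral over `x` under the tilt at `x`. The other
  -- factor is bounded by the mass of a ball centred at `x`.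
  have h1 : ∀ ω, chaos κ Y q ν n ω S ^ (1 + θ) = chaos κ Y q ν n ω S ^ θ * chaos κ Y q ν n ω S := by
    intro ω
    rw [add_comm, ENNReal.rpow_add_of_nonneg _ _ hθ.1.le zero_le_one, ENNReal.rpow_one]
  simp_rw [h1]
  rw [h.lintegral_mul_chaos q ν n hS ((h.measurable_chaos_apply q ν n hS).pow_const _),
    ← setLIntegral_const]
  refine setLIntegral_mono' hS fun x hx => ?_
  refine le_trans (lintegral_mono fun ω => ?_)
    (h.lintegral_expWeight_mul_chaos_ball_rpow hκ hq hθ hD ν x (hν x hx) hb hb0 hkn)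
  rw [mul_comm]
  exact mul_le_mul' le_rfl (ENNReal.rpow_le_rpow (measure_mono (hSk x hx)) hθ.1.le)

end IsScaleField

/-! ### Independence of scales and martingale convergence. -/

theorem chaos_apply {Ω : Type*} (κ : ℕ → ℝ → ℝ) (Y : ℕ → Plane → Ω → ℝ) (q : ℝ)
    (ν : Measure Plane) (n : ℕ) (ω : Ω) {A : Set Plane} (hA : MeasurableSet A) :
    chaos κ Y q ν n ω A = ∫⁻ x in A, expWeight κ Y q n x ω ∂ν :=
  withDensity_apply _ hA

/-- Measurability of the chaos of `A` with respect to any `σ`-algebra that makes the values of the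
field on `A` measurable. -/
theorem measurable_chaos_of_continuous {Ω : Type*} {m : MeasurableSpace Ω} (κ : ℕ → ℝ → ℝ)
    {Y : ℕ → Plane → Ω → ℝ} (q : ℝ) (ν : Measure Plane) (n : ℕ) {A : Set Plane}
    (hA : MeasurableSet A) (hνA : ν A ≠ ∞) (hm : ∀ x ∈ A, Measurable (Y n x))
    (hc : ∀ ω, Continuous (fun x => Y n x ω)) :
    Measurable (fun ω => chaos κ Y q ν n ω A) := by
  have : Fact (ν A < ∞) := ⟨hνA.lt_top⟩
  -- The integral is moved to the subtype, because only the values of the field at points of `A` are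
  -- assumed measurable.
  have h1 : ∀ ω, chaos κ Y q ν n ω A
      = ∫⁻ x : A, expWeight κ Y q n x ω ∂((ν.restrict A).comap Subtype.val) := by
    intro ω
    rw [lintegral_subtype_comap hA (fun x => expWeight κ Y q n x ω),
      Measure.restrict_restrict hA, inter_self, chaos_apply _ _ _ _ _ _ hA]
  simp_rw [h1]
  have h2 : Measurable (Function.uncurry fun (x : A) (ω : Ω) => Y n x ω) :=
    measurable_uncurry_of_continuous_of_measurable
      (fun ω => (hc ω).comp continuous_subtype_val) (fun x => hm x x.2)
  refine Measurable.lintegral_prod_left (f := fun (x : A) (ω : Ω) => expWeight κ Y q n x ω) ?_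
  unfold expWeight
  exact (Real.measurable_exp.comp ((h2.const_mul q).sub_const _)).ennreal_ofReal

theorem expWeight_add {Ω : Type*} (κ : ℕ → ℝ → ℝ) (Y : ℕ → Plane → Ω → ℝ) (q : ℝ) (k n : ℕ)
    (x : Plane) (ω : Ω) : expWeight κ Y q (k + n) x ω = expWeight κ Y q n x ω *
      expWeight (fun i d => κ (i + n) d - κ n d) (fun i x ω => Y (i + n) x ω - Y n x ω) q k x ω := by
  rw [expWeight, expWeight, expWeight, ENNReal.ofReal_exp_mul]
  congr 2
  ring

/-- The `σ`-algebra of the fields up to level `n`. -/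
@[reducible] def fieldPast {Ω : Type*} (Y : ℕ → Plane → Ω → ℝ) (n : ℕ) : MeasurableSpace Ω :=
  MeasurableSpace.comap (fun ω (p : Iic n × Plane) => Y p.1 p.2 ω) inferInstance

/-- The `σ`-algebra of the increments above level `n`. -/
@[reducible] def fieldFuture {Ω : Type*} (Y : ℕ → Plane → Ω → ℝ) (n : ℕ) : MeasurableSpace Ω :=
  MeasurableSpace.comap (fun ω (p : ℕ × Plane) => Y (p.1 + n) p.2 ω - Y n p.2 ω) inferInstance

theorem measurable_fieldPast {Ω : Type*} (Y : ℕ → Plane → Ω → ℝ) {j n : ℕ} (hj : j ≤ n)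
    (x : Plane) : Measurable[fieldPast Y n] (Y j x) :=
  Measurable.comp (g := fun f : Iic n × Plane → ℝ => f (⟨j, hj⟩, x)) (measurable_pi_apply _)
    (comap_measurable fun ω (p : Iic n × Plane) => Y p.1 p.2 ω)

theorem measurable_fieldFuture {Ω : Type*} (Y : ℕ → Plane → Ω → ℝ) (j n : ℕ)
    (x : Plane) : Measurable[fieldFuture Y n] (fun ω => Y (j + n) x ω - Y n x ω) :=
  Measurable.comp (g := fun f : ℕ × Plane → ℝ => f (j, x)) (measurable_pi_apply _)
    (comap_measurable fun ω (p : ℕ × Plane) => Y (p.1 + n) p.2 ω - Y n p.2 ω)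

theorem fieldPast_mono {Ω : Type*} (Y : ℕ → Plane → Ω → ℝ) : Monotone (fieldPast Y) := by
  intro m n hmn
  refine (@measurable_iff_comap_le _ _ (fieldPast Y n) _ _).1 ?_
  refine @measurable_pi_lambda _ _ _ (fieldPast Y n) _ _ fun p => ?_
  exact measurable_fieldPast Y (le_trans p.1.2 hmn) p.2

namespace IsScaleField

variable {Ω : Type*} [mΩ : MeasurableSpace Ω] {P : Measure Ω} {κ : ℕ → ℝ → ℝ}
  {Y : ℕ → Plane → Ω → ℝ} {L C r₀ : ℝ}

theorem fieldPast_le (h : IsScaleField P κ Y) (n : ℕ) : fieldPast Y n ≤ mΩ :=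
  Measurable.comap_le (measurable_pi_iff.2 fun p => h.measurable p.1 p.2)

theorem fieldFuture_le (h : IsScaleField P κ Y) (n : ℕ) : fieldFuture Y n ≤ mΩ :=
  Measurable.comap_le (measurable_pi_iff.2 fun p =>
    (h.measurable (p.1 + n) p.2).sub (h.measurable n p.2))

theorem indep_past_future (h : IsScaleField P κ Y) (n : ℕ) :
    Indep (fieldPast Y n) (fieldFuture Y n) P := by
  have hP := h.isProbabilityMeasure
  refine (IndepFun_iff_Indep _ _ _).1 ?_
  -- Jointly Gaussian families are independent when uncorrelated. A covariance depends only on the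
  -- lower of the two levels, so it cancels between `Y (p.1 + n)` and `Y n`.
  refine IsGaussianProcess.indepFun_of_covariance_eq_zero
    (X := fun (p : Iic n × Plane) ω => Y p.1 p.2 ω)
    (Y := fun (p : ℕ × Plane) ω => Y (p.1 + n) p.2 ω - Y n p.2 ω) ?_ ?_ ?_ ?_
  · classical
    refine h.gaussian.of_linear_combinations fun s => ?_
    rcases s with s | s
    · exact ⟨{((s.1 : ℕ), s.2)}, ContinuousLinearMap.proj ⟨((s.1 : ℕ), s.2), by simp⟩, by simp⟩
    · exact ⟨{(s.1 + n, s.2), (n, s.2)},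
        ContinuousLinearMap.proj (R := ℝ) (φ := fun _ => ℝ) ⟨(s.1 + n, s.2), by simp⟩
          - ContinuousLinearMap.proj (R := ℝ) (φ := fun _ => ℝ) ⟨(n, s.2), by simp⟩, by simp⟩
  · exact fun p => (h.measurable _ _).aemeasurable
  · exact fun p => ((h.measurable _ _).sub (h.measurable _ _)).aemeasurable
  · intro s t
    have := covariance_fun_sub_right (h.memLp_two s.1 s.2) (h.memLp_two (t.1 + n) t.2)
      (h.memLp_two n t.2)
    refine this.trans ?_
    have hs : (s.1 : ℕ) ≤ n := s.1.2
    rw [h.cov_eq, h.cov_eq, min_eq_left hs, min_eq_left (hs.trans (Nat.le_add_left _ _)), sub_self]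

/-- The martingale property of the chaos. -/
theorem lintegral_mul_chaos_succ (h : IsScaleField P κ Y) (q : ℝ) (ν : Measure Plane) [SFinite ν]
    (k n : ℕ) {A : Set Plane} (hA : MeasurableSet A) {f : Ω → ℝ≥0∞}
    (hf : Measurable[fieldPast Y n] f) :
    ∫⁻ ω, f ω * chaos κ Y q ν (k + n) ω A ∂P = ∫⁻ ω, f ω * chaos κ Y q ν n ω A ∂P := by
  have hf' : Measurable f := hf.mono (h.fieldPast_le n) le_rfl
  rw [h.lintegral_mul_chaos q ν _ hA hf', h.lintegral_mul_chaos q ν _ hA hf']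
  refine lintegral_congr fun x => ?_
  simp_rw [expWeight_add κ Y q k n, ← mul_assoc]
  rw [lintegral_mul_eq_lintegral_mul_lintegral_of_independent_measurableSpace (h.fieldPast_le n)
    (h.fieldFuture_le n) (h.indep_past_future n), (h.increments n).lintegral_expWeight, mul_one]
  · refine hf.mul ?_
    have := measurable_fieldPast Y (le_refl n) x
    unfold expWeight
    exact (Real.measurable_exp.comp ((this.const_mul q).sub_const _)).ennreal_ofReal
  · have := measurable_fieldFuture Y k n x
    unfold expWeight
    exact (Real.measurable_exp.comp ((this.const_mul q).sub_const _)).ennreal_ofReal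

/-- The filtration generated by the fields. -/
def filtration (h : IsScaleField P κ Y) : Filtration ℕ mΩ where
  seq := fieldPast Y
  mono' := fieldPast_mono Y
  le' := h.fieldPast_le

theorem integrable_chaos (h : IsScaleField P κ Y) (q : ℝ) (ν : Measure Plane) [IsFiniteMeasure ν]
    (n : ℕ) {A : Set Plane} (hA : MeasurableSet A) :
    Integrable (fun ω => (chaos κ Y q ν n ω A).toReal) P :=
  integrable_toReal_of_lintegral_ne_top (h.measurable_chaos_apply q ν n hA).aemeasurable
    (by rw [h.lintegral_chaos q ν n hA]; exact measure_ne_top _ _)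

theorem ae_chaos_lt_top (h : IsScaleField P κ Y) (q : ℝ) (ν : Measure Plane) [IsFiniteMeasure ν]
    (n : ℕ) {A : Set Plane} (hA : MeasurableSet A) : ∀ᵐ ω ∂P, chaos κ Y q ν n ω A < ∞ :=
  ae_lt_top (h.measurable_chaos_apply q ν n hA)
    (by rw [h.lintegral_chaos q ν n hA]; exact measure_ne_top _ _)

/-- `lintegral_mul_chaos_succ`, tested on indicators of past events, is the defining identity of the
conditional expectation. -/
theorem martingale_chaos (h : IsScaleField P κ Y) (q : ℝ) (ν : Measure Plane) [IsFiniteMeasure ν]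
    {A : Set Plane} (hA : MeasurableSet A) :
    Martingale (fun n ω => (chaos κ Y q ν n ω A).toReal) h.filtration P := by
  have hP := h.isProbabilityMeasure
  have hm : ∀ n, Measurable[fieldPast Y n] (fun ω => chaos κ Y q ν n ω A) := fun n =>
    measurable_chaos_of_continuous (m := fieldPast Y n) κ q ν n hA (measure_ne_top _ _)
      (fun x _ => measurable_fieldPast Y le_rfl x) (h.continuous n)
  refine martingale_nat (fun n => (hm n).ennreal_toReal.stronglyMeasurable)
    (fun n => h.integrable_chaos q ν n hA) (fun n => ?_)
  refine ae_eq_condExp_of_forall_setIntegral_eq (h.fieldPast_le n) (h.integrable_chaos q ν (n + 1) hA)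
    (fun _ _ _ => (h.integrable_chaos q ν n hA).integrableOn) (fun s hs _ => ?_)
    (hm n).ennreal_toReal.stronglyMeasurable.aestronglyMeasurable
  have hs' : MeasurableSet s := h.fieldPast_le n s hs
  have key : ∀ k, ∫ ω in s, (chaos κ Y q ν k ω A).toReal ∂P
      = (∫⁻ ω, s.indicator 1 ω * chaos κ Y q ν k ω A ∂P).toReal := by
    intro k
    rw [integral_toReal (h.measurable_chaos_apply q ν k hA).aemeasurable
      (ae_restrict_of_ae (h.ae_chaos_lt_top q ν k hA)), ← lintegral_indicator hs']
    congr 1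
    refine lintegral_congr fun ω => ?_
    by_cases hω : ω ∈ s <;> simp [hω]
  rw [key, key, add_comm n 1, h.lintegral_mul_chaos_succ q ν 1 n hA]
  exact (measurable_const (a := (1 : ℝ≥0∞))).indicator hs

/-- The chaos of a set of finite measure converges almost surely. -/
theorem ae_tendsto_chaos (h : IsScaleField P κ Y) (q : ℝ) (ν : Measure Plane) [IsFiniteMeasure ν]
    {A : Set Plane} (hA : MeasurableSet A) :
    ∀ᵐ ω ∂P, ∃ c : ℝ, Tendsto (fun n => (chaos κ Y q ν n ω A).toReal) atTop (𝓝 c) := by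
  have hP := h.isProbabilityMeasure
  have := (h.martingale_chaos q ν hA).submartingale.exists_ae_tendsto_of_bdd
    (R := (ν A).toNNReal) (fun n => ?_)
  · exact this
  · rw [eLpNorm_one_eq_lintegral_enorm, ENNReal.coe_toNNReal (measure_ne_top _ _),
      ← h.lintegral_chaos q ν n hA]
    refine lintegral_mono fun ω => ?_
    rw [Real.enorm_eq_ofReal ENNReal.toReal_nonneg]
    exact ENNReal.ofReal_toReal_le

end IsScaleField

/-! ### Convergence in the space of Radon measures. -/

/-- A sequence of measures whose integrals against compactly supported functions converge has a
Radon limit. -/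
theorem exists_isRadonLimit {μ : ℕ → Measure Plane} (hμ : ∀ n, IsFiniteMeasureOnCompacts (μ n))
    (hconv : ∀ f : Plane → ℝ, Continuous f → HasCompactSupport f →
      ∃ c, Tendsto (fun n => ∫ x, f x ∂(μ n)) atTop (𝓝 c)) : ∃ M, IsRadonLimit μ M := by
  choose! c hc using hconv
  have hc' : ∀ f : C_c(Plane, ℝ), Tendsto (fun n => ∫ x, f x ∂(μ n)) atTop (𝓝 (c f)) :=
    fun f => hc f f.continuous f.hasCompactSupport
  have hi : ∀ (f : C_c(Plane, ℝ)) n, Integrable f (μ n) := fun f n =>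
    f.continuous.integrable_of_hasCompactSupport f.hasCompactSupport
  let Λ₀ : C_c(Plane, ℝ) →ₗ[ℝ] ℝ :=
    { toFun := fun f => c f
      map_add' := fun f g => by
        refine tendsto_nhds_unique (hc' (f + g)) ?_
        refine ((hc' f).add (hc' g)).congr fun n => ?_
        exact (integral_add (hi f n) (hi g n)).symm
      map_smul' := fun a f => by
        refine tendsto_nhds_unique (hc' (a • f)) ?_
        refine ((hc' f).const_mul a).congr fun n => ?_
        exact (integral_const_mul a f).symm }
  let Λ : C_c(Plane, ℝ) →ₚ[ℝ] ℝ := PositiveLinearMap.mk₀ Λ₀ fun f hf =>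
    ge_of_tendsto' (hc' f) fun n => integral_nonneg hf
  refine ⟨RealRMK.rieszMeasure Λ, inferInstance, fun f hf hf' => ?_⟩
  have e : ∫ x, f x ∂(RealRMK.rieszMeasure Λ) = c f :=
    RealRMK.integral_rieszMeasure Λ ⟨⟨f, hf⟩, hf'⟩
  rw [e]
  exact hc f hf hf'

/-- Convergence of the integrals over balls of a dense set of continuous functions implies
convergence against compactly supported functions. -/
theorem exists_tendsto_integral_of_dense {μ : ℕ → Measure Plane}
    (hμ : ∀ n, IsFiniteMeasureOnCompacts (μ n)) {D : Set C(Plane, ℝ)} (hD : Dense D)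
    (hball : ∀ N : ℕ, ∃ c, Tendsto (fun n => (μ n).real (Metric.closedBall 0 N)) atTop (𝓝 c))
    (hconv : ∀ N : ℕ, ∀ g ∈ D, ∃ c,
      Tendsto (fun n => ∫ x in Metric.closedBall 0 N, g x ∂(μ n)) atTop (𝓝 c))
    {f : Plane → ℝ} (hf : Continuous f) (hfc : HasCompactSupport f) :
    ∃ c, Tendsto (fun n => ∫ x, f x ∂(μ n)) atTop (𝓝 c) := by
  obtain ⟨N, hN⟩ : ∃ N : ℕ, tsupport f ⊆ Metric.closedBall 0 N := by
    obtain ⟨r, hr⟩ := hfc.isBounded.subset_closedBall 0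
    obtain ⟨N, hN⟩ := exists_nat_ge r
    exact ⟨N, hr.trans (Metric.closedBall_subset_closedBall hN)⟩
  set B : Set Plane := Metric.closedBall 0 N
  have hB : IsCompact B := isCompact_closedBall _ _
  obtain ⟨c, hc⟩ := hball N
  obtain ⟨T, hT⟩ := hc.bddAbove_range
  have hT' : ∀ n, (μ n).real B ≤ T := fun n => hT ⟨n, rfl⟩
  have hT0 : 0 ≤ T := measureReal_nonneg.trans (hT' 0)
  have hfB : ∀ n, ∫ x, f x ∂(μ n) = ∫ x in B, f x ∂(μ n) := fun n =>
    (setIntegral_eq_integral_of_forall_compl_eq_zero fun x hx =>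
      image_eq_zero_of_notMem_tsupport fun h => hx (hN h)).symm
  refine cauchySeq_tendsto_of_complete (Metric.cauchySeq_iff'.2 fun ε hε => ?_)
  -- All masses of `B` are at most `T`, so this uniform approximation costs at most `ε / 4` in each
  -- integral, uniformly in `n`.
  obtain ⟨g, hgD, hg⟩ : ∃ g ∈ D, ∀ x ∈ B, |f x - g x| < ε / (4 * (T + 1)) := by
    obtain ⟨u, huD, hu⟩ := mem_closure_iff_seq_limit.1 (hD (⟨f, hf⟩ : C(Plane, ℝ)))
    have h1 := ContinuousMap.tendsto_iff_forall_isCompact_tendstoUniformlyOn.1 hu B hB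
    obtain ⟨n, hn⟩ := (Metric.tendstoUniformlyOn_iff.1 h1 (ε / (4 * (T + 1))) (by positivity)).exists
    exact ⟨u n, huD n, fun x hx => by simpa [Real.dist_eq] using hn x hx⟩
  obtain ⟨d, hd⟩ := hconv N g hgD
  obtain ⟨n₀, hn₀⟩ := Metric.cauchySeq_iff'.1 hd.cauchySeq (ε / 4) (by positivity)
  have hclose : ∀ n, |∫ x, f x ∂(μ n) - ∫ x in B, g x ∂(μ n)| ≤ ε / 4 := by
    intro n
    have hBn : μ n B < ∞ := hB.measure_lt_top
    rw [hfB, ← integral_sub (hf.continuousOn.integrableOn_compact hB)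
      (g.continuous.continuousOn.integrableOn_compact hB)]
    have := norm_setIntegral_le_of_norm_le_const (μ := μ n) (s := B) (f := fun x => f x - g x)
      (C := ε / (4 * (T + 1))) hBn (fun x hx => (hg x hx).le)
    rw [Real.norm_eq_abs] at this
    refine this.trans ?_
    calc ε / (4 * (T + 1)) * (μ n).real B ≤ ε / (4 * (T + 1)) * (T + 1) := by
          gcongr
          linarith [hT' n]
      _ = ε / 4 := by field_simp
  refine ⟨n₀, fun n hn => ?_⟩
  have h1 := hn₀ n hn
  rw [Real.dist_eq] at h1 ⊢
  have h2 := abs_le.1 (hclose n)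
  have h3 := abs_le.1 (hclose n₀)
  have h4 := abs_lt.1 h1
  rw [abs_lt]
  constructor <;> linarith

theorem isFiniteMeasureOnCompacts_chaos {Ω : Type*} {κ : ℕ → ℝ → ℝ} {Y : ℕ → Plane → Ω → ℝ}
    (q : ℝ) (ν : Measure Plane) [IsFiniteMeasureOnCompacts ν] (n : ℕ) (ω : Ω)
    (hc : Continuous fun x => Y n x ω) : IsFiniteMeasureOnCompacts (chaos κ Y q ν n ω) := by
  refine ⟨fun S hS => ?_⟩
  rw [chaos_apply _ _ _ _ _ _ hS.measurableSet]
  have : IntegrableOn (fun x => Real.exp (q * Y n x ω - q ^ 2 / 2 * κ n 0)) S ν :=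
    ContinuousOn.integrableOn_compact hS (by fun_prop)
  exact this.lintegral_lt_top

namespace IsScaleField

variable {Ω : Type*} [mΩ : MeasurableSpace Ω] {P : Measure Ω} {κ : ℕ → ℝ → ℝ}
  {Y : ℕ → Plane → Ω → ℝ} {L C r₀ : ℝ}

/-- The integral of the positive part of `g` is the total mass of the chaos over the measure with
density that part on `S`, so it converges by the martingale theorem. The negative part is treated
through `-g`. -/
theorem ae_tendsto_setIntegral_chaos (h : IsScaleField P κ Y) (q : ℝ) (ν : Measure Plane)
    [IsFiniteMeasureOnCompacts ν] [SFinite ν] {S : Set Plane} (hS : IsCompact S) (g : C(Plane, ℝ)) :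
    ∀ᵐ ω ∂P, ∃ c, Tendsto (fun n => ∫ x in S, g x ∂(chaos κ Y q ν n ω)) atTop (𝓝 c) := by
  have hgen : ∀ g : C(Plane, ℝ), ∀ᵐ ω ∂P, ∃ c, Tendsto
      (fun n => (∫⁻ x in S, ENNReal.ofReal (g x) ∂(chaos κ Y q ν n ω)).toReal) atTop (𝓝 c) := by
    intro g
    have hi : IntegrableOn g S ν := g.continuous.continuousOn.integrableOn_compact hS
    have := isFiniteMeasure_withDensity_ofReal hi.2
    filter_upwards [h.ae_tendsto_chaos q ((ν.restrict S).withDensity fun x => ENNReal.ofReal (g x))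
      MeasurableSet.univ] with ω ⟨c, hc⟩
    refine ⟨c, hc.congr fun n => congrArg _ ?_⟩
    have hg : Measurable fun x => ENNReal.ofReal (g x) := g.continuous.measurable.ennreal_ofReal
    have hW := h.measurable_expWeight_left q n ω
    rw [chaos_apply _ _ _ _ _ _ MeasurableSet.univ, Measure.restrict_univ,
      lintegral_withDensity_eq_lintegral_mul _ hg hW, chaos,
      restrict_withDensity hS.measurableSet, lintegral_withDensity_eq_lintegral_mul _ hW hg]
    simp only [Pi.mul_apply, mul_comm]
  filter_upwards [hgen g, hgen (-g)] with ω ⟨c, hc⟩ ⟨d, hd⟩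
  refine ⟨c - d, (hc.sub hd).congr fun n => ?_⟩
  have := isFiniteMeasureOnCompacts_chaos (κ := κ) q ν n ω (h.continuous n ω)
  rw [integral_eq_lintegral_pos_part_sub_lintegral_neg_part
    (g.continuous.continuousOn.integrableOn_compact hS)]
  rfl

/-- Almost sure convergence of the chaos in the space of Radon measures. -/
theorem ae_exists_isRadonLimit (h : IsScaleField P κ Y) (q : ℝ) (ν : Measure Plane)
    [IsFiniteMeasureOnCompacts ν] [SFinite ν] :
    ∀ᵐ ω ∂P, ∃ M, IsRadonLimit (fun n => chaos κ Y q ν n ω) M := by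
  obtain ⟨D, hDc, hD⟩ := TopologicalSpace.exists_countable_dense C(Plane, ℝ)
  have h1 : ∀ᵐ ω ∂P, ∀ N : ℕ, ∀ g ∈ D, ∃ c, Tendsto
      (fun n => ∫ x in Metric.closedBall 0 N, g x ∂(chaos κ Y q ν n ω)) atTop (𝓝 c) :=
    ae_all_iff.2 fun N => (ae_ball_iff hDc).2 fun g _ =>
      h.ae_tendsto_setIntegral_chaos q ν (isCompact_closedBall _ _) g
  have h2 : ∀ᵐ ω ∂P, ∀ N : ℕ, ∃ c, Tendsto
      (fun n => ∫ x in Metric.closedBall 0 N, (1 : C(Plane, ℝ)) x ∂(chaos κ Y q ν n ω))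
      atTop (𝓝 c) :=
    ae_all_iff.2 fun N => h.ae_tendsto_setIntegral_chaos q ν (isCompact_closedBall _ _) 1
  filter_upwards [h1, h2] with ω hω1 hω2
  have hfin : ∀ n, IsFiniteMeasureOnCompacts (chaos κ Y q ν n ω) := fun n =>
    isFiniteMeasureOnCompacts_chaos q ν n ω (h.continuous n ω)
  refine exists_isRadonLimit hfin fun f hf hf' =>
    exists_tendsto_integral_of_dense hfin hD (fun N => ?_) hω1 hf hf'
  simpa using hω2 N

end IsScaleField

namespace IsRadonLimit

/-- A continuous function between the indicators of two concentric balls. -/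
theorem exists_bump (x : Plane) {r' r : ℝ} (hr : r' < r) : ∃ f : Plane → ℝ, Continuous f ∧
    HasCompactSupport f ∧ (∀ y, 0 ≤ f y) ∧
    (∀ y, ENNReal.ofReal (f y) ≤ (Metric.ball x r).indicator 1 y) ∧
    ∀ y, (Metric.closedBall x r').indicator 1 y ≤ ENNReal.ofReal (f y) := by
  have hrr : 0 < r - r' := by linarith
  refine ⟨fun y => max 0 (min 1 ((r - dist y x) / (r - r'))), by fun_prop,
    HasCompactSupport.intro (isCompact_closedBall x r) fun y hy => ?_, fun y => le_max_left _ _,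
    fun y => ?_, fun y => ?_⟩
  · simp only [Metric.mem_closedBall, not_le] at hy
    refine max_eq_left (min_le_of_right_le (div_nonpos_of_nonpos_of_nonneg (by linarith) hrr.le))
  · by_cases hy : y ∈ Metric.ball x r
    · simp [hy]
    · simp only [Metric.mem_ball, not_lt] at hy
      have : max 0 (min 1 ((r - dist y x) / (r - r'))) = 0 :=
        max_eq_left (min_le_of_right_le (div_nonpos_of_nonpos_of_nonneg (by linarith) hrr.le))
      simp [this]
  · by_cases hy : y ∈ Metric.closedBall x r'
    · have h1 : 1 ≤ (r - dist y x) / (r - r') := by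
        rw [le_div_iff₀ hrr]
        have := Metric.mem_closedBall.1 hy
        linarith
      simp [hy, min_eq_left h1]
    · simp [hy]

variable {μ : ℕ → Measure Plane} {M : Measure Plane}

theorem tendsto_lintegral (hM : IsRadonLimit μ M) (hμ : ∀ n, IsFiniteMeasureOnCompacts (μ n))
    {f : Plane → ℝ} (hf : Continuous f) (hfc : HasCompactSupport f) (hf0 : ∀ y, 0 ≤ f y) :
    Tendsto (fun n => ∫⁻ y, ENNReal.ofReal (f y) ∂(μ n)) atTop
      (𝓝 (∫⁻ y, ENNReal.ofReal (f y) ∂M)) := by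
  have := hM.1
  rw [← ofReal_integral_eq_lintegral_ofReal (hf.integrable_of_hasCompactSupport hfc)
    (ae_of_all _ hf0)]
  refine (ENNReal.tendsto_ofReal (hM.2 f hf hfc)).congr fun n => ?_
  rw [ofReal_integral_eq_lintegral_ofReal (hf.integrable_of_hasCompactSupport hfc)
    (ae_of_all _ hf0)]

theorem ball_le_liminf (hM : IsRadonLimit μ M) (hμ : ∀ n, IsFiniteMeasureOnCompacts (μ n))
    (x : Plane) (r : ℝ) :
    M (Metric.ball x r) ≤ liminf (fun n => μ n (Metric.ball x r)) atTop := by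
  have h1 : Metric.ball x r = ⋃ k : ℕ, Metric.closedBall x (r - 1 / ((k : ℝ) + 1)) := by
    ext y
    simp only [Metric.mem_ball, mem_iUnion, Metric.mem_closedBall]
    constructor
    · intro hy
      obtain ⟨k, hk⟩ := exists_nat_one_div_lt (sub_pos.2 hy)
      exact ⟨k, by linarith⟩
    · rintro ⟨k, hk⟩
      have : (0 : ℝ) < 1 / ((k : ℝ) + 1) := by positivity
      linarith
  have hmono : Monotone fun k : ℕ => Metric.closedBall x (r - 1 / ((k : ℝ) + 1)) := by
    intro a b hab
    refine Metric.closedBall_subset_closedBall ?_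
    have : 1 / ((b : ℝ) + 1) ≤ 1 / ((a : ℝ) + 1) := by gcongr
    linarith
  rw [h1, hmono.measure_iUnion, ← h1]
  refine iSup_le fun k => ?_
  obtain ⟨f, hf, hfc, hf0, hf1, hf2⟩ := exists_bump x
    (r' := r - 1 / ((k : ℝ) + 1)) (r := r) (by
      have : (0 : ℝ) < 1 / ((k : ℝ) + 1) := by positivity
      linarith)
  have h2 := (hM.tendsto_lintegral hμ hf hfc hf0).liminf_eq
  calc M (Metric.closedBall x (r - 1 / ((k : ℝ) + 1)))
      = ∫⁻ y, (Metric.closedBall x (r - 1 / ((k : ℝ) + 1))).indicator 1 y ∂M := by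
        rw [lintegral_indicator_one measurableSet_closedBall]
    _ ≤ ∫⁻ y, ENNReal.ofReal (f y) ∂M := lintegral_mono hf2
    _ = _ := h2.symm
    _ ≤ _ := liminf_le_liminf (Eventually.of_forall fun n => by
        rw [← lintegral_indicator_one measurableSet_ball]
        exact lintegral_mono hf1)

/-- The gap between the radii leaves room for a bump function and absorbs any mass the limit puts on
a sphere. -/
theorem limsup_ball_le (hM : IsRadonLimit μ M) (hμ : ∀ n, IsFiniteMeasureOnCompacts (μ n))
    (x : Plane) {r' r : ℝ} (hr : r' < r) :
    limsup (fun n => μ n (Metric.ball x r')) atTop ≤ M (Metric.ball x r) := by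
  obtain ⟨f, hf, hfc, hf0, hf1, hf2⟩ := exists_bump x hr
  have h2 := (hM.tendsto_lintegral hμ hf hfc hf0).limsup_eq
  calc limsup (fun n => μ n (Metric.ball x r')) atTop
      ≤ limsup (fun n => ∫⁻ y, ENNReal.ofReal (f y) ∂(μ n)) atTop :=
        limsup_le_limsup (Eventually.of_forall fun n => by
          refine (measure_mono Metric.ball_subset_closedBall).trans ?_
          rw [← lintegral_indicator_one measurableSet_closedBall]
          exact lintegral_mono hf2)
    _ = ∫⁻ y, ENNReal.ofReal (f y) ∂M := h2
    _ ≤ _ := by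
        rw [← lintegral_indicator_one measurableSet_ball]
        exact lintegral_mono hf1

end IsRadonLimit

/-! ### Covers by balls and the upper bound for the dimension. -/

/-- The strict inequality puts a set of diameter `d` inside an open ball about any of its points.
The slack `η` serves the case `d = 0`, where no dyadic radius is comparable to the diameter. -/
theorem exists_dyadic_radius {r₀ τ d η : ℝ} (hr₀ : 0 < r₀) (hτ : 0 < τ) (hd : 0 ≤ d)
    (hd' : d ≤ r₀ / 2) (hη : 0 < η) :
    ∃ k : ℕ, d < r₀ / 2 ^ k ∧ (r₀ / 2 ^ k) ^ τ ≤ (4 * d) ^ τ + η := by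
  rcases hd.eq_or_lt with rfl | hd
  · have h1 : Tendsto (fun k : ℕ => (r₀ / 2 ^ k) ^ τ) atTop (𝓝 (0 ^ τ)) := by
      refine Tendsto.rpow_const ?_ (Or.inr hτ.le)
      have := (tendsto_pow_atTop_nhds_zero_of_lt_one (r := (1 / 2 : ℝ)) (by norm_num)
        (by norm_num)).const_mul r₀
      rw [mul_zero] at this
      refine this.congr fun k => ?_
      rw [one_div, inv_pow, div_eq_mul_inv]
    rw [Real.zero_rpow hτ.ne'] at h1
    obtain ⟨k, hk⟩ := (h1.eventually (gt_mem_nhds hη)).exists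
    refine ⟨k, by positivity, ?_⟩
    rw [mul_zero, Real.zero_rpow hτ.ne', zero_add]
    exact hk.le
  · have h2 : 2 ≤ r₀ / d := by rw [le_div_iff₀ hd]; linarith
    obtain ⟨n, hn1, hn2⟩ := exists_nat_pow_near (x := r₀ / d) (y := 2) (by linarith) one_lt_two
    obtain ⟨k, rfl⟩ : ∃ k, n = k + 1 := Nat.exists_eq_succ_of_ne_zero (by
      rintro rfl
      simp only [zero_add, pow_one] at hn2
      linarith)
    have h2k : (0 : ℝ) < 2 ^ k := by positivity
    rw [le_div_iff₀ hd] at hn1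
    rw [div_lt_iff₀ hd] at hn2
    refine ⟨k, ?_, ?_⟩
    · rw [lt_div_iff₀ h2k]
      rw [pow_succ] at hn1
      nlinarith
    · have : (r₀ / 2 ^ k) ^ τ ≤ (4 * d) ^ τ := by
        refine Real.rpow_le_rpow (by positivity) ?_ hτ.le
        rw [div_le_iff₀ h2k]
        rw [pow_succ, pow_succ] at hn2
        nlinarith
      linarith

/-- A set of zero Hausdorff measure is covered by balls of dyadic radii with small total size. -/
theorem exists_ball_cover_of_hausdorffMeasure_eq_zero {r₀ τ : ℝ} (hr₀ : 0 < r₀) (hτ : 0 < τ)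
    {K : Set Plane} (hK : μH[τ] K = 0) {ε : ℝ} (hε : 0 < ε) :
    ∃ (x : ℕ → Plane) (k : ℕ → ℕ), K ⊆ ⋃ i, Metric.ball (x i) (r₀ / 2 ^ k i) ∧
      ∑' i, ENNReal.ofReal ((r₀ / 2 ^ k i) ^ τ) ≤ ENNReal.ofReal ε := by
  rw [Measure.hausdorffMeasure_apply] at hK
  have h1 := (iSup₂_eq_bot.1 hK) (ENNReal.ofReal (r₀ / 2))
    (ENNReal.ofReal_pos.2 (by positivity))
  set ε' : ℝ≥0∞ := ENNReal.ofReal (ε / 2) / ENNReal.ofReal (4 ^ τ)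
  have hε' : 0 < ε' := ENNReal.div_pos (ENNReal.ofReal_pos.2 (by positivity)).ne'
    ENNReal.ofReal_ne_top
  have h1' := h1.trans bot_eq_zero
  obtain ⟨t, ht1, ht2, ht3⟩ : ∃ t : ℕ → Set Plane, K ⊆ ⋃ n, t n ∧
      (∀ n, Metric.ediam (t n) ≤ ENNReal.ofReal (r₀ / 2)) ∧
      ∑' n, ⨆ _ : (t n).Nonempty, Metric.ediam (t n) ^ τ < ε' := by
    have h2 : (⨅ t : ℕ → Set Plane, ⨅ (_ : K ⊆ ⋃ n, t n),
      ⨅ (_ : ∀ n, Metric.ediam (t n) ≤ ENNReal.ofReal (r₀ / 2)),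
        ∑' n, ⨆ _ : (t n).Nonempty, Metric.ediam (t n) ^ τ) < ε' := by
      rw [h1']; exact hε'
    simp only [iInf_lt_iff] at h2
    obtain ⟨t, a, b, c⟩ := h2
    exact ⟨t, a, b, c⟩
  obtain ⟨η, hη0, hη⟩ := ENNReal.exists_pos_sum_of_countable
    (ε := ENNReal.ofReal (ε / 2)) (ENNReal.ofReal_pos.2 (by positivity)).ne' ℕ
  have hex : ∀ n, ∃ (x : Plane) (k : ℕ), t n ⊆ Metric.ball x (r₀ / 2 ^ k) ∧
      ENNReal.ofReal ((r₀ / 2 ^ k) ^ τ) ≤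
        ENNReal.ofReal (4 ^ τ) * (⨆ _ : (t n).Nonempty, Metric.ediam (t n) ^ τ) + η n := by
    intro n
    rcases (t n).eq_empty_or_nonempty with he | ⟨x, hx⟩
    · obtain ⟨k, -, hk⟩ := exists_dyadic_radius hr₀ hτ le_rfl (by positivity)
        (NNReal.coe_pos.2 (hη0 n))
      rw [mul_zero, Real.zero_rpow hτ.ne', zero_add] at hk
      refine ⟨0, k, by simp [he], le_add_left ?_⟩
      rw [← ENNReal.ofReal_coe_nnreal]
      exact ENNReal.ofReal_le_ofReal hk
    · have htop : Metric.ediam (t n) ≠ ∞ := ((ht2 n).trans_lt ENNReal.ofReal_lt_top).ne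
      set d := (Metric.ediam (t n)).toReal
      have hdd : Metric.ediam (t n) = ENNReal.ofReal d := (ENNReal.ofReal_toReal htop).symm
      have hd : d ≤ r₀ / 2 := ENNReal.toReal_le_of_le_ofReal (by positivity) (ht2 n)
      obtain ⟨k, hk1, hk2⟩ := exists_dyadic_radius hr₀ hτ ENNReal.toReal_nonneg hd
        (NNReal.coe_pos.2 (hη0 n))
      refine ⟨x, k, fun y hy => ?_, ?_⟩
      · rw [Metric.mem_ball]
        refine lt_of_le_of_lt ?_ hk1
        have := Metric.edist_le_ediam_of_mem hy hx
        rw [edist_dist, hdd] at this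
        exact (ENNReal.ofReal_le_ofReal_iff ENNReal.toReal_nonneg).1 this
      · rw [iSup_pos ⟨x, hx⟩, hdd, ENNReal.ofReal_rpow_of_nonneg ENNReal.toReal_nonneg hτ.le,
          ← ENNReal.ofReal_mul (by positivity), ← ENNReal.ofReal_coe_nnreal,
          ← ENNReal.ofReal_add (by positivity) (by positivity)]
        refine ENNReal.ofReal_le_ofReal (hk2.trans ?_)
        rw [Real.mul_rpow (by norm_num) ENNReal.toReal_nonneg]
  choose x k hxk1 hxk2 using hex
  refine ⟨x, k, ht1.trans (iUnion_mono hxk1), (ENNReal.tsum_le_tsum hxk2).trans ?_⟩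
  rw [ENNReal.tsum_add, ENNReal.tsum_mul_left]
  refine (add_le_add (mul_le_mul' le_rfl ht3.le) hη.le).trans ?_
  rw [ENNReal.mul_div_cancel (ENNReal.ofReal_pos.2 (by positivity)).ne' ENNReal.ofReal_ne_top,
    ← ENNReal.ofReal_add (by positivity) (by positivity), add_halves]

theorem measureHausdorffContent_le_tsum {μ : Measure Plane} {s : ℝ≥0} {K : Set Plane}
    {x : ℕ → Plane} {r : ℕ → ℝ} (hr : ∀ i, 0 < r i) (hK : K ⊆ ⋃ i, Metric.ball (x i) (r i)) :
    measureHausdorffContent μ s K ≤ ∑' i, μ (Metric.ball (x i) (r i)) ^ (s : ℝ) := by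
  unfold measureHausdorffContent
  refine iInf_le_of_le univ ?_
  refine iInf_le_of_le x ?_
  refine iInf_le_of_le r ?_
  refine iInf_le_of_le (fun i _ => hr i) ?_
  refine iInf_le_of_le (by simpa using hK) ?_
  exact (tsum_univ fun i => μ (Metric.ball (x i) (r i)) ^ (s : ℝ)).le

theorem exp_neg_pow_eq_rpow {r₀ : ℝ} (hr₀ : 0 < r₀) (a : ℝ) (k : ℕ) :
    Real.exp (-(a * k)) = r₀ ^ (-(a / Real.log 2)) * (r₀ / 2 ^ k) ^ (a / Real.log 2) := by
  have h2 : (0 : ℝ) < Real.log 2 := Real.log_pos one_lt_two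
  rw [Real.div_rpow hr₀.le (by positivity), Real.rpow_neg hr₀.le, ← mul_div_assoc,
    inv_mul_cancel₀ (by positivity), one_div, Real.exp_neg, ← Real.rpow_natCast,
    ← Real.rpow_mul two_pos.le, Real.rpow_def_of_pos two_pos]
  congr 2
  field_simp

namespace IsScaleField

variable {Ω : Type*} [mΩ : MeasurableSpace Ω] {P : Measure Ω} {κ : ℕ → ℝ → ℝ}
  {Y : ℕ → Plane → Ω → ℝ} {L C r₀ : ℝ}

/-- A moment bound on small balls gives a null content for the limit measure. -/
theorem ae_content_eq_zero (h : IsScaleField P κ Y) (hr₀ : 0 < r₀) {s : ℝ≥0} {τ : ℝ}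
    (hτ : 0 < τ) {c : ℝ≥0∞} (hc : c ≠ ∞)
    (hmom : ∀ x k n, k ≤ n → ∫⁻ ω, chaos κ Y 1 volume n ω (Metric.ball x (r₀ / 2 ^ k)) ^ (s : ℝ) ∂P
      ≤ c * ENNReal.ofReal ((r₀ / 2 ^ k) ^ τ)) {K : Set Plane} (hK : μH[τ] K = 0) :
    ∀ᵐ ω ∂P, ∀ M, IsRadonLimit (fun n => chaos κ Y 1 volume n ω) M →
      measureHausdorffContent M s K = 0 := by
  have hε : ∀ j : ℕ, (0 : ℝ) < (1 / 2) ^ j := fun j => by positivity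
  choose x k hx hk using fun j : ℕ =>
    exists_ball_cover_of_hausdorffMeasure_eq_zero hr₀ hτ hK (hε j)
  -- The liminf dominates the `s`-th power of the mass for every Radon limit at once. By Fatou it
  -- inherits the moment bound, which holds only from level `k j i` on.
  set g : ℕ → ℕ → Ω → ℝ≥0∞ := fun j i ω =>
    liminf (fun n => chaos κ Y 1 volume n ω (Metric.ball (x j i) (r₀ / 2 ^ k j i)) ^ (s : ℝ)) atTop
  have hmeas : ∀ j i n, Measurable fun ω =>
      chaos κ Y 1 volume n ω (Metric.ball (x j i) (r₀ / 2 ^ k j i)) ^ (s : ℝ) := fun j i n =>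
    (h.measurable_chaos_apply 1 volume n measurableSet_ball).pow_const _
  have hgm : ∀ j i, Measurable (g j i) := fun j i => Measurable.liminf (hmeas j i)
  have hg : ∀ j i, ∫⁻ ω, g j i ω ∂P ≤ c * ENNReal.ofReal ((r₀ / 2 ^ k j i) ^ τ) := by
    intro j i
    refine (lintegral_liminf_le (hmeas j i)).trans ?_
    refine liminf_le_of_frequently_le' (Eventually.frequently ?_)
    filter_upwards [eventually_ge_atTop (k j i)] with n hn using hmom _ _ _ hn
  -- The covers have sizes `(1 / 2) ^ j`, so the expected costs are summable. Almost surely the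
  -- costs then tend to zero, which bounds the content.
  have hsum : ∫⁻ ω, ∑' j, ∑' i, g j i ω ∂P ≠ ∞ := by
    rw [lintegral_tsum fun j => (Measurable.tsum fun i => hgm j i).aemeasurable]
    have : ∀ j, ∫⁻ ω, ∑' i, g j i ω ∂P ≤ c * ENNReal.ofReal ((1 / 2) ^ j) := by
      intro j
      rw [lintegral_tsum fun i => (hgm j i).aemeasurable]
      refine (ENNReal.tsum_le_tsum (hg j)).trans ?_
      rw [ENNReal.tsum_mul_left]
      exact mul_le_mul' le_rfl (hk j)
    refine ((ENNReal.tsum_le_tsum this).trans_lt ?_).ne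
    rw [ENNReal.tsum_mul_left, ← ENNReal.ofReal_tsum_of_nonneg (fun j => (hε j).le)
      (summable_geometric_of_lt_one (by norm_num) (by norm_num))]
    exact ENNReal.mul_lt_top hc.lt_top ENNReal.ofReal_lt_top
  have hfin := ae_lt_top (Measurable.tsum fun j => Measurable.tsum fun i => hgm j i) hsum
  filter_upwards [hfin] with ω hω M hM
  have hμ : ∀ n, IsFiniteMeasureOnCompacts (chaos κ Y 1 volume n ω) := fun n =>
    isFiniteMeasureOnCompacts_chaos 1 volume n ω (h.continuous n ω)
  have hlim : Tendsto (fun j => ∑' i, g j i ω) atTop (𝓝 0) := by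
    rw [← Nat.cofinite_eq_atTop]
    exact ENNReal.tendsto_cofinite_zero_of_tsum_ne_top hω.ne
  refine le_antisymm (ge_of_tendsto' hlim fun j => ?_) zero_le
  refine (measureHausdorffContent_le_tsum (fun i => by positivity) (hx j)).trans
    (ENNReal.tsum_le_tsum fun i => ?_)
  have hs' : (0 : ℝ) ≤ s := s.2
  refine (ENNReal.rpow_le_rpow (hM.ball_le_liminf hμ (x j i) (r₀ / 2 ^ k j i)) hs').trans ?_
  exact ((ENNReal.monotone_rpow_of_nonneg hs').map_liminf_of_continuousAt _
    (ENNReal.continuous_rpow_const.continuousAt)).le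

theorem volume_ball_eq (x : Plane) {r : ℝ} (hr : 0 ≤ r) :
    volume (Metric.ball x r) = ENNReal.ofReal (Real.pi * r ^ (2 : ℝ)) := by
  rw [EuclideanSpace.volume_ball_fin_two, Real.rpow_two, mul_comm, ENNReal.ofReal_mul (by positivity),
    ENNReal.ofReal_pow hr, ← NNReal.coe_real_pi, ENNReal.ofReal_coe_nnreal]

/-- The volume contributes `2 s` and the field `s (1 - s) γ² / 2`; the sum is `ζ(s)`. -/
theorem lintegral_chaos_ball_rpow_lt_one (h : IsScaleField P κ Y) {γ : ℝ}
    (hκ : LogKernel (γ ^ 2 * Real.log 2) C r₀ κ) {s : ℝ} (hs : s ∈ Ioo 0 1) :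
    ∃ c : ℝ≥0∞, c ≠ ∞ ∧ ∀ x k n, k ≤ n →
      ∫⁻ ω, chaos κ Y 1 volume n ω (Metric.ball x (r₀ / 2 ^ k)) ^ s ∂P
        ≤ c * ENNReal.ofReal ((r₀ / 2 ^ k) ^ scalingExponent γ s) := by
  have hr₀ := hκ.r₀_pos
  have hs0 := hs.1
  refine ⟨ENNReal.ofReal (Real.exp (6 * C) * Real.pi ^ s
    * r₀ ^ (-(s * (1 - s) / 2 * (γ ^ 2 * Real.log 2) / Real.log 2))), ENNReal.ofReal_ne_top,
    fun x k n hkn => ?_⟩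
  have hrk : 0 < r₀ / 2 ^ k := by positivity
  have := h.lintegral_expWeight_mul_chaos_rpow hκ (q := 1) (w := 0) ⟨zero_le_one, le_rfl⟩
    ⟨le_rfl, zero_le_one⟩ hs volume (measurableSet_ball (x := x) (ε := r₀ / 2 ^ k)) x hkn
    (fun y hy => by
      rw [dist_comm]
      have := Metric.mem_ball.1 hy
      linarith) (fun y _ => by simp)
  simp only [expWeight, zero_mul, ne_eq, OfNat.ofNat_ne_zero, not_false_eq_true, zero_pow,
    zero_div, sub_self, Real.exp_zero, ENNReal.ofReal_one, one_mul, mul_zero, one_pow, mul_one,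
    zero_sub] at this
  refine this.trans ?_
  rw [volume_ball_eq _ hrk.le, ENNReal.ofReal_rpow_of_nonneg (by positivity) hs0.le,
    ← ENNReal.ofReal_mul (by positivity), ← ENNReal.ofReal_mul (by positivity)]
  apply ENNReal.ofReal_le_ofReal
  apply le_of_eq
  have h2 : Real.log 2 ≠ 0 := (Real.log_pos one_lt_two).ne'
  have e1 : -(s * (1 - s) / 2) * (↑k * (γ ^ 2 * Real.log 2)) + 6 * C
      = 6 * C + -(s * (1 - s) / 2 * (γ ^ 2 * Real.log 2) * k) := by ring
  rw [e1, Real.exp_add, exp_neg_pow_eq_rpow hr₀, Real.mul_rpow Real.pi_pos.le (by positivity),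
    ← Real.rpow_mul hrk.le]
  have e2 : scalingExponent γ s = s * (1 - s) / 2 * (γ ^ 2 * Real.log 2) / Real.log 2 + 2 * s := by
    rw [scalingExponent]
    field_simp
    ring
  rw [e2, Real.rpow_add hrk]
  ring

/-- The volume accounts for the exponent 2, and the extra power `θ` gains `θ (2 - (1 + θ) γ² / 2) >
0`. Only `τ > 2` matters, since a subset of the plane has dimension at most 2. -/
theorem lintegral_chaos_ball_rpow_gt_one (h : IsScaleField P κ Y) {γ : ℝ}
    (hκ : LogKernel (γ ^ 2 * Real.log 2) C r₀ κ) {θ : ℝ} (hθ : θ ∈ Ioo 0 1)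
    (hγθ : (1 + θ) * γ ^ 2 < 4) :
    ∃ c : ℝ≥0∞, ∃ τ : ℝ, c ≠ ∞ ∧ 2 < τ ∧ ∀ x k n, k ≤ n →
      ∫⁻ ω, chaos κ Y 1 volume n ω (Metric.ball x (r₀ / 2 ^ k)) ^ (1 + θ) ∂P
        ≤ c * ENNReal.ofReal ((r₀ / 2 ^ k) ^ τ) := by
  have hr₀ := hκ.r₀_pos
  have hθ0 := hθ.1
  have hlog : 0 < Real.log 2 := Real.log_pos one_lt_two
  set b := 2 * Real.log 2 - 1 ^ 2 * (1 + θ) / 2 * (γ ^ 2 * Real.log 2) with hb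
  have hb0 : 0 < b := by
    have : b = Real.log 2 / 2 * (4 - (1 + θ) * γ ^ 2) := by rw [hb]; ring
    rw [this]
    exact mul_pos (by positivity) (by linarith)
  set A := Real.exp (6 * C) * (Real.pi * (4 * r₀) ^ (2 : ℝ)) ^ θ / (1 - Real.exp (-(θ * b)))
  have hA : 0 ≤ A := div_nonneg (by positivity)
    (sub_nonneg.2 (Real.exp_le_one_iff.2 (neg_nonpos.2 (by positivity))))
  refine ⟨ENNReal.ofReal (A * r₀ ^ (-(θ * b / Real.log 2)) * Real.pi),
    2 + θ * b / Real.log 2, ENNReal.ofReal_ne_top, by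
      have : 0 < θ * b / Real.log 2 := by positivity
      linarith, fun x k n hkn => ?_⟩
  have hrk : 0 < r₀ / 2 ^ k := by positivity
  refine (h.lintegral_chaos_rpow_one_add hκ (q := 1) (t := 2) (D := Real.pi) (b := b) (k := k)
    (S := Metric.ball x (r₀ / 2 ^ k))
    ⟨zero_le_one, le_rfl⟩ hθ Real.pi_pos.le volume measurableSet_ball
    (fun y _ r hr => (volume_ball_eq y hr.le).le) hb hb0 hkn (fun y hy z hz => ?_)).trans ?_
  · rw [Metric.mem_ball] at *
    have := dist_triangle_right z y x
    linarith
  · rw [volume_ball_eq _ hrk.le, ← ENNReal.ofReal_mul', ← ENNReal.ofReal_mul (by positivity)]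
    · apply ENNReal.ofReal_le_ofReal
      apply le_of_eq
      rw [← Real.exp_nat_mul, mul_neg, mul_comm (k : ℝ), exp_neg_pow_eq_rpow hr₀,
        Real.rpow_add hrk]
      ring
    · positivity

end IsScaleField

/-- The slope of every chord in `[0, 1]` exceeds `2 - γ² / 2`, the derivative at `1`; this is where
`γ² < 4` enters. -/
theorem scalingExponent_strictMonoOn {γ : ℝ} (hγ : γ ^ 2 < 4) :
    StrictMonoOn (scalingExponent γ) (Icc 0 1) := by
  intro a ha b hb hab
  have h1 : scalingExponent γ b - scalingExponent γ a
      = (b - a) * (2 + γ ^ 2 / 2 * (1 - (a + b))) := by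
    rw [scalingExponent, scalingExponent]; ring
  have h2 : 0 < 2 + γ ^ 2 / 2 * (1 - (a + b)) := by
    have := sq_nonneg γ
    have h3 : 0 ≤ a := ha.1
    have h4 : a ≤ 1 := ha.2
    have h5 : 0 ≤ b := hb.1
    have h6 : b ≤ 1 := hb.2
    nlinarith
  have := mul_pos (sub_pos.2 hab) h2
  linarith

theorem scalingExponent_zero (γ : ℝ) : scalingExponent γ 0 = 0 := by simp [scalingExponent]

theorem scalingExponent_one (γ : ℝ) : scalingExponent γ 1 = 2 := by simp [scalingExponent]

theorem hausdorffMeasure_eq_zero_of_dimH_lt {K : Set Plane} {τ a : ℝ}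
    (hK : dimH K = ENNReal.ofReal a) (hτ : 0 < τ) (haτ : a < τ) : μH[τ] K = 0 := by
  have : dimH K < (τ.toNNReal : ℝ≥0∞) := by
    rw [hK]
    exact (ENNReal.ofReal_lt_ofReal_iff hτ).2 haτ
  have := hausdorffMeasure_of_dimH_lt this
  rwa [Real.coe_toNNReal _ hτ.le] at this

namespace IsScaleField

variable {Ω : Type*} [mΩ : MeasurableSpace Ω] {P : Measure Ω} {κ : ℕ → ℝ → ℝ}
  {Y : ℕ → Plane → Ω → ℝ} {L C r₀ : ℝ}

/-- The upper bound in the KPZ formula. -/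
theorem ae_measureDimH_le (h : IsScaleField P κ Y) {γ : ℝ} (hγ : γ ^ 2 < 4)
    (hκ : LogKernel (γ ^ 2 * Real.log 2) C r₀ κ) {K : Set Plane} {δ : ℝ} (hδ : δ ∈ Icc 0 1)
    (hK : dimH K = ENNReal.ofReal (scalingExponent γ δ)) :
    ∀ᵐ ω ∂P, ∀ M, IsRadonLimit (fun n => chaos κ Y 1 volume n ω) M →
      measureDimH M K ≤ ENNReal.ofReal δ := by
  suffices hsuff : ∃ u : ℕ → ℝ, Tendsto u atTop (𝓝 δ) ∧ (∀ i, 0 < u i) ∧ ∀ i, ∀ᵐ ω ∂P, ∀ M,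
      IsRadonLimit (fun n => chaos κ Y 1 volume n ω) M →
        measureHausdorffContent M (u i).toNNReal K = 0 by
    obtain ⟨u, hu, -, hu1⟩ := hsuff
    filter_upwards [ae_all_iff.2 hu1] with ω hω M hM
    refine ge_of_tendsto' (ENNReal.tendsto_ofReal hu) fun i => ?_
    unfold measureDimH
    exact iInf₂_le (u i).toNNReal (hω i M hM)
  obtain ⟨hδ0, hδ1⟩ := hδ
  rcases hδ1.lt_or_eq with hδ1 | rfl
  · have hlim : Tendsto (fun i : ℕ => (1 : ℝ) / ((i : ℝ) + 1)) atTop (𝓝 0) :=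
      tendsto_one_div_add_atTop_nhds_zero_nat
    refine ⟨fun i => δ + (1 - δ) / 2 * (1 / ((i : ℝ) + 1)), ?_, fun i => ?_, fun i => ?_⟩
    · simpa using (hlim.const_mul ((1 - δ) / 2)).const_add δ
    · have : 0 < (1 - δ) / 2 * (1 / ((i : ℝ) + 1)) := by
        have : 0 < 1 - δ := by linarith
        positivity
      linarith
    · have h1 : (0 : ℝ) < 1 / ((i : ℝ) + 1) := by positivity
      have h2 : 1 / ((i : ℝ) + 1) ≤ 1 := by
        rw [div_le_one (by positivity)]
        have : (0 : ℝ) ≤ i := by positivity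
        linarith
      set s := δ + (1 - δ) / 2 * (1 / ((i : ℝ) + 1))
      have hδs : δ < s := by
        have : 0 < (1 - δ) / 2 * (1 / ((i : ℝ) + 1)) := mul_pos (by linarith) h1
        simp only [s]; linarith
      have hs1 : s < 1 := by
        have : (1 - δ) / 2 * (1 / ((i : ℝ) + 1)) ≤ (1 - δ) / 2 * 1 :=
          mul_le_mul_of_nonneg_left h2 (by linarith)
        simp only [s]; linarith
      have hs0 : 0 < s := by linarith
      have hζ := scalingExponent_strictMonoOn hγ ⟨hδ0, hδ1.le⟩ ⟨hs0.le, hs1.le⟩ hδs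
      have hζ0 : 0 < scalingExponent γ s := by
        have := scalingExponent_strictMonoOn hγ ⟨le_rfl, zero_le_one⟩ ⟨hs0.le, hs1.le⟩ hs0
        rwa [scalingExponent_zero] at this
      obtain ⟨c, hc, hmom⟩ := h.lintegral_chaos_ball_rpow_lt_one hκ ⟨hs0, hs1⟩
      refine h.ae_content_eq_zero (s := s.toNNReal) hκ.r₀_pos hζ0 hc ?_
        (hausdorffMeasure_eq_zero_of_dimH_lt hK hζ0 hζ)
      rwa [Real.coe_toNNReal _ hs0.le]
  -- For `δ = 1` the exponents decreasing to `δ` are above 1. The factor `(4 - γ ^ 2) / 8` keeps `θ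
  -- < 1` and `(1 + θ) γ² < 4`.
  · have hlim : Tendsto (fun i : ℕ => (1 : ℝ) / ((i : ℝ) + 1)) atTop (𝓝 0) :=
      tendsto_one_div_add_atTop_nhds_zero_nat
    refine ⟨fun i => 1 + (4 - γ ^ 2) / 8 * (1 / ((i : ℝ) + 1)), ?_, fun i => ?_, fun i => ?_⟩
    · simpa using (hlim.const_mul ((4 - γ ^ 2) / 8)).const_add 1
    · have : 0 ≤ (4 - γ ^ 2) / 8 * (1 / ((i : ℝ) + 1)) :=
        mul_nonneg (by linarith) (by positivity)
      linarith
    · have h1 : (0 : ℝ) < 1 / ((i : ℝ) + 1) := by positivity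
      have h2 : 1 / ((i : ℝ) + 1) ≤ 1 := by
        rw [div_le_one (by positivity)]
        have : (0 : ℝ) ≤ i := by positivity
        linarith
      set θ := (4 - γ ^ 2) / 8 * (1 / ((i : ℝ) + 1))
      have hθ0 : 0 < θ := mul_pos (by linarith) h1
      have hθ1 : θ ≤ (4 - γ ^ 2) / 8 := by
        have : (4 - γ ^ 2) / 8 * (1 / ((i : ℝ) + 1)) ≤ (4 - γ ^ 2) / 8 * 1 :=
          mul_le_mul_of_nonneg_left h2 (by linarith)
        simpa only [mul_one] using this
      have hγ0 := sq_nonneg γ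
      obtain ⟨c, τ, hc, hτ, hmom⟩ := h.lintegral_chaos_ball_rpow_gt_one hκ (θ := θ)
        ⟨hθ0, by linarith⟩ (by nlinarith)
      rw [scalingExponent_one] at hK
      have hs0 : 0 < 1 + θ := by linarith
      refine h.ae_content_eq_zero (s := (1 + θ).toNNReal) hκ.r₀_pos
        (by linarith : 0 < τ) hc ?_ (hausdorffMeasure_eq_zero_of_dimH_lt hK (by linarith) hτ)
      rwa [Real.coe_toNNReal _ hs0.le]

end IsScaleField

/-! ### Net contents on a tree and capacitability. -/

section TreeContent

variable {α : Type*}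

/-- The cylinder of the sequences whose first letters, read backwards, form the word `w`. -/
def treeCyl (w : List α) : Set (ℕ → α) := {x | PiNat.res x w.length = w}

/-- The content of a set of sequences for the cost `c` of the cylinders. -/
noncomputable def treeContent (c : List α → ℝ≥0∞) (A : Set (ℕ → α)) : ℝ≥0∞ :=
  ⨅ (U : Set (List α)) (_ : A ⊆ ⋃ w ∈ U, treeCyl w), ∑' w, U.indicator c w

/-- The words of `F` without proper ancestor in `F`. -/
def treeTop (F : Set (List α)) : Set (List α) := {w ∈ F | ∀ v ∈ F, v <:+ w → v = w}

theorem mem_treeCyl {w : List α} {x : ℕ → α} : x ∈ treeCyl w ↔ PiNat.res x w.length = w := Iff.rfl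

theorem mem_treeCyl_res (x : ℕ → α) (n : ℕ) : x ∈ treeCyl (PiNat.res x n) := by
  rw [mem_treeCyl, PiNat.res_length]

theorem eq_res_of_suffix {x : ℕ → α} {n : ℕ} {v : List α} (h : v <:+ PiNat.res x n) :
    v = PiNat.res x v.length := by
  induction n with
  | zero => simp_all
  | succ n ih =>
    rw [PiNat.res_succ, List.suffix_cons_iff] at h
    rcases h with rfl | h
    · rw [List.length_cons, PiNat.res_length, PiNat.res_succ]
    · exact ih h

theorem res_suffix (x : ℕ → α) {m n : ℕ} (h : m ≤ n) : PiNat.res x m <:+ PiNat.res x n := by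
  induction h with
  | refl => exact List.suffix_rfl
  | step _ ih => exact ih.trans (by rw [PiNat.res_succ]; exact List.suffix_cons _ _)

theorem treeCyl_subset {v w : List α} (h : v <:+ w) : treeCyl w ⊆ treeCyl v := by
  intro x hx
  rw [mem_treeCyl] at hx ⊢
  rw [← hx] at h
  exact (eq_res_of_suffix h).symm

theorem treeTop_subset (F : Set (List α)) : treeTop F ⊆ F := fun _ h => h.1

/-- The shortest initial word of a point that belongs to `F` has no proper ancestor in `F`. -/
theorem iUnion_treeTop (F : Set (List α)) : ⋃ w ∈ F, treeCyl w ⊆ ⋃ w ∈ treeTop F, treeCyl w := by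
  classical
  intro x hx
  simp only [mem_iUnion] at hx ⊢
  obtain ⟨w, hwF, hw⟩ := hx
  have hex : ∃ n, PiNat.res x n ∈ F := ⟨w.length, by rwa [mem_treeCyl.1 hw]⟩
  refine ⟨PiNat.res x (Nat.find hex), ⟨Nat.find_spec hex, fun v hv hvs => ?_⟩, mem_treeCyl_res _ _⟩
  have h1 := eq_res_of_suffix hvs
  rw [h1] at hv
  have h2 := Nat.find_min' hex hv
  have h3 := hvs.length_le
  rw [PiNat.res_length] at h3
  rw [h1, le_antisymm h3 h2]

theorem treeContent_le {c : List α → ℝ≥0∞} {A : Set (ℕ → α)} {U : Set (List α)}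
    (hU : A ⊆ ⋃ w ∈ U, treeCyl w) : treeContent c A ≤ ∑' w, U.indicator c w :=
  iInf₂_le U hU

theorem treeContent_mono {c : List α → ℝ≥0∞} {A B : Set (ℕ → α)} (h : A ⊆ B) :
    treeContent c A ≤ treeContent c B :=
  le_iInf₂ fun _ hU => treeContent_le (h.trans hU)

theorem exists_cover_of_treeContent_lt {c : List α → ℝ≥0∞} {A : Set (ℕ → α)} {b : ℝ≥0∞}
    (h : treeContent c A < b) :
    ∃ U : Set (List α), A ⊆ ⋃ w ∈ U, treeCyl w ∧ ∑' w, U.indicator c w < b := by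
  simp only [treeContent, iInf_lt_iff] at h
  obtain ⟨U, hU, hb⟩ := h
  exact ⟨U, hU, hb⟩

theorem treeContent_treeCyl_le (c : List α → ℝ≥0∞) (w : List α) :
    treeContent c (treeCyl w) ≤ c w := by
  refine (treeContent_le (U := {w}) (by simp)).trans (le_of_eq ?_)
  rw [tsum_eq_single w (fun v hv => indicator_of_notMem (by simpa using hv) _)]
  simp

theorem treeContent_empty (c : List α → ℝ≥0∞) : treeContent c ∅ = 0 :=
  le_antisymm ((treeContent_le (U := ∅) (empty_subset _)).trans (by simp)) zero_le

theorem treeContent_iUnion_le_sum {ι : Type*} [Fintype ι] (c : List α → ℝ≥0∞)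
    (A : ι → Set (ℕ → α)) : treeContent c (⋃ i, A i) ≤ ∑ i, treeContent c (A i) := by
  refine ENNReal.le_of_forall_pos_le_add fun ε hε hfin => ?_
  rcases isEmpty_or_nonempty ι with hι | hι
  · simp [treeContent_empty]
  have hcard : (0 : ℝ≥0∞) < Fintype.card ι := by exact_mod_cast Fintype.card_pos
  have hη : (ε : ℝ≥0∞) / Fintype.card ι ≠ 0 :=
    (ENNReal.div_pos (by exact_mod_cast hε.ne') (ENNReal.natCast_ne_top _)).ne'
  have h1 : ∀ i, ∃ U : Set (List α), A i ⊆ ⋃ w ∈ U, treeCyl w ∧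
      ∑' w, U.indicator c w < treeContent c (A i) + ε / Fintype.card ι := fun i =>
    exists_cover_of_treeContent_lt (ENNReal.lt_add_right
      (ENNReal.sum_lt_top.1 hfin i (Finset.mem_univ i)).ne hη)
  choose U hU1 hU2 using h1
  refine (treeContent_le (U := ⋃ i, U i) ?_).trans ?_
  · refine iUnion_subset fun i => (hU1 i).trans ?_
    exact biUnion_mono (subset_iUnion U i) fun _ _ => subset_rfl
  · calc ∑' w, (⋃ i, U i).indicator c w ≤ ∑' w, ∑ i, (U i).indicator c w := by
          refine ENNReal.tsum_le_tsum fun w => ?_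
          by_cases hw : w ∈ ⋃ i, U i
          · obtain ⟨i, hi⟩ := mem_iUnion.1 hw
            rw [indicator_of_mem hw, ← indicator_of_mem hi c]
            exact Finset.single_le_sum (f := fun i => (U i).indicator c w)
              (fun _ _ => zero_le) (Finset.mem_univ i)
          · simp [indicator_of_notMem hw]
      _ = ∑ i, ∑' w, (U i).indicator c w := by
          rw [Summable.tsum_finsetSum fun _ _ => ENNReal.summable]
      _ ≤ ∑ i, (treeContent c (A i) + ε / Fintype.card ι) :=
          Finset.sum_le_sum fun i _ => (hU2 i).le
      _ = ∑ i, treeContent c (A i) + ε := by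
          rw [Finset.sum_add_distrib, Finset.sum_const, Finset.card_univ, nsmul_eq_mul,
            ENNReal.mul_div_cancel hcard.ne' (ENNReal.natCast_ne_top _)]

/-- Strong subadditivity. A point of `A ∩ B` lies in a cylinder of `U` and in one of `V`, and these
are nested. Either they coincide, or the longer word is not minimal in `U ∪ V`. The words `N`
arising so cover `A ∩ B`, and each word is counted in `treeTop (U ∪ V)` and `N` together at most as
often as in `U` and `V`. -/
theorem tsum_treeTop_add_treeContent_le (c : List α → ℝ≥0∞) {A B : Set (ℕ → α)}
    {U V : Set (List α)} (hU : A ⊆ ⋃ w ∈ U, treeCyl w) (hV : B ⊆ ⋃ w ∈ V, treeCyl w) :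
    ∑' w, (treeTop (U ∪ V)).indicator c w + treeContent c (A ∩ B)
      ≤ ∑' w, U.indicator c w + ∑' w, V.indicator c w := by
  classical
  set N : Set (List α) := (U ∩ V) ∪ ((U ∪ V) \ treeTop (U ∪ V)) with hN
  have hcov : A ∩ B ⊆ ⋃ w ∈ N, treeCyl w := by
    rintro x ⟨hxA, hxB⟩
    have hxU := hU hxA
    have hxV := hV hxB
    simp only [mem_iUnion] at hxU hxV ⊢
    obtain ⟨u, hu, hxu⟩ := hxU
    obtain ⟨v, hv, hxv⟩ := hxV
    have key : ∀ u ∈ U ∪ V, ∀ v ∈ U ∪ V, x ∈ treeCyl u → x ∈ treeCyl v → u.length < v.length →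
        v ∈ N := by
      intro u hu v hv hxu hxv hlt
      refine Or.inr ⟨hv, fun htop => ?_⟩
      have hs : u <:+ v := by
        rw [← mem_treeCyl.1 hxu, ← mem_treeCyl.1 hxv]
        exact res_suffix x hlt.le
      rw [htop.2 u hu hs] at hlt
      exact lt_irrefl _ hlt
    rcases lt_trichotomy u.length v.length with hlt | heq | hlt
    · exact ⟨v, key u (Or.inl hu) v (Or.inr hv) hxu hxv hlt, hxv⟩
    · have : u = v := by rw [← mem_treeCyl.1 hxu, ← mem_treeCyl.1 hxv, heq]
      exact ⟨u, Or.inl ⟨hu, this ▸ hv⟩, hxu⟩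
    · exact ⟨u, key v (Or.inr hv) u (Or.inl hu) hxv hxu hlt, hxu⟩
  refine (add_le_add le_rfl (treeContent_le hcov)).trans ?_
  rw [← ENNReal.tsum_add, ← ENNReal.tsum_add]
  refine ENNReal.tsum_le_tsum fun w => ?_
  have htop : w ∈ treeTop (U ∪ V) → w ∈ U ∪ V := fun h => h.1
  simp only [hN, indicator_apply, mem_union, mem_inter_iff, Set.mem_sdiff]
  by_cases h1 : w ∈ U <;> by_cases h2 : w ∈ V <;> by_cases h3 : w ∈ treeTop (U ∪ V) <;>
    simp_all

/-- The content is continuous along increasing unions of arbitrary sets. -/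
theorem treeContent_iUnion_le {c : List α → ℝ≥0∞} {A : ℕ → Set (ℕ → α)}
    (hA : Monotone A) {b : ℝ≥0∞} (hb : ∀ n, treeContent c (A n) ≤ b) (hb' : b ≠ ∞) :
    treeContent c (⋃ n, A n) ≤ b := by
  refine ENNReal.le_of_forall_pos_le_add fun ε hε _ => ?_
  obtain ⟨η, hη0, hη⟩ := ENNReal.exists_pos_sum_of_countable
    (ε := (ε : ℝ≥0∞)) (by exact_mod_cast hε.ne') ℕ
  have htop : ∀ n, treeContent c (A n) ≠ ∞ := fun n => ((hb n).trans_lt hb'.lt_top).ne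
  choose U hU1 hU2 using fun n => exists_cover_of_treeContent_lt (c := c) (A := A n)
    (b := treeContent c (A n) + η n)
    (ENNReal.lt_add_right (htop n) (by exact_mod_cast (hη0 n).ne'))
  set F : ℕ → Set (List α) := fun n => ⋃ i ≤ n, U i with hF
  have hFs : ∀ n, F (n + 1) = F n ∪ U (n + 1) := fun n => by
    ext w
    simp only [hF, mem_iUnion, mem_union, exists_prop, Nat.le_succ_iff]
    constructor
    · rintro ⟨i, hi | rfl, hw⟩
      · exact Or.inl ⟨i, hi, hw⟩
      · exact Or.inr hw
    · rintro (⟨i, hi, hw⟩ | hw)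
      · exact ⟨i, Or.inl hi, hw⟩
      · exact ⟨n + 1, Or.inr rfl, hw⟩
  have hUF : ∀ n, U n ⊆ F n := fun n w hw => mem_iUnion₂.2 ⟨n, le_rfl, hw⟩
  have hcovF : ∀ n, A n ⊆ ⋃ w ∈ treeTop (F n), treeCyl w := fun n =>
    ((hU1 n).trans (biUnion_mono (hUF n) fun _ _ => subset_rfl)).trans (iUnion_treeTop _)
  -- Strong subadditivity with `A n ∩ A (n + 1) = A n`: the term `treeContent c (A n)` cancels, and
  -- each new cover adds only its own error `η`.
  have hind : ∀ n, ∑' w, (treeTop (F n)).indicator c w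
      ≤ treeContent c (A n) + ∑ i ∈ Finset.range (n + 1), (η i : ℝ≥0∞) := by
    intro n
    induction n with
    | zero =>
      have : treeTop (F 0) ⊆ U 0 := by
        refine (treeTop_subset _).trans ?_
        simp [hF]
      refine (ENNReal.tsum_le_tsum fun w => ?_).trans ((hU2 0).le.trans (by simp))
      exact indicator_le_indicator_of_subset this (fun _ => zero_le) w
    | succ n ih =>
      have hsub : treeTop (F (n + 1)) ⊆ treeTop (treeTop (F n) ∪ U (n + 1)) := by
        intro w hw
        have hsub' : treeTop (F n) ∪ U (n + 1) ⊆ F (n + 1) := by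
          rw [hFs]
          exact union_subset_union_left _ (treeTop_subset _)
        refine ⟨?_, fun v hv hvw => hw.2 v (hsub' hv) hvw⟩
        have hw1 := hw.1
        rw [hFs] at hw1
        rcases hw1 with h | h
        · exact Or.inl ⟨h, fun v hv hvw => hw.2 v (by rw [hFs]; exact Or.inl hv) hvw⟩
        · exact Or.inr h
      have h1 := tsum_treeTop_add_treeContent_le c (hcovF n) (hU1 (n + 1))
      rw [inter_eq_left.2 (hA (Nat.le_succ n))] at h1
      have h2 : ∑' w, (treeTop (F (n + 1))).indicator c w
          ≤ ∑' w, (treeTop (treeTop (F n) ∪ U (n + 1))).indicator c w :=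
        ENNReal.tsum_le_tsum fun w => indicator_le_indicator_of_subset hsub (fun _ => zero_le) w
      have h3 := (add_le_add_left h2 (treeContent c (A n))).trans
        (h1.trans (add_le_add ih (hU2 (n + 1)).le))
      rw [Finset.sum_range_succ]
      refine (ENNReal.add_le_add_iff_right (htop n)).1 (h3.trans (le_of_eq ?_))
      ring
  set W := treeTop (⋃ n, U n)
  -- A minimal word of the full union is minimal in `F n` as soon as it has appeared, so any finite
  -- part of the cost of `W` is already seen at a single `n`.
  have hWF : ∀ w ∈ W, ∀ᶠ n in atTop, w ∈ treeTop (F n) := by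
    intro w hw
    obtain ⟨i, hi⟩ := mem_iUnion.1 hw.1
    filter_upwards [eventually_ge_atTop i] with n hn
    refine ⟨mem_iUnion₂.2 ⟨i, hn, hi⟩, fun v hv hvw => hw.2 v ?_ hvw⟩
    obtain ⟨j, -, hj⟩ := mem_iUnion₂.1 hv
    exact mem_iUnion.2 ⟨j, hj⟩
  have hcovW : ⋃ n, A n ⊆ ⋃ w ∈ W, treeCyl w := by
    refine (iUnion_subset fun n => (hU1 n).trans ?_).trans (iUnion_treeTop _)
    exact biUnion_mono (subset_iUnion U n) fun _ _ => subset_rfl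
  refine (treeContent_le hcovW).trans ?_
  rw [ENNReal.tsum_eq_iSup_sum]
  refine iSup_le fun s => ?_
  have hev : ∀ᶠ n in atTop, ∀ w ∈ s, W.indicator c w ≤ (treeTop (F n)).indicator c w := by
    refine (Finset.eventually_all s).2 fun w _ => ?_
    by_cases hw : w ∈ W
    · filter_upwards [hWF w hw] with n hn
      rw [indicator_of_mem hw, indicator_of_mem hn]
    · exact Eventually.of_forall fun n => by simp [indicator_of_notMem hw]
  obtain ⟨n, hn⟩ := hev.exists
  calc ∑ w ∈ s, W.indicator c w ≤ ∑ w ∈ s, (treeTop (F n)).indicator c w := Finset.sum_le_sum hn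
    _ ≤ ∑' w, (treeTop (F n)).indicator c w := ENNReal.sum_le_tsum s
    _ ≤ _ := hind n
    _ ≤ b + ε := add_le_add (hb n) ((ENNReal.sum_le_tsum _).trans hη.le)

variable [TopologicalSpace α] [DiscreteTopology α]

theorem isOpen_treeCyl (w : List α) : IsOpen (treeCyl w) := by
  rcases (treeCyl w).eq_empty_or_nonempty with h | ⟨x, hx⟩
  · rw [h]; exact isOpen_empty
  · have : treeCyl w = PiNat.cylinder x w.length := by
      rw [PiNat.cylinder_eq_res]
      ext y
      rw [mem_treeCyl, mem_ofPred_eq, mem_treeCyl.1 hx]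
    rw [this]
    exact PiNat.isOpen_cylinder _ _ _

/-- Capacitability: an analytic set of positive content contains a compact set of positive
content. -/
theorem exists_isCompact_treeContent_pos {c : List α → ℝ≥0∞} (hc : c [] ≠ ∞) {A : Set (ℕ → α)}
    (hA : AnalyticSet A) (hpos : treeContent c A ≠ 0) :
    ∃ S ⊆ A, IsCompact S ∧ treeContent c S ≠ 0 := by
  have htop : ∀ B, treeContent c B ≠ ∞ := fun B => by
    refine ((treeContent_mono (B := treeCyl []) ?_).trans_lt
      ((treeContent_treeCyl_le c []).trans_lt hc.lt_top)).ne
    intro x _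
    simp [mem_treeCyl]
  rw [analyticSet_iff_exists_polishSpace_range] at hA
  obtain ⟨β, _, _, g, hg, rfl⟩ := hA
  rcases isEmpty_or_nonempty β with hβ | hβ
  · rw [range_eq_empty, treeContent_empty] at hpos
    exact absurd rfl hpos
  obtain ⟨e, he, hes⟩ := PolishSpace.exists_nat_nat_continuous_surjective β
  set f : (ℕ → ℕ) → (ℕ → α) := g ∘ e with hf
  have hfc : Continuous f := hg.comp he
  have hrange : range g = range f := (hes.range_comp g).symm
  rw [hrange] at hpos ⊢
  obtain ⟨b, hb0, hb⟩ := exists_between (pos_iff_ne_zero.2 hpos)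
  -- Continuity along increasing unions allows one coordinate at a time to be bounded while the
  -- content of the image stays above `b`.
  have hstep : ∀ E : Set (ℕ → ℕ), b < treeContent c (f '' E) → ∀ k,
      ∃ m, b < treeContent c (f '' (E ∩ {σ | σ k ≤ m})) := by
    intro E hE k
    by_contra! hcon
    refine absurd hE (not_lt.2 ?_)
    have h1 : f '' E = ⋃ m, f '' (E ∩ {σ | σ k ≤ m}) := by
      rw [← image_iUnion, ← inter_iUnion]
      congr 1
      refine (inter_eq_left.2 fun σ _ => ?_).symm
      exact mem_iUnion.2 ⟨σ k, le_refl (σ k)⟩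
    rw [h1]
    refine treeContent_iUnion_le (fun m n hmn => image_mono ?_) hcon (hb.trans_le le_top).ne
    exact inter_subset_inter_right _ fun σ (hσ : σ k ≤ m) => le_trans hσ hmn
  choose! m hm using hstep
  let E : ℕ → Set (ℕ → ℕ) := fun n => Nat.rec univ (fun k E => E ∩ {σ | σ k ≤ m E k}) n
  have hE : ∀ n, b < treeContent c (f '' E n) := by
    intro n
    induction n with
    | zero => simpa [E] using hb
    | succ n ih => exact hm (E n) ih n
  set N : ℕ → ℕ := fun k => m (E k) k with hN
  have hEN : ∀ n, E n = {σ | ∀ k < n, σ k ≤ N k} := by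
    intro n
    induction n with
    | zero => simp [E]
    | succ n ih =>
      have : E (n + 1) = E n ∩ {σ | σ n ≤ N n} := rfl
      rw [this, ih]
      ext σ
      simp only [mem_inter_iff, mem_ofPred_eq, Nat.lt_succ_iff_lt_or_eq]
      constructor
      · rintro ⟨h1, h2⟩ k (hk | rfl)
        exacts [h1 k hk, h2]
      · exact fun h => ⟨fun k hk => h k (Or.inl hk), h n (Or.inr rfl)⟩
  set Q : Set (ℕ → ℕ) := Set.pi univ fun k => Iic (N k) with hQ
  have hQc : IsCompact Q := isCompact_univ_pi fun k => (finite_Iic (N k)).isCompact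
  refine ⟨f '' Q, image_subset_range _ _, hQc.image hfc, fun hzero => ?_⟩
  rw [← hzero] at hb0
  obtain ⟨U, hU, hUb⟩ := exists_cover_of_treeContent_lt hb0
  set O : Set (ℕ → ℕ) := f ⁻¹' ⋃ w ∈ U, treeCyl w with hO
  have hOo : IsOpen O := (isOpen_biUnion fun w _ => isOpen_treeCyl w).preimage hfc
  have hQO : Q ⊆ O := image_subset_iff.1 hU
  suffices h : ∃ n, E n ⊆ O by
    obtain ⟨n, hn⟩ := h
    exact absurd ((hE n).trans_le (treeContent_le (image_subset_iff.2 hn))) (not_lt.2 hUb.le)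
  -- `E n` bounds only the first `n` coordinates and is not compact. Points of `E n` outside `O`,
  -- truncated into `Q`, accumulate at a point of `Q`. Truncation leaves the first `n` coordinates
  -- unchanged, so the points themselves accumulate there, which contradicts that `O` is an open set
  -- containing `Q`.
  by_contra! hcon
  have hcon' : ∀ n, ∃ σ ∈ E n, σ ∉ O := fun n => not_subset.1 (hcon n)
  choose σ hσE hσO using hcon'
  set τ : ℕ → ℕ → ℕ := fun n k => min (σ n k) (N k)
  have hτQ : ∀ n, τ n ∈ Q := fun n k _ => mem_Iic.2 (min_le_right (σ n k) (N k))
  obtain ⟨ρ, hρQ, φ, hφ, hlim⟩ := hQc.tendsto_subseq hτQ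
  have hlim' : Tendsto (fun n => σ (φ n)) atTop (𝓝 ρ) := by
    rw [tendsto_pi_nhds] at hlim ⊢
    intro k
    refine (hlim k).congr' ?_
    filter_upwards [eventually_gt_atTop k] with n hn
    have h1 := hσE (φ n)
    rw [hEN] at h1
    exact min_eq_left (h1 k (hn.trans_le (hφ.id_le n)))
  obtain ⟨n, hn⟩ := (hlim'.eventually (hOo.mem_nhds (hQO hρQ))).exists
  exact hσO _ hn

end TreeContent

/-! ### Random walks down a tree and Frostman measures. -/

section TreeFlow

variable {α : Type*} [Fintype α]

/-- The transition weight from `w` to its child `a :: w` for the masses `H`. -/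
noncomputable def treeWeight (H : List α → ℝ≥0∞) (w : List α) (a : α) : ℝ≥0∞ :=
  H (a :: w) / ∑ b, H (b :: w)

/-- The distribution, started at `w`, of the chosen point of the word reached after `n` steps of
the random walk down the tree. -/
noncomputable def treeWalk [MeasurableSpace α] (H : List α → ℝ≥0∞) (z : List α → ℕ → α) :
    ℕ → List α → Measure (ℕ → α)
  | 0, w => Measure.dirac (z w)
  | n + 1, w => ∑ a, treeWeight H w a • treeWalk H z n (a :: w)

variable {H : List α → ℝ≥0∞}

theorem sum_treeWeight (htop : ∀ w, H w ≠ ∞) (hsub : ∀ w, H w ≤ ∑ a, H (a :: w)) {w : List α}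
    (hw : H w ≠ 0) : ∑ a, treeWeight H w a = 1 := by
  simp only [treeWeight, div_eq_mul_inv]
  rw [← Finset.sum_mul]
  refine ENNReal.mul_inv_cancel (fun h => hw ?_) (ENNReal.sum_ne_top.2 fun a _ => htop _)
  exact le_antisymm ((hsub w).trans h.le) zero_le

/-- By subadditivity the children weigh at least as much as the parent together, so dividing by
their sum only lowers their shares. -/
theorem mul_treeWeight_le (hsub : ∀ w, H w ≤ ∑ a, H (a :: w)) (w : List α) (a : α) :
    H w * treeWeight H w a ≤ H (a :: w) := by
  rw [treeWeight, ← mul_div_assoc]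
  refine ENNReal.div_le_of_le_mul ?_
  rw [mul_comm]
  exact mul_le_mul' le_rfl (hsub w)

theorem treeWeight_eq_zero {w : List α} {a : α} (h : H (a :: w) = 0) : treeWeight H w a = 0 := by
  rw [treeWeight, h, ENNReal.zero_div]

variable [MeasurableSpace α] {z : List α → ℕ → α}

theorem treeWalk_univ (htop : ∀ w, H w ≠ ∞) (hsub : ∀ w, H w ≤ ∑ a, H (a :: w)) (n : ℕ)
    {w : List α} (hw : H w ≠ 0) : treeWalk H z n w univ = 1 := by
  induction n generalizing w with
  | zero => simp [treeWalk]
  | succ n ih =>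
    rw [treeWalk, Measure.finsetSum_apply, ← sum_treeWeight htop hsub hw]
    refine Finset.sum_congr rfl fun a _ => ?_
    rw [Measure.smul_apply, smul_eq_mul]
    by_cases ha : H (a :: w) = 0
    · rw [treeWeight_eq_zero ha, zero_mul]
    · rw [ih ha, mul_one]

theorem treeWalk_compl {S : Set (ℕ → α)} (hS : MeasurableSet S)
    (hm : ∀ w : List α, MeasurableSet (treeCyl w))
    (hz : ∀ w, H w ≠ 0 → z w ∈ S ∩ treeCyl w) (n : ℕ) {w : List α} (hw : H w ≠ 0) :
    treeWalk H z n w (S ∩ treeCyl w)ᶜ = 0 := by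
  induction n generalizing w with
  | zero =>
    rw [treeWalk, Measure.dirac_apply' _ (hS.inter (hm w)).compl]
    simp [hz w hw]
  | succ n ih =>
    rw [treeWalk, Measure.finsetSum_apply]
    refine Finset.sum_eq_zero fun a _ => ?_
    rw [Measure.smul_apply, smul_eq_mul]
    by_cases ha : H (a :: w) = 0
    · rw [treeWeight_eq_zero ha, zero_mul]
    · refine mul_eq_zero_of_right _ (measure_mono_null ?_ (ih ha))
      exact compl_subset_compl.2 (inter_subset_inter_right _
        (treeCyl_subset (List.suffix_cons a w)))

theorem mul_treeWalk_treeCyl_le (htop : ∀ w, H w ≠ ∞) (hsub : ∀ w, H w ≤ ∑ a, H (a :: w))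
    {S : Set (ℕ → α)} (hS : MeasurableSet S) (hm : ∀ w : List α, MeasurableSet (treeCyl w))
    (hz : ∀ w, H w ≠ 0 → z w ∈ S ∩ treeCyl w) (n : ℕ) (w u : List α) (hw : H w ≠ 0)
    (hu : u.length ≤ n) : H w * treeWalk H z n w (treeCyl (u ++ w)) ≤ H (u ++ w) := by
  classical
  induction n generalizing w u with
  | zero =>
    obtain rfl : u = [] := List.length_eq_zero_iff.1 (by omega)
    rw [List.nil_append]
    exact mul_le_of_le_one_right' ((measure_mono (subset_univ _)).trans
      (treeWalk_univ htop hsub 0 hw).le)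
  | succ n ih =>
    -- Words are read backwards, so the first step of the walk from `w` is the last letter of `u`.
    -- Walks leaving through another child do not charge the cylinder.
    rcases u.eq_nil_or_concat with rfl | ⟨u', a, rfl⟩
    · rw [List.nil_append]
      exact mul_le_of_le_one_right' ((measure_mono (subset_univ _)).trans
        (treeWalk_univ htop hsub _ hw).le)
    · rw [List.concat_eq_append] at hu ⊢
      rw [List.append_assoc, List.singleton_append, treeWalk, Measure.finsetSum_apply,
        Finset.sum_eq_single a]
      · rw [Measure.smul_apply, smul_eq_mul]
        by_cases ha : H (a :: w) = 0
        · rw [treeWeight_eq_zero ha, zero_mul, mul_zero]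
          exact zero_le
        · rw [← mul_assoc]
          refine (mul_le_mul' (mul_treeWeight_le hsub w a) le_rfl).trans
            (ih (a :: w) u' ha (by simp at hu; omega))
      · intro b _ hba
        rw [Measure.smul_apply, smul_eq_mul]
        by_cases hb : H (b :: w) = 0
        · rw [treeWeight_eq_zero hb, zero_mul]
        · refine mul_eq_zero_of_right _ (measure_mono_null ?_ (treeWalk_compl hS hm hz n hb))
          intro x hx hx'
          have h1 := mem_treeCyl.1 (treeCyl_subset (List.suffix_append u' (a :: w)) hx)
          have h2 := mem_treeCyl.1 hx'.2
          simp only [List.length_cons] at h1 h2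
          rw [h1] at h2
          exact hba (List.cons.inj h2).1.symm
      · simp

end TreeFlow

/-- Frostman's lemma for trees. -/
theorem exists_frostman_tree {α : Type*} [Fintype α] [Nonempty α] [TopologicalSpace α]
    [DiscreteTopology α] [MeasurableSpace α] [BorelSpace α] {c : List α → ℝ≥0∞} (hc : ∀ w, c w ≠ ∞)
    {A : Set (ℕ → α)} (hA : MeasurableSet A) (hpos : treeContent c A ≠ 0) :
    ∃ S ⊆ A, IsCompact S ∧ ∃ (μ : Measure (ℕ → α)) (D : ℝ≥0), IsProbabilityMeasure μ ∧ μ Sᶜ = 0 ∧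
      ∀ w, μ (treeCyl w) ≤ D * c w := by
  have : PolishSpace α := inferInstance
  obtain ⟨S, hSA, hSc, hS⟩ := exists_isCompact_treeContent_pos (hc []) hA.analyticSet hpos
  refine ⟨S, hSA, hSc, ?_⟩
  set H : List α → ℝ≥0∞ := fun w => treeContent c (S ∩ treeCyl w) with hH
  have hm : ∀ w : List α, MeasurableSet (treeCyl w) := fun w => (isOpen_treeCyl w).measurableSet
  have hHc : ∀ w, H w ≤ c w := fun w =>
    (treeContent_mono inter_subset_right).trans (treeContent_treeCyl_le c w)
  have htop : ∀ w, H w ≠ ∞ := fun w => ((hHc w).trans_lt (hc w).lt_top).ne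
  have hsub : ∀ w, H w ≤ ∑ a, H (a :: w) := by
    intro w
    refine le_trans (treeContent_mono ?_) (treeContent_iUnion_le_sum c _)
    rintro x ⟨hxS, hx⟩
    refine mem_iUnion.2 ⟨x w.length, hxS, ?_⟩
    rw [mem_treeCyl, List.length_cons, PiNat.res_succ, mem_treeCyl.1 hx]
  have hex : ∀ w, ∃ z, H w ≠ 0 → z ∈ S ∩ treeCyl w := by
    intro w
    rcases (S ∩ treeCyl w).eq_empty_or_nonempty with he | ⟨z, hz⟩
    · refine ⟨fun _ => Classical.arbitrary α, fun h => absurd ?_ h⟩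
      simp only [hH, he, treeContent_empty]
    · exact ⟨z, fun _ => hz⟩
  choose z hz using hex
  have hH0 : H [] ≠ 0 := by
    have : S ∩ treeCyl [] = S := inter_eq_left.2 fun x _ => by simp [mem_treeCyl]
    simpa only [hH, this] using hS
  -- Sequences over a finite alphabet form a compact space, so the laws of the walks have a weak
  -- limit point. Both conclusions concern open sets, the complement of `S` and the cylinders, where
  -- limits of measures can only lose mass.
  let ν : ℕ → ProbabilityMeasure (ℕ → α) := fun n =>
    ⟨treeWalk H z n [], ⟨treeWalk_univ htop hsub n hH0⟩⟩
  obtain ⟨μ, -, φ, hφ, hlim⟩ := isCompact_univ.tendsto_subseq (x := ν) fun _ => mem_univ _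
  refine ⟨μ, (H [])⁻¹.toNNReal, inferInstance, ?_, fun w => ?_⟩
  · refine le_antisymm ?_ zero_le
    refine (ProbabilityMeasure.le_liminf_measure_open_of_tendsto hlim
      hSc.isClosed.isOpen_compl).trans ?_
    refine liminf_le_of_frequently_le' (Frequently.of_forall fun n => ?_)
    refine (measure_mono_null ?_
      (treeWalk_compl hSc.isClosed.measurableSet hm hz (φ n) hH0)).le
    exact compl_subset_compl.2 inter_subset_left
  · refine (ProbabilityMeasure.le_liminf_measure_open_of_tendsto hlim (isOpen_treeCyl w)).trans ?_
    refine liminf_le_of_frequently_le' (Eventually.frequently ?_)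
    filter_upwards [eventually_ge_atTop w.length] with n hn
    have h1 := mul_treeWalk_treeCyl_le htop hsub hSc.isClosed.measurableSet hm hz (φ n) [] w hH0
      (hn.trans (hφ.id_le n))
    rw [List.append_nil] at h1
    rw [ENNReal.coe_toNNReal (ENNReal.inv_ne_top.2 hH0), ← ENNReal.div_eq_inv_mul]
    refine (ENNReal.le_div_iff_mul_le (Or.inl hH0) (Or.inl (htop _))).2 ?_
    rw [mul_comm]
    exact h1.trans (hHc w)

/-! ### Coding of the square and Frostman's lemma in the plane. -/

/-- The integer whose binary expansion is given by the first `n` digits. -/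
def binVal (d : ℕ → Fin 2) : ℕ → ℕ
  | 0 => 0
  | n + 1 => 2 * binVal d n + d n

theorem binVal_eq_sum (d : ℕ → Fin 2) (n : ℕ) :
    (binVal d n : ℝ) = 2 ^ n * ∑ i ∈ Finset.range n, Real.ofDigitsTerm d i := by
  induction n with
  | zero => simp [binVal]
  | succ n ih =>
    rw [Finset.sum_range_succ, mul_add, pow_succ, mul_right_comm, ← ih, binVal, Real.ofDigitsTerm]
    push_cast
    field_simp
    ring

theorem binVal_le (d : ℕ → Fin 2) (n : ℕ) : (binVal d n : ℝ) ≤ 2 ^ n * Real.ofDigits d := by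
  rw [binVal_eq_sum, Real.ofDigits_eq_sum_add_ofDigits d n]
  have := Real.ofDigits_nonneg fun i => d (i + n)
  push_cast
  rw [mul_add]
  exact le_add_of_nonneg_right (by positivity)

theorem le_binVal_add_one (d : ℕ → Fin 2) (n : ℕ) :
    2 ^ n * Real.ofDigits d ≤ (binVal d n : ℝ) + 1 := by
  rw [binVal_eq_sum, Real.ofDigits_eq_sum_add_ofDigits d n]
  have := Real.ofDigits_le_one fun i => d (i + n)
  push_cast
  rw [mul_add, ← mul_assoc, mul_inv_cancel₀ (by positivity), one_mul]
  linarith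

theorem eq_of_binVal_eq {d e : ℕ → Fin 2} {n : ℕ} (h : binVal d n = binVal e n) :
    ∀ i < n, d i = e i := by
  induction n with
  | zero => intro i hi; omega
  | succ n ih =>
    have hd := (d n).2
    have he := (e n).2
    simp only [binVal] at h
    intro i hi
    rcases Nat.lt_succ_iff_lt_or_eq.1 hi with hi | rfl
    · exact ih (by omega) i hi
    · exact Fin.ext (by omega)

/-- The coding of the square `[-R, R]²` by pairs of binary expansions. -/
noncomputable def squareCode (R : ℝ) (x : ℕ → Fin 2 × Fin 2) : Plane :=
  !₂[-R + 2 * R * Real.ofDigits fun i => (x i).1, -R + 2 * R * Real.ofDigits fun i => (x i).2]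

theorem continuous_squareCode (R : ℝ) : Continuous (squareCode R) := by
  have h1 : Continuous fun x : ℕ → Fin 2 × Fin 2 => Real.ofDigits fun i => (x i).1 :=
    Real.continuous_ofDigits.comp (by fun_prop)
  have h2 : Continuous fun x : ℕ → Fin 2 × Fin 2 => Real.ofDigits fun i => (x i).2 :=
    Real.continuous_ofDigits.comp (by fun_prop)
  unfold squareCode
  refine (PiLp.continuous_toLp 2 _).comp (continuous_pi fun i => ?_)
  fin_cases i
  · simpa using by fun_prop
  · simpa using by fun_prop

theorem exists_squareCode_eq {R : ℝ} (hR : 0 < R) {p : Plane} (hp : p ∈ Metric.closedBall 0 R) :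
    ∃ x, squareCode R x = p := by
  have hcoord : ∀ i, ∃ d : ℕ → Fin 2, -R + 2 * R * Real.ofDigits d = p i := by
    intro i
    have h1 : |p i| ≤ R := by
      have := PiLp.norm_apply_le p i
      rw [mem_closedBall_zero_iff] at hp
      exact this.trans hp
    obtain ⟨d, -, hd⟩ := Real.ofDigits_SurjOn (b := 2) one_lt_two
      (show (p i + R) / (2 * R) ∈ Icc (0 : ℝ) 1 by
        have := abs_le.1 h1
        constructor
        · exact div_nonneg (by linarith) (by linarith)
        · rw [div_le_one (by linarith)]; linarith)
    refine ⟨d, ?_⟩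
    rw [hd]
    field_simp
    ring
  obtain ⟨d, hd⟩ := hcoord 0
  obtain ⟨e, he⟩ := hcoord 1
  refine ⟨fun i => (d i, e i), ?_⟩
  ext i
  fin_cases i
  · simpa [squareCode] using hd
  · simpa [squareCode] using he

theorem dist_squareCode_le {R : ℝ} (hR : 0 < R) {n : ℕ} {x y : ℕ → Fin 2 × Fin 2}
    (h : ∀ i < n, x i = y i) : dist (squareCode R x) (squareCode R y) ≤ 4 * R / 2 ^ n := by
  have h1 := Real.abs_ofDigits_sub_ofDigits_le (x := fun i => (x i).1) (y := fun i => (y i).1)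
    (n := n) (fun i hi => by rw [h i hi])
  have h2 := Real.abs_ofDigits_sub_ofDigits_le (x := fun i => (x i).2) (y := fun i => (y i).2)
    (n := n) (fun i hi => by rw [h i hi])
  rw [EuclideanSpace.dist_eq, Fin.sum_univ_two]
  refine Real.sqrt_le_iff.2 ⟨by positivity, ?_⟩
  simp only [squareCode, PiLp.toLp_apply, Matrix.cons_val_zero, Matrix.cons_val_one, Real.dist_eq]
  have key : ∀ u v : ℝ, |u - v| ≤ (((2 : ℕ) : ℝ) ^ n)⁻¹ →
      |-R + 2 * R * u - (-R + 2 * R * v)| ^ 2 ≤ (4 * R / 2 ^ n) ^ 2 / 4 := by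
    intro u v huv
    have e1 : -R + 2 * R * u - (-R + 2 * R * v) = 2 * R * (u - v) := by ring
    rw [e1, abs_mul, abs_of_pos (by linarith : 0 < 2 * R)]
    have e2 : (4 * R / 2 ^ n) ^ 2 / 4 = (2 * R * (((2 : ℕ) : ℝ) ^ n)⁻¹) ^ 2 := by
      push_cast
      field_simp
      ring
    rw [e2]
    gcongr
  have k1 := key _ _ h1
  have k2 := key _ _ h2
  have : 0 ≤ (4 * R / 2 ^ n) ^ 2 := by positivity
  linarith

/-- A set of positive Hausdorff measure has positive content in the coding space. -/
theorem treeContent_squareCode_ne_zero {R t : ℝ} (hR : 0 < R) (ht : 0 < t) {K : Set Plane}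
    (hK : K ⊆ Metric.closedBall 0 R) (hpos : μH[t] K ≠ 0) :
    treeContent (fun w => ENNReal.ofReal (((2 : ℝ) ^ t)⁻¹ ^ w.length)) (squareCode R ⁻¹' K) ≠ 0 := by
  intro hzero
  apply hpos
  set ρ : ℝ := ((2 : ℝ) ^ t)⁻¹ with hρ
  have h2t : 1 < (2 : ℝ) ^ t := Real.one_lt_rpow one_lt_two ht
  have hρ0 : 0 < ρ := by positivity
  have hρ1 : ρ < 1 := inv_lt_one_of_one_lt₀ h2t
  have hex : ∀ n : ℕ, ∃ U : Set (List (Fin 2 × Fin 2)), squareCode R ⁻¹' K ⊆ ⋃ w ∈ U, treeCyl w ∧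
      ∑' w, U.indicator (fun w => ENNReal.ofReal (ρ ^ w.length)) w < ENNReal.ofReal (ρ ^ n) :=
    fun n => exists_cover_of_treeContent_lt (by
      rw [hzero]; exact ENNReal.ofReal_pos.2 (by positivity))
  choose U hU1 hU2 using hex
  -- A cover of cost below `ρ ^ n` uses only words longer than `n`. Cheap covers are thus
  -- automatically fine, and zero content forces zero Hausdorff measure.
  have hlen : ∀ n, ∀ w ∈ U n, n < w.length := by
    intro n w hw
    have h1 := (ENNReal.le_tsum w).trans_lt (hU2 n)
    rw [indicator_of_mem hw, ENNReal.ofReal_lt_ofReal_iff (by positivity)] at h1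
    exact (pow_lt_pow_iff_right_of_lt_one₀ hρ0 hρ1).1 h1
  have hdiam : ∀ w : List (Fin 2 × Fin 2),
      Metric.ediam (squareCode R '' treeCyl w) ≤ ENNReal.ofReal (4 * R / 2 ^ w.length) := by
    intro w
    refine Metric.ediam_image_le_iff.2 fun x hx y hy => ?_
    rw [edist_dist]
    refine ENNReal.ofReal_le_ofReal (dist_squareCode_le hR ?_)
    rw [mem_treeCyl] at hx hy
    exact fun i hi => PiNat.res_eq_res.1 (hx.trans hy.symm) hi
  have hdiam' : ∀ w : List (Fin 2 × Fin 2),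
      Metric.ediam (squareCode R '' treeCyl w) ^ t
        ≤ ENNReal.ofReal ((4 * R) ^ t) * ENNReal.ofReal (ρ ^ w.length) := by
    intro w
    refine (ENNReal.rpow_le_rpow (hdiam w) ht.le).trans (le_of_eq ?_)
    rw [ENNReal.ofReal_rpow_of_nonneg (by positivity) ht.le, ← ENNReal.ofReal_mul (by positivity),
      Real.div_rpow (by positivity) (by positivity), hρ, inv_pow, div_eq_mul_inv,
      ← Real.rpow_natCast, ← Real.rpow_natCast, ← Real.rpow_mul two_pos.le,
      ← Real.rpow_mul two_pos.le, mul_comm t]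
  set T : ℕ → List (Fin 2 × Fin 2) → Set Plane := fun n w =>
    ⋃ _ : w ∈ U n, squareCode R '' treeCyl w with hT
  have hlim4 : Tendsto (fun n : ℕ => 4 * R / 2 ^ n) atTop (𝓝 0) := by
    have := (tendsto_pow_atTop_nhds_zero_of_lt_one (r := (1 / 2 : ℝ)) (by norm_num)
      (by norm_num)).const_mul (4 * R)
    rw [mul_zero] at this
    refine this.congr fun k => ?_
    rw [one_div, inv_pow, div_eq_mul_inv]
  have h1 := Measure.hausdorffMeasure_le_liminf_tsum (X := Plane) t K (l := atTop)
    (fun n : ℕ => ENNReal.ofReal (4 * R / 2 ^ n))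
    (by simpa using ENNReal.tendsto_ofReal hlim4) T
    (Eventually.of_forall fun n w => by
      by_cases hw : w ∈ U n
      · simp only [hT, hw, iUnion_true]
        refine (hdiam w).trans (ENNReal.ofReal_le_ofReal ?_)
        have := (hlen n w hw).le
        gcongr
        exact one_le_two
      · simp [hT, hw])
    (Eventually.of_forall fun n p hp => by
      obtain ⟨x, rfl⟩ := exists_squareCode_eq hR (hK hp)
      have := hU1 n hp
      simp only [mem_iUnion] at this ⊢
      obtain ⟨w, hw, hx⟩ := this
      exact ⟨w, mem_iUnion.2 ⟨hw, x, hx, rfl⟩⟩)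
  have h2 : ∀ n, ∑' w, Metric.ediam (T n w) ^ t
      ≤ ENNReal.ofReal ((4 * R) ^ t) * ENNReal.ofReal (ρ ^ n) := by
    intro n
    refine le_trans ?_ (mul_le_mul' le_rfl (hU2 n).le)
    rw [← ENNReal.tsum_mul_left]
    refine ENNReal.tsum_le_tsum fun w => ?_
    by_cases hw : w ∈ U n
    · simp only [hT, hw, iUnion_true, indicator_of_mem]
      exact hdiam' w
    · simp [hT, hw, ENNReal.zero_rpow_of_pos ht]
  have h3 : Tendsto (fun n : ℕ => ENNReal.ofReal ((4 * R) ^ t) * ENNReal.ofReal (ρ ^ n)) atTop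
      (𝓝 0) := by
    have := ENNReal.Tendsto.const_mul (a := ENNReal.ofReal ((4 * R) ^ t))
      (ENNReal.tendsto_ofReal (tendsto_pow_atTop_nhds_zero_of_lt_one hρ0.le hρ1))
      (Or.inr ENNReal.ofReal_ne_top)
    simpa using this
  refine le_antisymm (h1.trans ?_) zero_le
  rw [← h3.liminf_eq]
  exact liminf_le_liminf (Eventually.of_forall h2)

theorem squareCode_preimage_ball_subset {R r : ℝ} (hR : 0 < R) (p : Plane) {n : ℕ}
    (hr : r ≤ 2 * R / 2 ^ n) :
    ∃ a b : ℤ, squareCode R ⁻¹' Metric.ball p r ⊆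
      ⋃ ij ∈ Finset.Icc (a - 1) (a + 1) ×ˢ Finset.Icc (b - 1) (b + 1),
        {x | (binVal (fun i => (x i).1) n : ℤ) = ij.1 ∧ (binVal (fun i => (x i).2) n : ℤ) = ij.2} := by
  have key : ∀ (u v : ℝ) (d : ℕ → Fin 2), |(-R + 2 * R * Real.ofDigits d) - u| < r →
      (binVal d n : ℤ) ∈ Finset.Icc (⌊2 ^ n * (u + R) / (2 * R)⌋ - 1)
        (⌊2 ^ n * (u + R) / (2 * R)⌋ + 1) := by
    intro u v d hd
    set A := 2 ^ n * (u + R) / (2 * R) with hA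
    have h1 := binVal_le d n
    have h2 := le_binVal_add_one d n
    -- In units of the level-`n` grid the ball has radius at most 1, and cutting the expansion
    -- lowers the value by at most 1. This leaves three integers per coordinate, whichever expansion
    -- is chosen for a dyadic number.
    have hlt : |2 ^ n * Real.ofDigits d - A| < 1 := by
      have e1 : 2 ^ n * Real.ofDigits d - A
          = (2 ^ n / (2 * R)) * ((-R + 2 * R * Real.ofDigits d) - u) := by
        rw [hA]; field_simp; ring
      rw [e1, abs_mul, abs_of_pos (by positivity)]
      calc 2 ^ n / (2 * R) * |(-R + 2 * R * Real.ofDigits d) - u|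
          < 2 ^ n / (2 * R) * (2 * R / 2 ^ n) :=
            mul_lt_mul_of_pos_left (hd.trans_le hr) (by positivity)
        _ = 1 := by field_simp
    have h3 := abs_lt.1 hlt
    have h4 := Int.floor_le A
    have h5 := Int.lt_floor_add_one A
    rw [Finset.mem_Icc]
    constructor
    · have : ((⌊A⌋ : ℤ) : ℝ) - 2 < ((binVal d n : ℤ) : ℝ) := by push_cast; linarith
      have : ⌊A⌋ - 2 < (binVal d n : ℤ) := by exact_mod_cast this
      omega
    · have : ((binVal d n : ℤ) : ℝ) < ((⌊A⌋ : ℤ) : ℝ) + 2 := by push_cast; linarith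
      have : (binVal d n : ℤ) < ⌊A⌋ + 2 := by exact_mod_cast this
      omega
  refine ⟨_, _, fun x hx => mem_iUnion₂.2 ⟨(_, _), Finset.mem_product.2
    ⟨key (p 0) 0 (fun i => (x i).1) ?_, key (p 1) 0 (fun i => (x i).2) ?_⟩, rfl, rfl⟩⟩
  · have h1 := PiLp.norm_apply_le (squareCode R x - p) 0
    rw [mem_preimage, Metric.mem_ball, dist_eq_norm] at hx
    simpa [squareCode] using h1.trans_lt hx
  · have h1 := PiLp.norm_apply_le (squareCode R x - p) 1
    rw [mem_preimage, Metric.mem_ball, dist_eq_norm] at hx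
    simpa [squareCode] using h1.trans_lt hx

/-- Frostman's lemma for bounded Borel subsets of the plane. -/
theorem exists_frostman {R t : ℝ} (hR : 0 < R) (ht : 0 < t) {K : Set Plane} (hKm : MeasurableSet K)
    (hK : K ⊆ Metric.closedBall 0 R) (hpos : μH[t] K ≠ 0) :
    ∃ S ⊆ K, IsCompact S ∧ ∃ (ν : Measure Plane) (D : ℝ), IsProbabilityMeasure ν ∧ ν Sᶜ = 0 ∧
      0 ≤ D ∧ ∀ x r, 0 < r → ν (Metric.ball x r) ≤ ENNReal.ofReal (D * r ^ t) := by
  set c : List (Fin 2 × Fin 2) → ℝ≥0∞ := fun w => ENNReal.ofReal (((2 : ℝ) ^ t)⁻¹ ^ w.length)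
  have hcont := continuous_squareCode R
  obtain ⟨S, hSK, hS, μ, D, hμ, hμS, hμD⟩ := exists_frostman_tree (c := c)
    (fun _ => ENNReal.ofReal_ne_top) (hcont.measurable hKm)
    (treeContent_squareCode_ne_zero hR ht hK hpos)
  have hS' := hS.image hcont
  refine ⟨squareCode R '' S, image_subset_iff.2 hSK, hS', μ.map (squareCode R),
    -- The first term counts nine dyadic squares. The second handles radii at least `2 * R`, where
    -- total mass one is enough.
    9 * D * (R ^ t)⁻¹ + ((2 * R) ^ t)⁻¹, Measure.isProbabilityMeasure_map hcont.aemeasurable,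
    ?_, by positivity, fun p r hr => ?_⟩
  · rw [Measure.map_apply hcont.measurable hS'.measurableSet.compl]
    exact measure_mono_null (fun x hx hxS => hx ⟨x, hxS, rfl⟩) hμS
  · rw [Measure.map_apply hcont.measurable measurableSet_ball]
    have hrt : 0 < r ^ t := Real.rpow_pos_of_pos hr t
    rcases le_or_gt (2 * R) r with hrR | hrR
    · refine prob_le_one.trans ?_
      rw [← ENNReal.ofReal_one]
      refine ENNReal.ofReal_le_ofReal ?_
      have h1 : 1 ≤ ((2 * R) ^ t)⁻¹ * r ^ t := by
        rw [← div_eq_inv_mul, one_le_div (by positivity)]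
        exact Real.rpow_le_rpow (by positivity) hrR ht.le
      have h2 : 0 ≤ 9 * (D : ℝ) * (R ^ t)⁻¹ * r ^ t := by positivity
      linarith
    · obtain ⟨n, hn1, hn2⟩ := exists_nat_pow_near (x := 2 * R / r) (y := 2)
        (by rw [le_div_iff₀ hr]; linarith) one_lt_two
      rw [le_div_iff₀ hr] at hn1
      rw [div_lt_iff₀ hr] at hn2
      obtain ⟨a, b, hab⟩ := squareCode_preimage_ball_subset hR p (n := n) (r := r) (by
        rw [le_div_iff₀ (by positivity)]; linarith)
      refine (measure_mono hab).trans ((measure_biUnion_finset_le _ _).trans ?_)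
      have hterm : ∀ ij : ℤ × ℤ, μ {x | (binVal (fun i => (x i).1) n : ℤ) = ij.1 ∧
          (binVal (fun i => (x i).2) n : ℤ) = ij.2} ≤ ENNReal.ofReal (D * ((2 : ℝ) ^ t)⁻¹ ^ n) := by
        intro ij
        rcases Set.eq_empty_or_nonempty {x : ℕ → Fin 2 × Fin 2 |
          (binVal (fun i => (x i).1) n : ℤ) = ij.1 ∧
            (binVal (fun i => (x i).2) n : ℤ) = ij.2} with he | ⟨y, hy⟩
        · rw [he, measure_empty]; exact zero_le
        · refine (measure_mono fun x hx => ?_).trans ((hμD (PiNat.res y n)).trans ?_)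
          · rw [mem_treeCyl, PiNat.res_length, PiNat.res_eq_res]
            intro i hi
            exact Prod.ext (eq_of_binVal_eq (by exact_mod_cast hx.1.trans hy.1.symm) i hi)
              (eq_of_binVal_eq (by exact_mod_cast hx.2.trans hy.2.symm) i hi)
          · simp only [c, PiNat.res_length]
            rw [ENNReal.ofReal_mul (p := (D : ℝ)) D.2, ENNReal.ofReal_coe_nnreal]
      refine (Finset.sum_le_card_nsmul _ _ _ fun ij _ => hterm ij).trans ?_
      rw [Finset.card_product, Int.card_Icc, Int.card_Icc]
      have e9 : (a + 1 + 1 - (a - 1)).toNat * (b + 1 + 1 - (b - 1)).toNat = 9 := by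
        have e1 : (a + 1 + 1 - (a - 1)).toNat = 3 := by omega
        have e2 : (b + 1 + 1 - (b - 1)).toNat = 3 := by omega
        rw [e1, e2]
      rw [e9, nsmul_eq_mul, Nat.cast_ofNat, ← ENNReal.ofReal_ofNat 9,
        ← ENNReal.ofReal_mul (by norm_num)]
      refine ENNReal.ofReal_le_ofReal ?_
      have h1 : ((2 : ℝ) ^ t)⁻¹ ^ n ≤ (R ^ t)⁻¹ * r ^ t := by
        rw [inv_pow, ← div_eq_inv_mul, ← Real.div_rpow hr.le hR.le, inv_le_comm₀ (by positivity)
          (by positivity), ← Real.inv_rpow (by positivity), inv_div, ← Real.rpow_natCast,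
          ← Real.rpow_mul two_pos.le, mul_comm, Real.rpow_mul two_pos.le, Real.rpow_natCast]
        refine Real.rpow_le_rpow (by positivity) ?_ ht.le
        rw [div_le_iff₀ hr]
        rw [pow_succ] at hn2
        linarith
      have h2 : 0 ≤ ((2 * R) ^ t)⁻¹ * r ^ t := by positivity
      have h3 : 9 * ((D : ℝ) * ((2 : ℝ) ^ t)⁻¹ ^ n) ≤ 9 * ((D : ℝ) * ((R ^ t)⁻¹ * r ^ t)) := by
        gcongr
      linarith

/-! ### Positivity of the limit mass. -/

/-- Truncation at `T` with a moment bound for the excess: the form in which a moment of order `1 +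
θ` provides uniform integrability. -/
theorem ENNReal.le_min_add_mul_rpow {z T : ℝ≥0∞} {θ : ℝ} (hθ : 0 < θ) (hT : T ≠ 0) (hT' : T ≠ ∞) :
    z ≤ min z T + T ^ (-θ) * z ^ (1 + θ) := by
  rcases le_total z T with h | h
  · rw [min_eq_left h]; exact le_self_add
  · refine le_add_left ?_
    have hz : z ≠ 0 := fun h0 => hT (le_antisymm (h0 ▸ h) zero_le)
    rcases eq_or_ne z ∞ with rfl | hz'
    · rw [ENNReal.top_rpow_of_pos (by linarith), ENNReal.mul_top]
      exact (ENNReal.rpow_pos (pos_iff_ne_zero.2 hT) hT').ne'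
    · rw [ENNReal.rpow_add _ _ hz hz', ENNReal.rpow_one, mul_left_comm, ENNReal.rpow_neg,
        ← ENNReal.div_eq_inv_mul, ← ENNReal.div_rpow_of_nonneg _ _ hθ.le]
      refine le_mul_of_one_le_right' (ENNReal.one_le_rpow ?_ hθ)
      rw [ENNReal.le_div_iff_mul_le (Or.inl hT) (Or.inl hT'), one_mul]
      exact h

theorem chaos_add_apply {Ω : Type*} {κ : ℕ → ℝ → ℝ} {Y : ℕ → Plane → Ω → ℝ} (q : ℝ)
    (ν : Measure Plane) (k n : ℕ) (ω : Ω) {A : Set Plane} (hA : MeasurableSet A)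
    (hm : ∀ j, Measurable fun x => Y j x ω) :
    chaos κ Y q ν (k + n) ω A = ∫⁻ x in A, expWeight κ Y q n x ω
      ∂(chaos (fun i d => κ (i + n) d - κ n d) (fun i x ω => Y (i + n) x ω - Y n x ω) q ν k ω) := by
  rw [chaos_apply _ _ _ _ _ _ hA, chaos, restrict_withDensity hA,
    lintegral_withDensity_eq_lintegral_mul]
  · refine lintegral_congr fun x => ?_
    rw [expWeight_add, mul_comm]
    rfl
  · unfold expWeight
    exact (Real.measurable_exp.comp ((((hm _).sub (hm _)).const_mul q).sub_const _)).ennreal_ofReal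
  · unfold expWeight
    exact (Real.measurable_exp.comp (((hm _).const_mul q).sub_const _)).ennreal_ofReal

theorem measurableSet_limsup_eq_zero {Ω : Type*} {m : MeasurableSpace Ω} {f : ℕ → Ω → ℝ≥0∞}
    (hf : ∀ n, Measurable (f n)) : MeasurableSet {ω | limsup (fun n => f n ω) atTop = 0} :=
  (Measurable.limsup hf) (measurableSet_singleton 0)

namespace IsScaleField

variable {Ω : Type*} [mΩ : MeasurableSpace Ω] {P : Measure Ω} {κ : ℕ → ℝ → ℝ}
  {Y : ℕ → Plane → Ω → ℝ} {L C r₀ : ℝ}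

theorem measurable_left (h : IsScaleField P κ Y) (n : ℕ) (ω : Ω) : Measurable fun x => Y n x ω :=
  (h.continuous n ω).measurable

/-- Vanishing of the limit mass does not depend on the fields up to level `m`. -/
theorem limsup_chaos_eq_zero_iff (h : IsScaleField P κ Y) (q : ℝ) (ν : Measure Plane)
    {S : Set Plane} (hS : IsCompact S) (hνS : ν Sᶜ = 0) (m : ℕ) (ω : Ω) :
    limsup (fun n => chaos κ Y q ν n ω univ) atTop = 0 ↔
      limsup (fun n => chaos (fun i d => κ (i + m) d - κ m d)
        (fun i x ω => Y (i + m) x ω - Y m x ω) q ν n ω univ) atTop = 0 := by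
  set κ' : ℕ → ℝ → ℝ := fun i d => κ (i + m) d - κ m d
  set Y' : ℕ → Plane → Ω → ℝ := fun i x ω => Y (i + m) x ω - Y m x ω
  -- On the compact set `S` the exponent of level `m` is bounded for this `ω`, so removing the first
  -- levels changes all masses by a factor at most `exp c`.
  obtain ⟨c, hc⟩ := hS.exists_bound_of_continuousOn
    (f := fun x => q * Y m x ω - q ^ 2 / 2 * κ m 0)
    (((h.continuous m ω).const_mul q).sub continuous_const).continuousOn
  have hae : ∀ n, ∀ᵐ x ∂(chaos κ' Y' q ν n ω), x ∈ S := fun n =>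
    (withDensity_absolutelyContinuous ν _).ae_le (mem_ae_iff.2 hνS)
  have hup : ∀ n, chaos κ Y q ν (n + m) ω univ
      ≤ ENNReal.ofReal (Real.exp c) * chaos κ' Y' q ν n ω univ := by
    intro n
    rw [chaos_add_apply q ν n m ω MeasurableSet.univ (fun j => h.measurable_left j ω),
      Measure.restrict_univ, ← lintegral_const]
    refine lintegral_mono_ae ?_
    filter_upwards [hae n] with x hx
    exact ENNReal.ofReal_le_ofReal (Real.exp_le_exp.2 (abs_le.1 (hc x hx)).2)
  have hlo : ∀ n, chaos κ' Y' q ν n ω univ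
      ≤ ENNReal.ofReal (Real.exp c) * chaos κ Y q ν (n + m) ω univ := by
    intro n
    rw [chaos_add_apply q ν n m ω MeasurableSet.univ (fun j => h.measurable_left j ω),
      Measure.restrict_univ, ← lintegral_const_mul _ (h.measurable_expWeight_left q m ω)]
    refine le_trans (le_of_eq (by rw [lintegral_one])) (lintegral_mono_ae (f := fun _ => 1) ?_)
    filter_upwards [hae n] with x hx
    rw [expWeight, ENNReal.ofReal_exp_mul, ← ENNReal.ofReal_one]
    refine ENNReal.ofReal_le_ofReal (Real.one_le_exp ?_)
    linarith [(abs_le.1 (hc x hx)).1]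
  have hshift : limsup (fun n => chaos κ Y q ν (n + m) ω univ) atTop
      = limsup (fun n => chaos κ Y q ν n ω univ) atTop :=
    limsup_nat_add (fun n => chaos κ Y q ν n ω univ) m
  rw [← hshift]
  constructor
  · intro h0
    refine le_antisymm ((limsup_le_limsup (Eventually.of_forall hlo)).trans ?_) zero_le
    rw [ENNReal.limsup_const_mul_of_ne_top ENNReal.ofReal_ne_top, h0, mul_zero]
  · intro h0
    refine le_antisymm ((limsup_le_limsup (Eventually.of_forall hup)).trans ?_) zero_le
    rw [ENNReal.limsup_const_mul_of_ne_top ENNReal.ofReal_ne_top, h0, mul_zero]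

/-- Zero-one law for the vanishing of the limit mass. -/
theorem measure_limsup_chaos_eq_zero_or_one (h : IsScaleField P κ Y) (q : ℝ) (ν : Measure Plane)
    [IsFiniteMeasure ν] {S : Set Plane} (hS : IsCompact S) (hνS : ν Sᶜ = 0) :
    P {ω | limsup (fun n => chaos κ Y q ν n ω univ) atTop = 0} = 0 ∨
      P {ω | limsup (fun n => chaos κ Y q ν n ω univ) atTop = 0} = 1 := by
  have hP := h.isProbabilityMeasure
  set E : Set Ω := {ω | limsup (fun n => chaos κ Y q ν n ω univ) atTop = 0} with hE
  have hEpast : MeasurableSet[⨆ n, fieldPast Y n] E := by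
    have hm : ∀ n, Measurable[⨆ n, fieldPast Y n] (fun ω => chaos κ Y q ν n ω univ) := fun n =>
      (measurable_chaos_of_continuous (m := fieldPast Y n) κ q ν n MeasurableSet.univ
        (measure_ne_top _ _) (fun x _ => measurable_fieldPast Y le_rfl x) (h.continuous n)).mono
        (le_iSup (fieldPast Y) n) le_rfl
    exact measurableSet_limsup_eq_zero hm
  have hEfut : ∀ m, MeasurableSet[fieldFuture Y m] E := by
    intro m
    have hm : ∀ n, Measurable[fieldFuture Y m] (fun ω => chaos (fun i d => κ (i + m) d - κ m d)
        (fun i x ω => Y (i + m) x ω - Y m x ω) q ν n ω univ) := fun n =>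
      measurable_chaos_of_continuous (m := fieldFuture Y m) _ q ν n MeasurableSet.univ
        (measure_ne_top _ _) (fun x _ => measurable_fieldFuture Y n m x)
        ((h.increments m).continuous n)
    have h1 : E = {ω | limsup (fun n => chaos (fun i d => κ (i + m) d - κ m d)
        (fun i x ω => Y (i + m) x ω - Y m x ω) q ν n ω univ) atTop = 0} := by
      ext ω
      exact h.limsup_chaos_eq_zero_iff q ν hS hνS m ω
    rw [h1]
    exact measurableSet_limsup_eq_zero hm
  -- `E` belongs to every future, so it is independent of every past and hence of their supremum,
  -- which contains `E` itself.
  have hle : ∀ m, MeasurableSpace.generateFrom {E} ≤ fieldFuture Y m := fun m =>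
    MeasurableSpace.generateFrom_le fun t ht => by
      rw [mem_singleton_iff.1 ht]; exact hEfut m
  have hind := indep_iSup_of_monotone
    (fun m => indep_of_indep_of_le_right (h.indep_past_future m) (hle m))
    h.fieldPast_le ((hle 0).trans (h.fieldFuture_le 0)) (fieldPast_mono Y)
  exact measure_eq_zero_or_one_of_indepSet_self
    (hind.indepSet_of_measurableSet hEpast
      (MeasurableSpace.measurableSet_generateFrom (mem_singleton E)))

/-- The limit mass of a chaos bounded in `L^(1+θ)` is almost surely positive. -/
theorem ae_exists_pos_tendsto_chaos (h : IsScaleField P κ Y) (q : ℝ) (ν : Measure Plane)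
    [IsFiniteMeasure ν] (hν : ν ≠ 0) {S : Set Plane} (hS : IsCompact S) (hνS : ν Sᶜ = 0)
    {θ : ℝ} (hθ : 0 < θ) {B : ℝ≥0∞} (hB : B ≠ ∞)
    (hmom : ∀ n, ∫⁻ ω, chaos κ Y q ν n ω univ ^ (1 + θ) ∂P ≤ B) :
    ∀ᵐ ω ∂P, ∃ c : ℝ, 0 < c ∧
      Tendsto (fun n => chaos κ Y q ν n ω univ) atTop (𝓝 (ENNReal.ofReal c)) := by
  have hP := h.isProbabilityMeasure
  set Z : ℕ → Ω → ℝ≥0∞ := fun n ω => chaos κ Y q ν n ω univ with hZ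
  have hZm : ∀ n, Measurable (Z n) := fun n => h.measurable_chaos_apply q ν n MeasurableSet.univ
  -- By the zero-one law it is enough to exclude probability one. In that case the truncated means
  -- would tend to zero and the tails would be at most `T ^ (-θ) * B`, while the mean stays equal to
  -- `ν univ`.
  have hnull : P {ω | limsup (fun n => Z n ω) atTop = 0} = 0 := by
    refine (h.measure_limsup_chaos_eq_zero_or_one q ν hS hνS).resolve_right fun hone => ?_
    have hae : ∀ᵐ ω ∂P, Tendsto (fun n => Z n ω) atTop (𝓝 0) := by
      have : ∀ᵐ ω ∂P, limsup (fun n => Z n ω) atTop = 0 :=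
        (prob_compl_eq_zero_iff ((Measurable.limsup hZm) (measurableSet_singleton 0))).2 hone
      filter_upwards [this] with ω hω
      exact tendsto_of_le_liminf_of_limsup_le zero_le hω.le
    have hbound : ∀ T : ℝ≥0∞, T ≠ 0 → T ≠ ∞ → ν univ ≤ T ^ (-θ) * B := by
      intro T hT hT'
      have h1 : Tendsto (fun n => ∫⁻ ω, min (Z n ω) T ∂P) atTop (𝓝 (∫⁻ _, 0 ∂P)) := by
        refine tendsto_lintegral_of_dominated_convergence (fun _ => T)
          (fun n => (hZm n).min measurable_const) (fun n => ae_of_all _ fun ω => min_le_right _ _)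
          (by simpa using hT') ?_
        filter_upwards [hae] with ω hω
        have := hω.min (tendsto_const_nhds (x := T))
        simpa using this
      have h2 : ∀ n, ν univ ≤ ∫⁻ ω, min (Z n ω) T ∂P + T ^ (-θ) * B := by
        intro n
        rw [← h.lintegral_chaos q ν n MeasurableSet.univ]
        calc ∫⁻ ω, Z n ω ∂P ≤ ∫⁻ ω, (min (Z n ω) T + T ^ (-θ) * Z n ω ^ (1 + θ)) ∂P :=
              lintegral_mono fun ω => ENNReal.le_min_add_mul_rpow hθ hT hT'
          _ = ∫⁻ ω, min (Z n ω) T ∂P + T ^ (-θ) * ∫⁻ ω, Z n ω ^ (1 + θ) ∂P := by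
              rw [lintegral_add_left ((hZm n).min measurable_const),
                lintegral_const_mul _ ((hZm n).pow_const _)]
          _ ≤ _ := add_le_add le_rfl (mul_le_mul' le_rfl (hmom n))
      have h3 := h1.add_const (T ^ (-θ) * B)
      rw [lintegral_zero, zero_add] at h3
      exact ge_of_tendsto' h3 h2
    have hlim : Tendsto (fun n : ℕ => ((n : ℝ≥0∞)) ^ (-θ) * B) atTop (𝓝 (0 * B)) := by
      refine ENNReal.Tendsto.mul_const ?_ (Or.inr hB)
      have h1 : Tendsto (fun n : ℕ => ((n : ℝ≥0∞)) ^ (-θ)) atTop (𝓝 (∞ ^ (-θ))) :=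
        (ENNReal.continuous_rpow_const.tendsto ∞).comp ENNReal.tendsto_nat_nhds_top
      rwa [ENNReal.top_rpow_of_neg (by linarith)] at h1
    rw [zero_mul] at hlim
    have h0 : ν univ ≤ 0 := ge_of_tendsto hlim (by
      filter_upwards [eventually_gt_atTop 0] with n hn
      exact hbound n (by exact_mod_cast hn.ne') (ENNReal.natCast_ne_top n))
    exact hν (Measure.measure_univ_eq_zero.1 (le_antisymm h0 zero_le))
  have hfin : ∀ᵐ ω ∂P, ∀ n, Z n ω < ∞ :=
    ae_all_iff.2 fun n => h.ae_chaos_lt_top q ν n MeasurableSet.univ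
  have hne : ∀ᵐ ω ∂P, limsup (fun n => Z n ω) atTop ≠ 0 := ae_iff.2 (by simpa using hnull)
  filter_upwards [h.ae_tendsto_chaos q ν MeasurableSet.univ, hfin, hne] with ω ⟨c, hc⟩ hω hω0
  have h1 : Tendsto (fun n => Z n ω) atTop (𝓝 (ENNReal.ofReal c)) :=
    (ENNReal.tendsto_ofReal hc).congr fun n => ENNReal.ofReal_toReal (hω n).ne
  refine ⟨c, ?_, h1⟩
  by_contra hc0
  rw [ENNReal.ofReal_of_nonpos (not_lt.1 hc0)] at h1
  exact hω0 h1.limsup_eq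

end IsScaleField

/-! ### Small-ball estimates. -/

/-- A nonnegative variable whose `L^(1+θ)` norm is comparable to its mean is not concentrated
near zero. -/
theorem exists_measure_le_quarter_le {A θ : ℝ} (hA : 0 < A) (hθ : 0 < θ) :
    ∃ c : ℝ, 0 ≤ c ∧ c < 1 ∧ ∀ {Ω : Type*} [MeasurableSpace Ω] (P : Measure Ω)
      [IsProbabilityMeasure P] (W : Ω → ℝ≥0∞) (p : ℝ), Measurable W → 0 < p →
      ∫⁻ ω, W ω ∂P = ENNReal.ofReal p →
      ∫⁻ ω, W ω ^ (1 + θ) ∂P ≤ ENNReal.ofReal (A * p ^ (1 + θ)) →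
      P {ω | W ω ≤ ENNReal.ofReal (p / 4)} ≤ ENNReal.ofReal c := by
  -- With this `τ` the excess above `τ * p` contributes at most `p / 4` to the mean, and values up
  -- to `p / 4` contribute at most `p / 4`. The remaining half comes from `Gᶜ` truncated at `τ * p`,
  -- so `Gᶜ` has probability at least `1 / (2 * τ)`.
  set τ : ℝ := max ((4 * A) ^ (1 / θ)) 1 with hτ
  have hτ1 : 1 ≤ τ := le_max_right _ _
  have hτ0 : 0 < τ := by linarith
  have hτA : τ ^ (-θ) * A ≤ 1 / 4 := by
    have h1 : 4 * A ≤ τ ^ θ := by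
      calc 4 * A = ((4 * A) ^ (1 / θ)) ^ θ := by
            rw [← Real.rpow_mul (by positivity), one_div_mul_cancel hθ.ne', Real.rpow_one]
        _ ≤ τ ^ θ := Real.rpow_le_rpow (by positivity) (le_max_left _ _) hθ.le
    rw [Real.rpow_neg hτ0.le, inv_mul_le_iff₀ (by positivity)]
    linarith
  have hinv : 1 / (2 * τ) ≤ 1 := by
    rw [div_le_one (by positivity)]; linarith
  refine ⟨1 - 1 / (2 * τ), by linarith, by have : 0 < 1 / (2 * τ) := by positivity
                                           linarith, ?_⟩
  intro Ω _ P _ W p hW hp hmean hmom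
  set G : Set Ω := {ω | W ω ≤ ENNReal.ofReal (p / 4)} with hG
  have hGm : MeasurableSet G := measurableSet_le hW measurable_const
  have hGi : Measurable (Gᶜ.indicator (1 : Ω → ℝ≥0∞)) := measurable_one.indicator hGm.compl
  have hT : ENNReal.ofReal (τ * p) ≠ 0 := by
    simpa using mul_pos hτ0 hp
  have hpt : ∀ ω, W ω ≤ ENNReal.ofReal (p / 4) + (ENNReal.ofReal (τ * p) * Gᶜ.indicator 1 ω
      + ENNReal.ofReal (τ * p) ^ (-θ) * W ω ^ (1 + θ)) := by
    intro ω
    by_cases hω : ω ∈ G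
    · exact le_add_right hω
    · refine le_add_left ?_
      rw [indicator_of_mem (show ω ∈ Gᶜ from hω), Pi.one_apply, mul_one]
      exact (ENNReal.le_min_add_mul_rpow hθ hT ENNReal.ofReal_ne_top).trans
        (add_le_add (min_le_right _ _) le_rfl)
  have h1 := lintegral_mono (μ := P) hpt
  rw [hmean, lintegral_add_left measurable_const, lintegral_add_left
    (hGi.const_mul _), lintegral_const_mul _ hGi,
    lintegral_const_mul _ (hW.pow_const _), lintegral_indicator_one hGm.compl, lintegral_const,
    measure_univ, mul_one] at h1
  have h2 : ENNReal.ofReal (τ * p) ^ (-θ) * ∫⁻ ω, W ω ^ (1 + θ) ∂P ≤ ENNReal.ofReal (p / 4) := by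
    refine (mul_le_mul' le_rfl hmom).trans ?_
    rw [ENNReal.ofReal_rpow_of_pos (by positivity), ← ENNReal.ofReal_mul (by positivity)]
    apply ENNReal.ofReal_le_ofReal
    rw [Real.mul_rpow hτ0.le hp.le, Real.rpow_add hp, Real.rpow_one, Real.rpow_neg hp.le]
    have : p ^ θ ≠ 0 := by positivity
    calc τ ^ (-θ) * (p ^ θ)⁻¹ * (A * (p * p ^ θ)) = (τ ^ (-θ) * A) * p := by field_simp
      _ ≤ 1 / 4 * p := mul_le_mul_of_nonneg_right hτA hp.le
      _ = p / 4 := by ring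
  have h3 : ENNReal.ofReal p ≤ ENNReal.ofReal (p / 4) + (ENNReal.ofReal (τ * p * P.real Gᶜ)
      + ENNReal.ofReal (p / 4)) := by
    refine h1.trans (add_le_add le_rfl (add_le_add ?_ h2))
    rw [ENNReal.ofReal_mul (p := τ * p) (by positivity), ofReal_measureReal]
  rw [← ENNReal.ofReal_add (by positivity) (by positivity),
    ← ENNReal.ofReal_add (by positivity) (by positivity),
    ENNReal.ofReal_le_ofReal_iff (by positivity)] at h3
  have h4 : 1 / (2 * τ) ≤ P.real Gᶜ := by
    rw [div_le_iff₀ (by positivity)]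
    nlinarith
  rw [← ofReal_measureReal]
  apply ENNReal.ofReal_le_ofReal
  have := probReal_compl_eq_one_sub (μ := P) hGm
  linarith

/-- A log-kernel whose increments are log-kernels with finite range at the corresponding dyadic
scale. -/
structure DyadicKernel (L C r₀ : ℝ) (κ : ℕ → ℝ → ℝ) : Prop where
  logKernel : LogKernel L C r₀ κ
  increments : ∀ m, LogKernel L C (r₀ / 2 ^ m) (fun n d => κ (n + m) d - κ m d)
  range : ∀ m n d, m ≤ n → r₀ / 2 ^ m ≤ d → κ n d = κ m d

namespace IsScaleField

variable {Ω : Type*} [mΩ : MeasurableSpace Ω] {P : Measure Ω} {κ : ℕ → ℝ → ℝ}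
  {Y : ℕ → Plane → Ω → ℝ} {L C r₀ : ℝ}

/-- Independence of the chaos of the increments on separated sets, and of the field at a separated
point. -/
theorem lintegral_expWeight_mul_prod_indicator (h : IsScaleField P κ Y) {m n : ℕ} {ρ : ℝ}
    (hκ : ∀ d, ρ ≤ d → κ (n + m) d = κ m d) (q : ℝ) (x : Plane) {N : ℕ}
    (A : Fin N → Set Plane) (hA : ∀ i, MeasurableSet (A i)) (hAv : ∀ i, volume (A i) ≠ ∞)
    (hxA : ∀ i, ∀ y ∈ A i, ρ ≤ dist x y)
    (hAA : ∀ i j, i ≠ j → ∀ y ∈ A i, ∀ z ∈ A j, ρ ≤ dist y z) (T : ℝ≥0∞) :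
    ∫⁻ ω, expWeight κ Y q (n + m) x ω * ∏ i, {ω | chaos (fun i d => κ (i + m) d - κ m d)
        (fun i x ω => Y (i + m) x ω - Y m x ω) 1 volume n ω (A i) ≤ T}.indicator 1 ω ∂P
      = ∏ i, P {ω | chaos (fun i d => κ (i + m) d - κ m d)
        (fun i x ω => Y (i + m) x ω - Y m x ω) 1 volume n ω (A i) ≤ T} := by
  have hP := h.isProbabilityMeasure
  -- The index `none` carries the full field at `x` (`c = 0`), and `some i` carries the increments
  -- on `A i` (`c = 1`). Different blocks are at distance at least `ρ`, where level `m` already has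
  -- the final covariance, so they are uncorrelated.
  set B : Option (Fin N) → Set Plane := fun t => t.elim {x} A with hB
  set c : Option (Fin N) → ℝ := fun t => t.elim 0 (fun _ => 1) with hc
  set X : (t : Option (Fin N)) → B t → Ω → ℝ :=
    fun t s ω => Y (n + m) s ω - c t * Y m s ω with hX
  have hXm : ∀ t s, Measurable (X t s) := fun t s =>
    (h.measurable _ _).sub ((h.measurable _ _).const_mul _)
  have hmem : ∀ t (s : B t), MemLp (fun ω => c t * Y m s ω) 2 P := fun t s =>
    (h.memLp_two m s).const_mul _
  have hcov : ∀ t₁ t₂, t₁ ≠ t₂ → ∀ (s₁ : B t₁) (s₂ : B t₂), cov[X t₁ s₁, X t₂ s₂; P] = 0 := by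
    intro t₁ t₂ ht s₁ s₂
    have hd : ρ ≤ dist (s₁ : Plane) s₂ := by
      rcases t₁ with _ | i <;> rcases t₂ with _ | j
      · exact absurd rfl ht
      · have h1 : (s₁ : Plane) = x := s₁.2
        rw [h1]; exact hxA j _ s₂.2
      · have h1 : (s₂ : Plane) = x := s₂.2
        rw [h1, dist_comm]; exact hxA i _ s₁.2
      · exact hAA i j (fun hij => ht (by rw [hij])) _ s₁.2 _ s₂.2
    have h0 := covariance_fun_sub_fun_sub (h.memLp_two (n + m) s₁) (hmem t₁ s₁)
      (h.memLp_two (n + m) s₂) (hmem t₂ s₂)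
    refine h0.trans ?_
    rw [covariance_const_mul_left, covariance_const_mul_left, covariance_const_mul_right,
      covariance_const_mul_right, h.cov_eq, h.cov_eq, h.cov_eq, h.cov_eq, min_self, min_self,
      min_eq_right (Nat.le_add_left m n), min_eq_left (Nat.le_add_left m n), hκ _ hd]
    rcases t₁ with _ | i <;> rcases t₂ with _ | j
    · exact absurd rfl ht
    all_goals simp [hc]
  have hgauss : IsGaussianProcess
      (fun (p : (t : Option (Fin N)) × B t) ω => X p.1 p.2 ω) P := by
    classical
    refine h.gaussian.of_linear_combinations fun p => ?_
    exact ⟨{(n + m, (p.2 : Plane)), (m, (p.2 : Plane))},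
        ContinuousLinearMap.proj (R := ℝ) (φ := fun _ => ℝ) ⟨(n + m, (p.2 : Plane)), by simp⟩
          - c p.1 • ContinuousLinearMap.proj (R := ℝ) (φ := fun _ => ℝ)
            ⟨(m, (p.2 : Plane)), by simp⟩, by simp [hX]⟩
  have hind := IsGaussianProcess.iIndepFun_of_covariance_eq_zero hgauss
    (fun t s => (hXm t s).aemeasurable) hcov
  set mt : Option (Fin N) → MeasurableSpace Ω :=
    fun t => MeasurableSpace.comap (fun ω s => X t s ω) inferInstance with hmt
  have hXmt : ∀ t s, Measurable[mt t] (X t s) := fun t s =>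
    Measurable.comp (g := fun f : B t → ℝ => f s) (measurable_pi_apply _)
      (comap_measurable fun ω s => X t s ω)
  set E : Fin N → Set Ω := fun i => {ω | chaos (fun i d => κ (i + m) d - κ m d)
        (fun i x ω => Y (i + m) x ω - Y m x ω) 1 volume n ω (A i) ≤ T} with hE
  set g : Option (Fin N) → Ω → ℝ≥0∞ := fun t =>
    t.elim (expWeight κ Y q (n + m) x) (fun i => (E i).indicator 1) with hg
  have hmt_le : ∀ t, mt t ≤ mΩ := fun t => Measurable.comap_le (measurable_pi_iff.2 (hXm t))
  have hgmt : ∀ t, Measurable[mt t] (g t) := by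
    intro t
    rcases t with _ | i
    · have h1 := hXmt none ⟨x, rfl⟩
      simp only [hX, hc, Option.elim_none, zero_mul, sub_zero] at h1
      change Measurable[mt none] (expWeight κ Y q (n + m) x)
      unfold expWeight
      exact (Real.measurable_exp.comp ((h1.const_mul q).sub_const _)).ennreal_ofReal
    · refine Measurable.indicator measurable_const ?_
      refine measurableSet_le ?_ measurable_const
      refine measurable_chaos_of_continuous (m := mt (some i)) _ 1 volume n (hA i) (hAv i)
        (fun y hy => ?_) ((h.increments m).continuous n)
      have h1 := hXmt (some i) ⟨y, hy⟩
      simpa only [hX, hc, Option.elim_some, one_mul] using h1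
  have hgind : iIndepFun g P := by
    rw [iIndepFun_iff]
    intro s f' hf'
    refine (iIndep_iff _ _).1 hind.iIndep s fun t ht => ?_
    exact (measurable_iff_comap_le.1 (hgmt t)) _ (hf' t ht)
  have hprod := lintegral_prod_eq_prod_lintegral_of_indepFun Finset.univ g hgind
    (fun t => (hgmt t).mono (hmt_le t) le_rfl)
  simp only [Fintype.prod_option] at hprod
  refine hprod.trans ?_
  change (∫⁻ ω, expWeight κ Y q (n + m) x ω ∂P) * _ = _
  rw [h.lintegral_expWeight, one_mul]
  refine Finset.prod_congr rfl fun i _ => ?_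
  have hEm : MeasurableSet (E i) :=
    measurableSet_le ((h.increments m).measurable_chaos_apply 1 volume n (hA i)) measurable_const
  exact lintegral_indicator_one hEm


/-- The chaos of the increments gives a ball of larger scale a very small mass only with
exponentially small probability. -/
theorem exists_lintegral_expWeight_mul_indicator_le_pow (h : IsScaleField P κ Y)
    (hκ : DyadicKernel L C r₀ κ) (hL : L < 4 * Real.log 2) :
    ∃ c : ℝ, 0 ≤ c ∧ c < 1 ∧ ∀ (q : ℝ) (m n N : ℕ) (x z : Plane) (s : ℝ),
      (3 * N + 1) * (r₀ / 2 ^ m) ≤ s → (∀ y ∈ Metric.ball z s, r₀ / 2 ^ m ≤ dist x y) →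
      ∫⁻ ω, expWeight κ Y q (n + m) x ω * {ω | chaos (fun i d => κ (i + m) d - κ m d)
        (fun i x ω => Y (i + m) x ω - Y m x ω) 1 volume n ω (Metric.ball z s)
          ≤ ENNReal.ofReal (Real.pi * (r₀ / 2 ^ m) ^ (2 : ℝ) / 4)}.indicator 1 ω ∂P
      ≤ ENNReal.ofReal c ^ N := by
  have hP := h.isProbabilityMeasure
  have hlog : 0 < Real.log 2 := Real.log_pos one_lt_two
  obtain ⟨θ, hθ, hb0⟩ : ∃ θ ∈ Ioo (0 : ℝ) 1, 0 < 2 * Real.log 2 - 1 ^ 2 * (1 + θ) / 2 * L := by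
    have h1 : Tendsto (fun θ : ℝ => 2 * Real.log 2 - 1 ^ 2 * (1 + θ) / 2 * L) (𝓝[>] 0)
        (𝓝 (2 * Real.log 2 - 1 ^ 2 * (1 + 0) / 2 * L)) := by
      have : Continuous fun θ : ℝ => 2 * Real.log 2 - 1 ^ 2 * (1 + θ) / 2 * L := by fun_prop
      exact this.continuousWithinAt
    have h2 := h1.eventually (lt_mem_nhds (show (0 : ℝ) < _ by linarith))
    obtain ⟨θ, h3, h4⟩ := (h2.and (Ioo_mem_nhdsGT one_pos)).exists
    exact ⟨θ, h4, h3⟩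
  set b := 2 * Real.log 2 - 1 ^ 2 * (1 + θ) / 2 * L with hb
  have hρ1 : Real.exp (-(θ * b)) < 1 := Real.exp_lt_one_iff.2 (neg_neg_of_pos (mul_pos hθ.1 hb0))
  set A := Real.exp (6 * C) * 16 ^ θ / (1 - Real.exp (-(θ * b))) with hA
  have hA0 : 0 < A := div_pos (by positivity) (by linarith)
  obtain ⟨c, hc0, hc1, hc⟩ := exists_measure_le_quarter_le hA0 hθ.1
  refine ⟨c, hc0, hc1, ?_⟩
  intro q m n N x z s hs hx
  have hr₀ := hκ.logKernel.r₀_pos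
  set ρ := r₀ / 2 ^ m with hρ
  have hρ0 : 0 < ρ := by positivity
  set e : Plane := EuclideanSpace.single 0 1 with he
  have he1 : ‖e‖ = 1 := by simp [he]
  set κ' : ℕ → ℝ → ℝ := fun i d => κ (i + m) d - κ m d with hκ'
  set Y' : ℕ → Plane → Ω → ℝ := fun i x ω => Y (i + m) x ω - Y m x ω with hY'
  have h' : IsScaleField P κ' Y' := h.increments m
  -- Centres `3 * ρ` apart along a ray leave distance at least `ρ` between the balls, so the
  -- increments there are independent. A small total mass forces all `N` masses to be small.
  set A' : Fin N → Set Plane := fun i => Metric.ball (z + (3 * ρ * (i : ℕ)) • e) ρ with hA'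
  have hsub : ∀ i, A' i ⊆ Metric.ball z s := by
    intro i
    refine Metric.ball_subset_ball' ?_
    have h1 : ((i : ℕ) : ℝ) ≤ N := by exact_mod_cast i.2.le
    rw [dist_eq_norm, add_sub_cancel_left, norm_smul, he1, mul_one, Real.norm_eq_abs,
      abs_of_nonneg (by positivity)]
    nlinarith
  have hsep : ∀ i j, i ≠ j → ∀ y ∈ A' i, ∀ y' ∈ A' j, ρ ≤ dist y y' := by
    intro i j hij y hy y' hy'
    have h1 : 3 * ρ ≤ dist (z + (3 * ρ * (i : ℕ)) • e) (z + (3 * ρ * (j : ℕ)) • e) := by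
      rw [dist_add_left, dist_eq_norm, ← sub_smul, norm_smul, he1, mul_one, ← mul_sub, norm_mul,
        Real.norm_of_nonneg (by positivity : 0 ≤ 3 * ρ)]
      refine le_mul_of_one_le_right (by positivity) ?_
      have h2 : (1 : ℤ) ≤ |((i : ℕ) : ℤ) - ((j : ℕ) : ℤ)| := by
        apply Int.one_le_abs
        intro h3
        exact hij (Fin.ext (by omega))
      rw [Real.norm_eq_abs]
      exact_mod_cast h2
    have h2 := dist_triangle4 (z + (3 * ρ * (i : ℕ)) • e) y y' (z + (3 * ρ * (j : ℕ)) • e)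
    have h3 : dist y (z + (3 * ρ * (i : ℕ)) • e) < ρ := hy
    have h4 : dist y' (z + (3 * ρ * (j : ℕ)) • e) < ρ := hy'
    rw [dist_comm _ y] at h2
    linarith
  have hvol : ∀ (y : Plane) r, 0 < r →
      volume (Metric.ball y r) ≤ ENNReal.ofReal (Real.pi * r ^ (2 : ℝ)) :=
    fun y r hr => (volume_ball_eq y hr.le).le
  set p := Real.pi * ρ ^ (2 : ℝ) with hp
  have hp0 : 0 < p := by positivity
  refine (lintegral_mono fun ω => ?_).trans ((h.lintegral_expWeight_mul_prod_indicator
    (n := n) (fun d hd => hκ.range m (n + m) d (Nat.le_add_left m n) hd) q x A'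
    (fun i => measurableSet_ball) (fun i => measure_ball_lt_top.ne)
    (fun i y hy => hx y (hsub i hy)) hsep (ENNReal.ofReal (p / 4))).le.trans ?_)
  · refine mul_le_mul' le_rfl ?_
    by_cases hω : ω ∈ {ω | chaos κ' Y' 1 volume n ω (Metric.ball z s) ≤ ENNReal.ofReal (p / 4)}
    · rw [indicator_of_mem hω, Finset.prod_eq_one fun i _ => ?_, Pi.one_apply]
      rw [indicator_of_mem, Pi.one_apply]
      exact (measure_mono (hsub i)).trans hω
    · rw [indicator_of_notMem hω]
      exact zero_le
  · have hpow : ∏ _i : Fin N, ENNReal.ofReal c = ENNReal.ofReal c ^ N := by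
      rw [Finset.prod_const, Finset.card_univ, Fintype.card_fin]
    rw [← hpow]
    refine Finset.prod_le_prod' fun i _ => ?_
    refine hc P _ p (h'.measurable_chaos_apply 1 volume n measurableSet_ball) hp0 ?_ ?_
    · rw [h'.lintegral_chaos 1 volume n measurableSet_ball, volume_ball_eq _ hρ0.le]
    -- The increments start at scale `ρ`, so the moment bound applies with `k = 0`. After scaling by
    -- `p` its constant `A` does not depend on `m`, which makes `c` uniform.
    · have h1 := h'.lintegral_chaos_rpow_one_add (hκ.increments m) (q := 1) (θ := θ) (t := 2)
        (D := Real.pi) (b := b) ⟨zero_le_one, le_rfl⟩ hθ Real.pi_pos.le volume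
        (S := A' i) measurableSet_ball (fun y _ r hr => hvol y r hr) hb hb0 (k := 0)
        (n := n) (Nat.zero_le _) (fun y hy y' hy' => by
          have h3 : dist y (z + (3 * ρ * (i : ℕ)) • e) < ρ := hy
          have h4 : dist y' (z + (3 * ρ * (i : ℕ)) • e) < ρ := hy'
          rw [Metric.mem_ball, pow_zero, div_one]
          have := dist_triangle_right y' y (z + (3 * ρ * (i : ℕ)) • e)
          linarith)
      refine h1.trans ?_
      rw [volume_ball_eq _ hρ0.le, ← hp, ← ENNReal.ofReal_mul (by
        rw [pow_zero, mul_one]; exact div_nonneg (by positivity) (by linarith))]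
      apply ENNReal.ofReal_le_ofReal
      apply le_of_eq
      have h5 : Real.pi * (4 * ρ) ^ (2 : ℝ) = 16 * p := by
        rw [hp, Real.mul_rpow (by norm_num) hρ0.le]
        norm_num
        ring
      rw [h5, Real.mul_rpow (by norm_num) hp0.le, pow_zero, Real.rpow_add hp0, Real.rpow_one, hA]
      ring

end IsScaleField

namespace IsScaleField

variable {Ω : Type*} [mΩ : MeasurableSpace Ω] {P : Measure Ω} {κ : ℕ → ℝ → ℝ}
  {Y : ℕ → Plane → Ω → ℝ} {L C r₀ : ℝ}

/-- The mass of the chaos of the increments, tilted by a negative power of the chaos at the coarse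
level. -/
theorem lintegral_expWeight_mul_tilted_le (h : IsScaleField P κ Y) (hκ : DyadicKernel L C r₀ κ)
    {q p : ℝ} (hq : 0 ≤ q) (hp : 0 ≤ p) {k m : ℕ} (hkm : k + 2 ≤ m) (n : ℕ) (x : Plane)
    {A : Set Plane} (hA : MeasurableSet A)
    (hxA : ∀ y ∈ A, r₀ / 2 ^ (k + 2) ≤ dist x y ∧ dist x y < r₀ / 2 ^ k) :
    ∫⁻ ω, expWeight κ Y q (n + m) x ω *
        (∫⁻ y in A, ENNReal.ofReal (Real.exp (-p * (Y m y ω - κ m 0 / 2)))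
          ∂(chaos (fun i d => κ (i + m) d - κ m d) (fun i x ω => Y (i + m) x ω - Y m x ω) 1
            volume n ω)) ∂P
      ≤ ENNReal.ofReal (Real.exp (p * (1 + p) / 2 * (m * L + C) - q * p * ((k + 2 : ℕ) * L - C)))
        * volume A := by
  have hP := h.isProbabilityMeasure
  have h' := h.increments m
  have hm := h.measurable_uncurry m
  have hmt : Measurable fun z : Plane × Ω =>
      ENNReal.ofReal (Real.exp (-p * (Y m z.1 z.2 - κ m 0 / 2))) :=
    (Real.measurable_exp.comp ((hm.sub_const _).const_mul _)).ennreal_ofReal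
  have hmω : ∀ ω, Measurable fun y : Plane =>
      ENNReal.ofReal (Real.exp (-p * (Y m y ω - κ m 0 / 2))) := fun ω =>
    hmt.comp measurable_prodMk_right
  have h1 : ∀ ω, expWeight κ Y q (n + m) x ω *
        (∫⁻ y in A, ENNReal.ofReal (Real.exp (-p * (Y m y ω - κ m 0 / 2)))
          ∂(chaos (fun i d => κ (i + m) d - κ m d) (fun i x ω => Y (i + m) x ω - Y m x ω) 1
            volume n ω))
      = ∫⁻ y in A, ENNReal.ofReal (Real.exp (q * Y (n + m) x ω + (-(1 + p)) * Y m y ω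
          + 1 * Y (n + m) y ω + (p * κ m 0 / 2 - q ^ 2 / 2 * κ (n + m) 0
            - (κ (n + m) 0 - κ m 0) / 2))) := by
    intro ω
    rw [chaos, restrict_withDensity hA, lintegral_withDensity_eq_lintegral_mul _
      (h'.measurable_expWeight_left 1 n ω) (hmω ω),
      ← lintegral_const_mul]
    · refine lintegral_congr fun y => ?_
      rw [Pi.mul_apply, expWeight, expWeight, ENNReal.ofReal_exp_mul, ENNReal.ofReal_exp_mul]
      congr 2
      ring
    · exact (h'.measurable_expWeight_left 1 n ω).mul (hmω ω)
  simp_rw [h1]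
  rw [lintegral_lintegral_swap, ← setLIntegral_const]
  · refine setLIntegral_mono' hA fun y hy => ?_
    rw [h.lintegral_exp_three]
    apply ENNReal.ofReal_le_ofReal
    apply Real.exp_le_exp.2
    obtain ⟨hy1, hy2⟩ := hxA y hy
    have hr₀ := hκ.logKernel.r₀_pos
    -- At these distances the covariance is final at level `k + 2`, so the tilt at `x` acts on the
    -- field at `y` only through the first `k + 2` levels.
    have e1 : κ (n + m) (dist x y) = κ (k + 2) (dist x y) :=
      hκ.range _ _ _ (by omega) hy1
    have e2 : κ m (dist x y) = κ (k + 2) (dist x y) := hκ.range _ _ _ hkm hy1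
    have e3 := hκ.logKernel.lower (k + 2) (dist x y) dist_nonneg (by
      have : 4 * (r₀ / 2 ^ (k + 2)) = r₀ / 2 ^ k := by rw [pow_add]; field_simp; norm_num
      rwa [this])
    have e4 := hκ.logKernel.upper m 0 le_rfl
    rw [min_self, min_eq_right (Nat.le_add_left m n), min_eq_left (Nat.le_add_left m n), dist_self,
      e1, e2]
    have e5 : q * p * (((k + 2 : ℕ) : ℝ) * L - C) ≤ q * p * κ (k + 2) (dist x y) :=
      mul_le_mul_of_nonneg_left e3 (by positivity)
    have e6 : p * (1 + p) / 2 * κ m 0 ≤ p * (1 + p) / 2 * (m * L + C) :=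
      mul_le_mul_of_nonneg_left e4 (by positivity)
    linarith
  · have hn := h.measurable_uncurry (n + m)
    have hx : Measurable fun z : Ω × Plane => Y (n + m) x z.1 :=
      (h.measurable (n + m) x).comp measurable_fst
    have hm' := hm.comp (measurable_swap (α := Ω) (β := Plane))
    have hn' := hn.comp (measurable_swap (α := Ω) (β := Plane))
    refine Measurable.aemeasurable ?_
    exact (Real.measurable_exp.comp ((((hx.const_mul q).add (hm'.const_mul _)).add
      (hn'.const_mul _)).add_const _)).ennreal_ofReal

/-- Hölder's inequality between the chaos and the chaos of the increments. -/
theorem chaos_increments_rpow_le (h : IsScaleField P κ Y) {p : ℝ} (hp : 0 < p) (m n : ℕ) (ω : Ω)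
    {A : Set Plane} (hA : MeasurableSet A) :
    chaos (fun i d => κ (i + m) d - κ m d) (fun i x ω => Y (i + m) x ω - Y m x ω) 1 volume n ω A
        ^ (1 + p)
      ≤ chaos κ Y 1 volume (n + m) ω A ^ p *
        ∫⁻ y in A, ENNReal.ofReal (Real.exp (-p * (Y m y ω - κ m 0 / 2)))
          ∂(chaos (fun i d => κ (i + m) d - κ m d) (fun i x ω => Y (i + m) x ω - Y m x ω) 1
            volume n ω) := by
  set μ := chaos (fun i d => κ (i + m) d - κ m d) (fun i x ω => Y (i + m) x ω - Y m x ω) 1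
            volume n ω with hμ
  have hp1 : 0 < 1 + p := by linarith
  have hm := h.measurable_left m ω
  -- The exponents `p / (1 + p)` and `1 / (1 + p)` make the product of the two integrands
  -- identically one, so the left side is the mass of `A` under `μ`.
  have h1 := ENNReal.lintegral_mul_norm_pow_le (μ := μ.restrict A)
    (h.measurable_expWeight_left 1 m ω).aemeasurable
    (g := fun y => ENNReal.ofReal (Real.exp (-p * (Y m y ω - κ m 0 / 2))))
    (Real.measurable_exp.comp ((hm.sub_const _).const_mul _)).ennreal_ofReal.aemeasurable
    (p := p / (1 + p)) (q := 1 / (1 + p)) (by positivity) (by positivity) (by field_simp; ring)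
  have h2 : ∀ y, expWeight κ Y 1 m y ω ^ (p / (1 + p)) *
      ENNReal.ofReal (Real.exp (-p * (Y m y ω - κ m 0 / 2))) ^ (1 / (1 + p)) = 1 := by
    intro y
    rw [expWeight, ENNReal.ofReal_exp_rpow, ENNReal.ofReal_exp_rpow, ENNReal.ofReal_exp_mul,
      ENNReal.ofReal_eq_one, Real.exp_eq_one_iff]
    field_simp
    ring
  simp_rw [h2] at h1
  rw [lintegral_one, Measure.restrict_apply_univ, hμ,
    ← chaos_add_apply 1 volume n m ω hA (fun j => h.measurable_left j ω), ← hμ] at h1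
  refine (ENNReal.rpow_le_rpow h1 hp1.le).trans (le_of_eq ?_)
  rw [ENNReal.mul_rpow_of_nonneg _ _ hp1.le, ← ENNReal.rpow_mul, ← ENNReal.rpow_mul,
    div_mul_cancel₀ _ hp1.ne', div_mul_cancel₀ _ hp1.ne', ENNReal.rpow_one]

/-- Small-ball estimate for the chaos under the measure tilted at a nearby point. -/
theorem exists_lintegral_expWeight_mul_indicator_chaos_le (h : IsScaleField P κ Y)
    (hκ : DyadicKernel L C r₀ κ) (hL : L < 4 * Real.log 2) :
    ∃ c : ℝ, 0 ≤ c ∧ c < 1 ∧ ∀ (q p η : ℝ) (k m n N : ℕ) (x z : Plane), 0 ≤ q → 0 < p → 0 ≤ η →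
      k + 2 ≤ m → dist x z = r₀ / 2 ^ k / 2 → (3 * N + 1) * (r₀ / 2 ^ m) ≤ r₀ / 2 ^ k / 4 →
      ∫⁻ ω, expWeight κ Y q (n + m) x ω * {ω | chaos κ Y 1 volume (n + m) ω
          (Metric.ball z (r₀ / 2 ^ k / 4)) ≤ ENNReal.ofReal η}.indicator 1 ω ∂P
      ≤ ENNReal.ofReal c ^ N + ENNReal.ofReal (
          (Real.pi * (r₀ / 2 ^ m) ^ (2 : ℝ) / 4) ^ (-(1 + p)) * η ^ p
          * (Real.exp (p * (1 + p) / 2 * (m * L + C) - q * p * ((k + 2 : ℕ) * L - C))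
          * (Real.pi * (r₀ / 2 ^ k / 4) ^ (2 : ℝ)))) := by
  obtain ⟨c, hc0, hc1, hc⟩ := h.exists_lintegral_expWeight_mul_indicator_le_pow hκ hL
  refine ⟨c, hc0, hc1, ?_⟩
  intro q p η k m n N x z hq hp hη hkm hxz hN
  have hr₀ := hκ.logKernel.r₀_pos
  set b := Metric.ball z (r₀ / 2 ^ k / 4) with hb
  have hrk : 0 < r₀ / 2 ^ k := by positivity
  have hk2 : r₀ / 2 ^ (k + 2) = r₀ / 2 ^ k / 4 := by rw [pow_add]; field_simp; norm_num
  have hxb : ∀ y ∈ b, r₀ / 2 ^ (k + 2) ≤ dist x y ∧ dist x y < r₀ / 2 ^ k := by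
    intro y hy
    have h1 : dist y z < r₀ / 2 ^ k / 4 := hy
    have h2 := dist_triangle x y z
    have h3 := dist_triangle_right x y z
    rw [hk2]
    constructor <;> linarith
  have hrm : r₀ / 2 ^ m ≤ r₀ / 2 ^ (k + 2) :=
    div_le_div_of_nonneg_left hr₀.le (by positivity) (pow_le_pow_right₀ one_le_two hkm)
  have h1 := hc q m n N x z _ hN (fun y hy => hrm.trans (hxb y hy).1)
  have h2 := h.lintegral_expWeight_mul_tilted_le hκ hq hp.le hkm n x measurableSet_ball hxb
  set κ' : ℕ → ℝ → ℝ := fun i d => κ (i + m) d - κ m d with hκ'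
  set Y' : ℕ → Plane → Ω → ℝ := fun i x ω => Y (i + m) x ω - Y m x ω with hY'
  set E' : Set Ω := {ω | chaos κ' Y' 1 volume n ω b
    ≤ ENNReal.ofReal (Real.pi * (r₀ / 2 ^ m) ^ (2 : ℝ) / 4)} with hE'
  set E : Set Ω := {ω | chaos κ Y 1 volume (n + m) ω b ≤ ENNReal.ofReal η} with hE
  have hE'm : MeasurableSet E' := measurableSet_le
    ((h.increments m).measurable_chaos_apply 1 volume n measurableSet_ball) measurable_const
  set s : ℝ := Real.pi * (r₀ / 2 ^ m) ^ (2 : ℝ) / 4 with hs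
  have hs0 : 0 < s := by positivity
  set J : Ω → ℝ≥0∞ := fun ω => ∫⁻ y in b, ENNReal.ofReal (Real.exp (-p * (Y m y ω - κ m 0 / 2)))
          ∂(chaos κ' Y' 1 volume n ω) with hJ
  -- Either the increments give `b` less than `s`, which is rare by independence. Or they give it
  -- more, and a small value of the chaos then forces `J` to be large by Hölder, which is rare by
  -- Markov's inequality.
  have hpt : ∀ ω, expWeight κ Y q (n + m) x ω * E.indicator 1 ω
      ≤ expWeight κ Y q (n + m) x ω * E'.indicator 1 ω
        + ENNReal.ofReal (s ^ (-(1 + p)) * η ^ p) * (expWeight κ Y q (n + m) x ω * J ω) := by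
    intro ω
    rw [mul_left_comm, ← mul_add]
    refine mul_le_mul' le_rfl ?_
    by_cases hω' : ω ∈ E'
    · rw [indicator_of_mem hω']
      exact le_add_right (indicator_le_self' (fun _ _ => zero_le) ω)
    by_cases hω : ω ∈ E
    · rw [indicator_of_mem hω, indicator_of_notMem hω', zero_add, Pi.one_apply]
      have h3 := h.chaos_increments_rpow_le hp m n ω (A := b) measurableSet_ball
      have h4 : ENNReal.ofReal s ^ (1 + p) ≤ ENNReal.ofReal η ^ p * J ω :=
        ((ENNReal.rpow_le_rpow (not_le.1 hω').le (by linarith)).trans h3).trans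
          (mul_le_mul' (ENNReal.rpow_le_rpow hω hp.le) le_rfl)
      rw [ENNReal.ofReal_rpow_of_pos hs0, ENNReal.ofReal_rpow_of_nonneg hη hp.le] at h4
      rw [ENNReal.ofReal_mul (by positivity), mul_assoc]
      refine le_trans (le_of_eq ?_) (mul_le_mul' le_rfl h4)
      rw [← ENNReal.ofReal_mul (by positivity), ← Real.rpow_add hs0]
      simp
    · rw [indicator_of_notMem hω]
      exact zero_le
  refine (lintegral_mono hpt).trans ?_
  have hme : Measurable fun ω => expWeight κ Y q (n + m) x ω * E'.indicator 1 ω :=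
    (h.measurable_expWeight_right q (n + m) x).mul (measurable_one.indicator hE'm)
  rw [lintegral_add_left hme, lintegral_const_mul' _ _ ENNReal.ofReal_ne_top]
  refine add_le_add h1 ?_
  refine (mul_le_mul' le_rfl h2).trans (le_of_eq ?_)
  rw [volume_ball_eq _ (by positivity), ← ENNReal.ofReal_mul (Real.exp_pos _).le,
    ← ENNReal.ofReal_mul (by positivity)]

/-- Summable small-ball estimate along well-chosen scales. -/
theorem exists_summable_smallBall (h : IsScaleField P κ Y)
    (hκ : DyadicKernel L C r₀ κ) (hL : L < 4 * Real.log 2) {q β : ℝ} (hq : 0 ≤ q)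
    (hβ : 0 < (β - 2) * Real.log 2 - L / 2 + q * L) :
    ∃ (a : ℕ) (u : ℕ → ℝ≥0∞), 1 ≤ a ∧ ∑' j, u j ≠ ∞ ∧ ∀ (j n : ℕ) (x z : Plane), 2 ≤ j →
      (a + 1) * j ≤ n → dist x z = r₀ / 2 ^ (a * j) / 2 →
      ∫⁻ ω, expWeight κ Y q n x ω * {ω | chaos κ Y 1 volume n ω
          (Metric.ball z (r₀ / 2 ^ (a * j) / 4))
            ≤ ENNReal.ofReal (Real.exp (-(β * Real.log 2 * (a * j))))}.indicator 1 ω ∂P ≤ u j := by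
  obtain ⟨c, hc0, hc1, hc⟩ := h.exists_lintegral_expWeight_mul_indicator_chaos_le hκ hL
  have hr₀ := hκ.logKernel.r₀_pos
  have hL0 := hκ.logKernel.L_nonneg
  have hlog : 0 < Real.log 2 := Real.log_pos one_lt_two
  set G := (β - 2) * Real.log 2 - L / 2 + q * L with hG
  obtain ⟨p, hp0, hp1, hpG⟩ : ∃ p : ℝ, 0 < p ∧ p ≤ 1 ∧ p * L ≤ G := by
    refine ⟨min 1 (G / (L + 1)), lt_min one_pos (by positivity), min_le_left _ _, ?_⟩
    calc min 1 (G / (L + 1)) * L ≤ G / (L + 1) * L :=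
          mul_le_mul_of_nonneg_right (min_le_right _ _) hL0
      _ ≤ G := by rw [div_mul_eq_mul_div, div_le_iff₀ (by linarith)]; nlinarith
  -- The `j` extra levels between `a * j` and `(a + 1) * j` cost at most `(4 log 2 + L) * j` in the
  -- exponent. The tilt gains at least `a * (p * G / 2) * j`, so a large `a` leaves a decay `exp
  -- (-j)`.
  obtain ⟨a, ha⟩ := exists_nat_gt (max 1 ((4 * Real.log 2 + L + 1) / (p * G / 2)))
  have ha1 : (1 : ℝ) < a := (le_max_left _ _).trans_lt ha
  have ha2 : 4 * Real.log 2 + L + 1 < a * (p * G / 2) := by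
    rw [← div_lt_iff₀ (by positivity)]; exact (le_max_right _ _).trans_lt ha
  set K : ℝ := (Real.pi * r₀ ^ (2 : ℝ) / 4) ^ (-(1 + p)) * (Real.pi * (r₀ / 4) ^ (2 : ℝ))
    * Real.exp (p * (1 + p) / 2 * C - q * p * (2 * L - C)) with hK
  have hK0 : 0 ≤ K := by positivity
  refine ⟨a, fun j => ENNReal.ofReal c ^ (j - 6) + ENNReal.ofReal (K * Real.exp (-1) ^ j),
    by exact_mod_cast ha1.le, ?_, ?_⟩
  · rw [ENNReal.tsum_add]
    refine ENNReal.add_ne_top.2 ⟨?_, ?_⟩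
    · have h1 : Summable fun j : ℕ => c ^ (j - 6) := by
        rw [← summable_nat_add_iff 6]
        simpa using summable_geometric_of_lt_one hc0 hc1
      have h2 := h1.tsum_ofReal_ne_top
      simpa only [ENNReal.ofReal_pow hc0] using h2
    · exact ((summable_geometric_of_lt_one (Real.exp_pos _).le
        (Real.exp_lt_one_iff.2 (by norm_num))).mul_left K).tsum_ofReal_ne_top
  · intro j n x z hj hn hxz
    obtain ⟨n', rfl⟩ := Nat.exists_eq_add_of_le' hn
    -- `N = j - 6` separated balls fit after `j` refinements. The truncated subtraction means `N =
    -- 0` for small `j`, where the inequality requires `2 ≤ j`.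
    have hpow : 4 * (3 * (j - 6) + 1) ≤ 2 ^ j := by
      rcases le_or_gt j 6 with h6 | h6
      · interval_cases j <;> norm_num
      · obtain ⟨i, rfl⟩ := Nat.exists_eq_add_of_lt h6
        have : i + 1 < 2 ^ (i + 1) := Nat.lt_two_pow_self
        have e : 2 ^ (6 + i + 1) = 64 * 2 ^ (i + 1) := by ring
        omega
    have h1 := hc q p (Real.exp (-(β * Real.log 2 * (a * j)))) (a * j) ((a + 1) * j) n' (j - 6) x z
      hq hp0 (Real.exp_pos _).le (by rw [add_mul]; omega) hxz (by
        have h2 : (4 * (3 * ((j - 6 : ℕ) : ℝ) + 1)) ≤ 2 ^ j := by exact_mod_cast hpow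
        rw [add_mul a 1 j, one_mul, pow_add, ← div_div, mul_div_assoc', div_le_div_iff₀ (by positivity)
          (by norm_num)]
        have : 0 < r₀ / 2 ^ (a * j) := by positivity
        nlinarith)
    refine h1.trans (add_le_add le_rfl (ENNReal.ofReal_le_ofReal ?_))
    have h2 : ∀ i : ℕ, (r₀ / 2 ^ i) = r₀ * Real.exp (-(i * Real.log 2)) := by
      intro i
      rw [Real.exp_neg, mul_comm (i : ℝ), Real.exp_mul, Real.exp_log two_pos, Real.rpow_natCast]
      field_simp
    have h3 : Real.pi * (r₀ / 2 ^ ((a + 1) * j)) ^ (2 : ℝ) / 4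
        = (Real.pi * r₀ ^ (2 : ℝ) / 4) * Real.exp (-(((a + 1) * j : ℕ) * Real.log 2) * 2) := by
      rw [h2, Real.mul_rpow hr₀.le (Real.exp_pos _).le, ← Real.exp_mul]
      ring
    have h4 : Real.pi * (r₀ / 2 ^ (a * j) / 4) ^ (2 : ℝ)
        = (Real.pi * (r₀ / 4) ^ (2 : ℝ)) * Real.exp (-((a * j : ℕ) * Real.log 2) * 2) := by
      rw [h2, mul_div_right_comm, Real.mul_rpow (by positivity) (Real.exp_pos _).le, ← Real.exp_mul]
      ring
    rw [h3, h4, Real.mul_rpow (by positivity) (Real.exp_pos _).le, ← Real.exp_mul, ← Real.exp_mul,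
      ← Real.exp_nat_mul, hK]
    have h5 : ∀ x y e₁ e₂ e₃ e₄ : ℝ, x * Real.exp e₁ * Real.exp e₂ * (Real.exp e₃ * (y * Real.exp e₄))
        = x * y * Real.exp (e₁ + e₂ + e₃ + e₄) := by
      intro x y e₁ e₂ e₃ e₄
      rw [Real.exp_add, Real.exp_add, Real.exp_add]
      ring
    rw [h5, mul_assoc _ (Real.exp _) (Real.exp _), ← Real.exp_add]
    refine mul_le_mul_of_nonneg_left (Real.exp_le_exp.2 ?_) (by positivity)
    push_cast
    have hj0 : (0 : ℝ) ≤ j := Nat.cast_nonneg j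
    have h6 : 2 * Real.log 2 * (a + 1) * (1 + p) - β * Real.log 2 * a * p - 2 * Real.log 2 * a
        + p * (1 + p) / 2 * (a + 1) * L - q * p * a * L ≤ -1 := by
      have e1 : a * p * (G - p * L / 2) ≥ a * p * (G / 2) :=
        mul_le_mul_of_nonneg_left (by linarith) (by positivity)
      have e2 : 2 * Real.log 2 * (1 + p) ≤ 4 * Real.log 2 := by nlinarith
      have e3 : p * (1 + p) / 2 * L ≤ L := by
        have : p * (1 + p) / 2 ≤ 1 := by nlinarith
        nlinarith
      rw [hG] at e1 ha2
      linarith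
    have h7 := mul_le_mul_of_nonneg_right h6 hj0
    linarith

end IsScaleField

/-! ### Mass distribution and the lower bound for the dimension. -/

/-- A ball of radius at least `ϱ` around `x` contains one of finitely many prescribed balls near
`x` of comparable radius. -/
theorem exists_finset_unit_ball_subset : ∃ U : Finset Plane, (∀ u ∈ U, ‖u‖ = 1) ∧
    ∀ (x c : Plane) (ϱ ρ : ℝ), 0 < ϱ → ϱ ≤ ρ → x ∈ Metric.ball c ρ →
      ∃ u ∈ U, Metric.ball (x + (ϱ / 2) • u) (ϱ / 4) ⊆ Metric.ball c ρ := by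
  obtain ⟨t, ht, htf, hcov⟩ := (isCompact_sphere (0 : Plane) 1).finite_cover_balls
    (e := 1 / 2) (by norm_num)
  refine ⟨htf.toFinset, fun u hu => by simpa using ht (htf.mem_toFinset.1 hu), ?_⟩
  have hnet : ∀ e : Plane, ‖e‖ = 1 → ∃ u ∈ htf.toFinset, ‖e - u‖ ≤ 1 / 2 := by
    intro e he
    have := hcov (show e ∈ Metric.sphere (0 : Plane) 1 by simpa using he)
    simp only [mem_iUnion, Metric.mem_ball, dist_eq_norm] at this
    obtain ⟨u, hu, hlt⟩ := this
    exact ⟨u, htf.mem_toFinset.2 hu, hlt.le⟩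
  intro x c ϱ ρ hϱ hle hx
  have hv : ‖c - x‖ < ρ := by rwa [← dist_eq_norm, dist_comm]
  obtain ⟨e, he1, he⟩ : ∃ e : Plane, ‖e‖ = 1 ∧ c - x = ‖c - x‖ • e := by
    rcases eq_or_ne (c - x) 0 with h0 | h0
    · exact ⟨EuclideanSpace.single 0 1, by simp, by simp [h0]⟩
    · have hn : ‖c - x‖ ≠ 0 := norm_ne_zero_iff.2 h0
      exact ⟨‖c - x‖⁻¹ • (c - x), by rw [norm_smul, norm_inv, norm_norm, inv_mul_cancel₀ hn],
        by rw [smul_smul, mul_inv_cancel₀ hn, one_smul]⟩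
  obtain ⟨u, hu, heu⟩ := hnet e he1
  -- The new centre lies `ϱ / 2` away from `x`, roughly towards `c`; the net on the unit sphere errs
  -- by at most `ϱ / 4`. The radius `ϱ / 4` keeps the small ball at distance at least `ϱ / 4` from
  -- `x`, as the decorrelation from the tilt requires.
  refine ⟨u, hu, Metric.ball_subset_ball' ?_⟩
  have h1 : x + (ϱ / 2) • u - c = (ϱ / 2 - ‖c - x‖) • e - (ϱ / 2) • (e - u) := by
    have : x + (ϱ / 2) • u - c = (ϱ / 2) • u - (c - x) := by abel
    rw [this]
    conv_lhs => rw [he]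
    rw [sub_smul, smul_sub]
    abel
  have h2 : ‖x + (ϱ / 2) • u - c‖ ≤ |ϱ / 2 - ‖c - x‖| + ϱ / 4 := by
    rw [h1]
    refine (norm_sub_le _ _).trans (add_le_add ?_ ?_)
    · rw [norm_smul, he1, mul_one, Real.norm_eq_abs]
    · rw [norm_smul, Real.norm_of_nonneg (by positivity)]
      calc ϱ / 2 * ‖e - u‖ ≤ ϱ / 2 * (1 / 2) := mul_le_mul_of_nonneg_left heu (by positivity)
        _ = ϱ / 4 := by ring
  rw [dist_eq_norm]
  have h3 := norm_nonneg (c - x)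
  rcases abs_cases (ϱ / 2 - ‖c - x‖) with ⟨h4, _⟩ | ⟨h4, _⟩ <;> linarith

/-- Mass distribution principle for a limit of measures, with respect to approximate mass
distributions `Z n`. -/
theorem IsRadonLimit.exists_pos_le_tsum_ball_rpow {μ Z : ℕ → Measure Plane} {M : Measure Plane}
    (hM : IsRadonLimit μ M) (hμ : ∀ n, IsFiniteMeasureOnCompacts (μ n)) {S : Set Plane}
    (hS : IsCompact S) (hZS : ∀ n, Z n Sᶜ = 0) {r₀ q : ℝ} (hr₀ : 0 < r₀) (hq : 0 < q) {a j₀ : ℕ}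
    (ha : 1 ≤ a) {G : ℕ → Set Plane}
    (hG : ∀ n, ∀ x ∈ G n, ∀ j, j₀ ≤ j → (a + 1) * (j + 1) ≤ n → ∀ (c : Plane) (ρ : ℝ),
      r₀ / 2 ^ (a * (j + 1)) ≤ ρ → x ∈ Metric.ball c ρ →
        Z n (Metric.ball x (4 * (r₀ / 2 ^ (a * j)))) ≤ μ n (Metric.ball c ρ) ^ q)
    {e : ℝ≥0∞} (he : e ≠ 0) (heG : ∃ᶠ n in atTop, e ≤ Z n (G n)) :
    ∃ e' : ℝ≥0∞, e' ≠ 0 ∧ ∀ (I : Set ℕ) (x : ℕ → Plane) (r : ℕ → ℝ),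
      S ⊆ ⋃ i ∈ I, Metric.ball (x i) (r i) → e' ≤ ∑' i : I, M (Metric.ball (x i) (r i)) ^ q := by
  have hpos : ∀ k : ℕ, 0 < r₀ / 2 ^ k := fun k => by positivity
  -- Covering balls assigned to the coarsest scale `j₀` may be arbitrarily large. Cutting `S` into
  -- finitely many pieces handles them at the price of a factor `QF.card`.
  obtain ⟨Q, -, hQf, hQ⟩ := hS.finite_cover_balls (e := 2 * (r₀ / 2 ^ (a * j₀)))
    (by have := hpos (a * j₀); linarith)
  set QF := hQf.toFinset with hQF
  refine ⟨e / (QF.card + 1), ENNReal.div_ne_zero.2 ⟨he, by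
    exact_mod_cast ENNReal.natCast_ne_top (QF.card + 1)⟩, ?_⟩
  intro I x r hcov
  -- a finite subcover by slightly smaller balls
  obtain ⟨F, hF⟩ := hS.elim_finite_subcover
    (fun p : {p : I × ℝ // 0 < p.2 ∧ p.2 < r p.1} => Metric.ball (x p.1.1) p.1.2)
    (fun _ => Metric.isOpen_ball) (by
      intro y hy
      have := hcov hy
      simp only [mem_iUnion, Metric.mem_ball] at this
      obtain ⟨i, hi, hlt⟩ := this
      obtain ⟨ρ, h1, h2⟩ := exists_between hlt
      exact mem_iUnion.2 ⟨⟨(⟨i, hi⟩, ρ), dist_nonneg.trans_lt h1, h2⟩, h1⟩)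
  classical
  -- one radius for each centre
  set FI : Finset I := F.image fun p => p.1.1 with hFI
  have hrad : ∀ i : I, ∃ ρ : ℝ, ρ < r i ∧ ∀ p ∈ F, p.1.1 = i → 0 < ρ ∧ p.1.2 ≤ ρ := by
    intro i
    by_cases hi : (F.filter fun p => p.1.1 = i).Nonempty
    · obtain ⟨p, hp, hmax⟩ := Finset.exists_max_image _ (fun p => p.1.2) hi
      rw [Finset.mem_filter] at hp
      refine ⟨p.1.2, by rw [← hp.2]; exact p.2.2, fun p' hp' hi' => ⟨p.2.1, hmax p' ?_⟩⟩
      exact Finset.mem_filter.2 ⟨hp', hi'⟩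
    · exact ⟨r i - 1, by linarith, fun p hp hpi =>
        absurd ⟨p, Finset.mem_filter.2 ⟨hp, hpi⟩⟩ hi⟩
  choose ρ hρr hρ using hrad
  have hρ0 : ∀ i ∈ FI, 0 < ρ i := by
    intro i hi
    obtain ⟨p, hp, hpi⟩ := Finset.mem_image.1 hi
    exact (hρ i p hp hpi).1
  have hcovF : S ⊆ ⋃ i ∈ FI, Metric.ball (x i) (ρ i) := by
    intro y hy
    have := hF hy
    simp only [mem_iUnion] at this
    obtain ⟨p, hp, hyp⟩ := this
    exact mem_iUnion₂.2 ⟨p.1.1, Finset.mem_image_of_mem _ hp,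
      Metric.ball_subset_ball (hρ _ p hp rfl).2 hyp⟩
  -- the scale adapted to each ball
  have hscale : ∀ i : I, ∃ j, j₀ ≤ j ∧ (i ∈ FI → r₀ / 2 ^ (a * (j + 1)) ≤ ρ i) ∧
      (j = j₀ ∨ ρ i ≤ r₀ / 2 ^ (a * j)) := by
    intro i
    by_cases hi : i ∈ FI
    · have hex : ∃ j, j₀ ≤ j ∧ r₀ / 2 ^ (a * (j + 1)) ≤ ρ i := by
        obtain ⟨k, hk⟩ := exists_pow_lt_of_lt_one (div_pos (hρ0 i hi) hr₀)
          (show (1 / 2 : ℝ) < 1 by norm_num)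
        refine ⟨max j₀ k, le_max_left _ _, ?_⟩
        rw [lt_div_iff₀ hr₀] at hk
        refine le_trans ?_ hk.le
        rw [one_div, inv_pow, div_eq_inv_mul]
        refine mul_le_mul_of_nonneg_right (inv_anti₀ (by positivity)
          (pow_le_pow_right₀ one_le_two ?_)) hr₀.le
        have h1 : k ≤ max j₀ k := le_max_right _ _
        nlinarith
      refine ⟨Nat.find hex, (Nat.find_spec hex).1, fun _ => (Nat.find_spec hex).2, ?_⟩
      by_contra! hcon
      have h1 := (Nat.find_spec hex).1
      have h2 := Nat.find_min hex (m := Nat.find hex - 1) (by omega)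
      refine h2 ⟨by omega, ?_⟩
      rw [Nat.sub_add_cancel (by omega)]
      exact hcon.2.le
    · exact ⟨j₀, le_rfl, fun h => absurd h hi, Or.inl rfl⟩
  choose j hj₀ hj1 hj2 using hscale
  have hfreq : ∃ᶠ n in atTop, e / (QF.card + 1) ≤ ∑ i ∈ FI, μ n (Metric.ball (x i) (ρ i)) ^ q := by
    refine (heG.and_eventually
      (eventually_ge_atTop (FI.sup fun i => (a + 1) * (j i + 1)))).mono ?_
    rintro n ⟨hn1, hn2⟩
    have hn : ∀ i ∈ FI, (a + 1) * (j i + 1) ≤ n := fun i hi =>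
      (Finset.le_sup (f := fun i => (a + 1) * (j i + 1)) hi).trans hn2
    have hpiece : ∀ y ∈ QF, ∀ i ∈ FI,
        Z n (G n ∩ (Metric.ball y (2 * (r₀ / 2 ^ (a * j₀))) ∩ Metric.ball (x i) (ρ i)))
          ≤ μ n (Metric.ball (x i) (ρ i)) ^ q := by
      intro y _ i hi
      rcases (G n ∩ (Metric.ball y (2 * (r₀ / 2 ^ (a * j₀))) ∩
        Metric.ball (x i) (ρ i))).eq_empty_or_nonempty with h0 | ⟨z, hzG, hzy, hzi⟩
      · rw [h0, measure_empty]; exact zero_le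
      -- A piece containing a good point `z` lies in the ball of radius `4 * (r₀ / 2 ^ (a * j))`
      -- about `z`, whose `Z n`-mass is controlled by `hG`.
      refine (measure_mono ?_).trans
        (hG n z hzG (j i) (hj₀ i) (hn i hi) (x i) (ρ i) (hj1 i hi) hzi)
      rintro z' ⟨-, hz'y, hz'i⟩
      rw [Metric.mem_ball] at *
      rcases hj2 i with h1 | h1
      · rw [h1]
        have := dist_triangle_right z' z y
        linarith
      · have := dist_triangle_right z' z (x i)
        have := hpos (a * j i)
        linarith
    have hcard : ((QF.card : ℝ≥0∞) + 1) ≠ 0 := by simp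
    have hcard' : ((QF.card : ℝ≥0∞) + 1) ≠ ∞ := by
      exact_mod_cast ENNReal.natCast_ne_top (QF.card + 1)
    rw [ENNReal.div_le_iff hcard hcard']
    calc e ≤ Z n (G n) := hn1
      _ ≤ Z n ((⋃ y ∈ QF, ⋃ i ∈ FI, G n ∩ (Metric.ball y (2 * (r₀ / 2 ^ (a * j₀)))
            ∩ Metric.ball (x i) (ρ i))) ∪ Sᶜ) := by
          refine measure_mono fun z hz => ?_
          by_cases hzS : z ∈ S
          · left
            have h1 := hQ hzS
            have h2 := hcovF hzS
            simp only [mem_iUnion] at h1 h2 ⊢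
            obtain ⟨y, hy, hzy⟩ := h1
            obtain ⟨i, hi, hzi⟩ := h2
            exact ⟨y, hQf.mem_toFinset.2 hy, i, hi, hz, hzy, hzi⟩
          · exact Or.inr hzS
      _ ≤ ∑ y ∈ QF, ∑ i ∈ FI, μ n (Metric.ball (x i) (ρ i)) ^ q := by
          refine (measure_union_le _ _).trans ?_
          rw [hZS, add_zero]
          refine (measure_biUnion_finset_le _ _).trans (Finset.sum_le_sum fun y hy => ?_)
          exact (measure_biUnion_finset_le _ _).trans
            (Finset.sum_le_sum fun i hi => hpiece y hy i hi)
      _ ≤ (∑ i ∈ FI, μ n (Metric.ball (x i) (ρ i)) ^ q) * (QF.card + 1) := by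
          rw [Finset.sum_const, nsmul_eq_mul, mul_comm]
          exact mul_le_mul' le_rfl le_self_add
  -- pass to the limit
  have hε : ∀ ε : ℝ≥0∞, 0 < ε → e / (QF.card + 1)
      ≤ ∑ i ∈ FI, (M (Metric.ball (x i) (r i)) + ε) ^ q := by
    intro ε hε
    have hev : ∀ᶠ n in atTop, ∀ i ∈ FI, μ n (Metric.ball (x i) (ρ i))
        ≤ M (Metric.ball (x i) (r i)) + ε := by
      rw [Filter.eventually_all_finset]
      intro i _
      have h1 := hM.limsup_ball_le hμ (x i) (hρr i)
      have hfin : M (Metric.ball (x i) (r i)) ≠ ∞ := by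
        have := hM.1
        exact measure_ball_lt_top.ne
      exact (eventually_lt_of_limsup_lt (h1.trans_lt (ENNReal.lt_add_right hfin hε.ne'))).mono
        fun n hn => hn.le
    obtain ⟨n, hn1, hn2⟩ := (hfreq.and_eventually hev).exists
    exact hn1.trans (Finset.sum_le_sum fun i hi => ENNReal.rpow_le_rpow (hn2 i hi) hq.le)
  have hlim : Tendsto (fun ε : ℝ≥0∞ => ∑ i ∈ FI, (M (Metric.ball (x i) (r i)) + ε) ^ q) (𝓝[>] 0)
      (𝓝 (∑ i ∈ FI, (M (Metric.ball (x i) (r i)) + 0) ^ q)) := by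
    refine tendsto_nhdsWithin_of_tendsto_nhds (tendsto_finsetSum _ fun i _ => ?_)
    have h1 : Continuous fun ε : ℝ≥0∞ => (M (Metric.ball (x i) (r i)) + ε) ^ q :=
      ENNReal.continuous_rpow_const.comp (continuous_const.add continuous_id)
    exact h1.tendsto 0
  have hle := ge_of_tendsto hlim (eventually_mem_nhdsWithin.mono fun ε hε' => hε ε hε')
  simp only [add_zero] at hle
  exact hle.trans (ENNReal.sum_le_tsum FI)

/-- Lower bounds for the measure-theoretic dimension from the mass distribution principle. -/
theorem ofReal_le_measureDimH {M : Measure Plane} {S K : Set Plane} (hSK : S ⊆ K) {q : ℝ}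
    {e : ℝ≥0∞} (he : e ≠ 0) (hS : ∀ (I : Set ℕ) (x : ℕ → Plane) (r : ℕ → ℝ),
      S ⊆ ⋃ i ∈ I, Metric.ball (x i) (r i) → e ≤ ∑' i : I, M (Metric.ball (x i) (r i)) ^ q) :
    ENNReal.ofReal q ≤ measureDimH M K := by
  refine le_iInf₂ fun s hs => ?_
  by_contra! hlt
  have hsq : (s : ℝ) ≤ q := by
    have h1 : ENNReal.ofReal s < ENNReal.ofReal q := by rwa [ENNReal.ofReal_coe_nnreal]
    exact (ENNReal.ofReal_lt_ofReal_iff'.1 h1).1.le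
  -- A ball of mass at least one already makes the sum at least one. If there is none, lowering the
  -- exponent from `q` to `s` only increases the terms.
  have h1 : min 1 e ≤ measureHausdorffContent M s K := by
    refine le_iInf fun I => le_iInf fun x => le_iInf fun r => le_iInf₂ fun _ hcov => ?_
    by_cases hbig : ∃ i : I, 1 ≤ M (Metric.ball (x i) (r i))
    · obtain ⟨i, hi⟩ := hbig
      refine (min_le_left _ _).trans ((by simpa using ENNReal.rpow_le_rpow hi s.2 :
        1 ≤ M (Metric.ball (x i) (r i)) ^ (s : ℝ)).trans ?_)
      exact ENNReal.le_tsum (f := fun i : I => M (Metric.ball (x i) (r i)) ^ (s : ℝ)) i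
    · push Not at hbig
      refine (min_le_right _ _).trans ((hS I x r (hSK.trans hcov)).trans ?_)
      exact ENNReal.tsum_le_tsum fun i =>
        ENNReal.rpow_le_rpow_of_exponent_ge (hbig i).le hsq
  rw [hs] at h1
  exact (lt_min one_pos (pos_iff_ne_zero.2 he)).not_ge h1

namespace IsScaleField

variable {Ω : Type*} [mΩ : MeasurableSpace Ω] {P : Measure Ω} {κ : ℕ → ℝ → ℝ}
  {Y : ℕ → Plane → Ω → ℝ} {L C r₀ : ℝ}

theorem measurable_chaos_ball (h : IsScaleField P κ Y) (q : ℝ) (ν : Measure Plane) [SFinite ν]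
    (n : ℕ) (v : Plane) (r : ℝ) :
    Measurable fun p : Plane × Ω => chaos κ Y q ν n p.2 (Metric.ball (p.1 + v) r) := by
  have h1 : ∀ p : Plane × Ω, chaos κ Y q ν n p.2 (Metric.ball (p.1 + v) r)
      = ∫⁻ y, {z : (Plane × Ω) × Plane | dist z.2 (z.1.1 + v) < r}.indicator
          (fun z => expWeight κ Y q n z.2 z.1.2) (p, y) ∂ν := by
    intro p
    rw [chaos_apply _ _ _ _ _ _ measurableSet_ball, ← lintegral_indicator measurableSet_ball]
    rfl
  simp_rw [h1]
  refine Measurable.lintegral_prod_right' ?_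
  refine Measurable.indicator ?_ ?_
  · exact (h.measurable_expWeight q n).comp
      (measurable_snd.prodMk (measurable_snd.comp measurable_fst))
  · exact measurableSet_lt (measurable_snd.dist
      ((measurable_fst.comp measurable_fst).add_const v)) measurable_const

/-- If bad events, indexed by scales, have summable probabilities under the tilted measures, then
almost surely the points which are good at all small scales carry a positive mass. -/
theorem ae_exists_frequently_le_chaos (h : IsScaleField P κ Y) (q : ℝ) (ν : Measure Plane)
    [IsProbabilityMeasure ν] {s : ℕ → ℕ} (hs : ∀ j n, s j ≤ n → j < n) {w : ℕ → ℝ≥0∞}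
    (hw : ∑' j, w j ≠ ∞) {f : ℕ → ℕ → Plane × Ω → ℝ≥0∞} (hf : ∀ j n, Measurable (f j n))
    (hf1 : ∀ j n z, f j n z ≠ 0 → 1 ≤ f j n z)
    (hfw : ∀ j n x, 1 ≤ j → s j ≤ n → ∫⁻ ω, expWeight κ Y q n x ω * f j n (x, ω) ∂P ≤ w j)
    (hmass : ∀ᵐ ω ∂P, ∃ c : ℝ, 0 < c ∧
      Tendsto (fun n => chaos κ Y q ν n ω univ) atTop (𝓝 (ENNReal.ofReal c))) :
    ∀ᵐ ω ∂P, ∃ (j₀ : ℕ) (e : ℝ≥0∞), e ≠ 0 ∧ ∃ᶠ n in atTop, e ≤ chaos κ Y q ν n ω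
      {x | ∀ j, j₀ ≤ j → s j ≤ n → f j n (x, ω) = 0} := by
  have hP := h.isProbabilityMeasure
  set H : ℕ → ℕ → Plane × Ω → ℝ≥0∞ := fun j₀ n z =>
    ∑ j ∈ (Finset.range n).filter (fun j => j₀ + 1 ≤ j ∧ s j ≤ n), f j n z with hH
  have hHm : ∀ j₀ n, Measurable (H j₀ n) := fun j₀ n =>
    Finset.measurable_fun_sum _ fun j _ => hf j n
  -- `B j₀ n` dominates the mass at level `n` of the points that are bad at some scale beyond `j₀`.
  -- By Fubini its mean is a sum of tilted probabilities, hence at most a tail of `∑ w`.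
  set B : ℕ → ℕ → Ω → ℝ≥0∞ := fun j₀ n ω => ∫⁻ x, expWeight κ Y q n x ω * H j₀ n (x, ω) ∂ν with hB
  have hBm : ∀ j₀ n, Measurable (B j₀ n) := fun j₀ n =>
    Measurable.lintegral_prod_left ((h.measurable_expWeight q n).mul (hHm j₀ n))
  have hEB : ∀ j₀ n, ∫⁻ ω, B j₀ n ω ∂P ≤ ∑' j, w (j + j₀) := by
    intro j₀ n
    rw [hB, lintegral_lintegral_swap]
    · have hx : ∀ x, ∫⁻ ω, expWeight κ Y q n x ω * H j₀ n (x, ω) ∂P ≤ ∑' j, w (j + j₀) := by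
        intro x
        have hm : ∀ j, Measurable fun ω => expWeight κ Y q n x ω * f j n (x, ω) := fun j =>
          (h.measurable_expWeight_right q n x).mul ((hf j n).comp measurable_prodMk_left)
        simp only [hH, Finset.mul_sum]
        rw [lintegral_finsetSum _ fun j _ => hm j]
        calc _ ≤ ∑ j ∈ (Finset.range n).filter (fun j => j₀ + 1 ≤ j ∧ s j ≤ n), w j := by
              refine Finset.sum_le_sum fun j hj => ?_
              rw [Finset.mem_filter] at hj
              exact hfw j n x (by omega) hj.2.2
          _ ≤ ∑ j ∈ (Finset.range n).filter (fun j => j₀ ≤ j), w j := by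
              refine Finset.sum_le_sum_of_subset fun j hj => ?_
              rw [Finset.mem_filter] at hj ⊢
              exact ⟨hj.1, by omega⟩
          _ ≤ ∑ j ∈ Finset.range n, w (j + j₀) := by
              rw [Finset.range_eq_Ico, Finset.sum_Ico_add']
              refine Finset.sum_le_sum_of_subset fun j hj => ?_
              simp only [Finset.mem_filter, Finset.mem_Ico] at hj ⊢
              omega
          _ ≤ _ := ENNReal.sum_le_tsum _
      refine (lintegral_mono hx).trans ?_
      simp
    · exact (((h.measurable_expWeight q n).mul (hHm j₀ n)).comp measurable_swap).aemeasurable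
  -- Fatou's lemma in `n` and the vanishing of the tails in `j₀` give this variable zero mean. A
  -- random `j₀` then leaves bad mass below `c / 2` for infinitely many `n`.
  have hzero : ∀ᵐ ω ∂P, ⨅ j₀, liminf (fun n => B j₀ n ω) atTop = 0 := by
    have hm : Measurable fun ω => ⨅ j₀, liminf (fun n => B j₀ n ω) atTop :=
      Measurable.iInf fun j₀ => Measurable.liminf (hBm j₀)
    refine (lintegral_eq_zero_iff hm).1 (le_antisymm ?_ zero_le)
    refine ge_of_tendsto' (ENNReal.tendsto_sum_nat_add w hw) fun j₀ => ?_
    refine (lintegral_mono fun ω => iInf_le _ j₀).trans ((lintegral_liminf_le (hBm j₀)).trans ?_)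
    refine (liminf_le_liminf (Eventually.of_forall (hEB j₀))).trans ?_
    simp
  filter_upwards [hzero, hmass] with ω hω ⟨c, hc, hlim⟩
  have hlt : ⨅ j₀, liminf (fun n => B j₀ n ω) atTop < ENNReal.ofReal (c / 2) := by
    rw [hω]; simpa using hc
  obtain ⟨j₀, hj₀⟩ := iInf_lt_iff.1 hlt
  refine ⟨j₀ + 1, ENNReal.ofReal (c / 4), by simpa using hc, ?_⟩
  have hev : ∀ᶠ n in atTop, ENNReal.ofReal (3 * c / 4) < chaos κ Y q ν n ω univ :=
    hlim.eventually (lt_mem_nhds ((ENNReal.ofReal_lt_ofReal_iff hc).2 (by linarith)))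
  refine ((frequently_lt_of_liminf_lt (by isBoundedDefault) hj₀).and_eventually hev).mono ?_
  rintro n ⟨hn1, hn2⟩
  set G : Set Plane := {x | ∀ j, j₀ + 1 ≤ j → s j ≤ n → f j n (x, ω) = 0} with hG
  have hGH : G = {x | H j₀ n (x, ω) = 0} := by
    ext x
    simp only [hG, mem_ofPred_eq, hH, Finset.sum_eq_zero_iff, Finset.mem_filter, Finset.mem_range]
    exact ⟨fun hx j hj => hx j hj.2.1 hj.2.2, fun hx j h1 h2 => hx j ⟨hs j n h2, h1, h2⟩⟩
  have hHω : Measurable fun x => H j₀ n (x, ω) := (hHm j₀ n).comp measurable_prodMk_right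
  have hGm : MeasurableSet G := by
    rw [hGH]
    exact hHω (measurableSet_singleton 0)
  have hGc : chaos κ Y q ν n ω Gᶜ ≤ B j₀ n ω := by
    rw [chaos_apply _ _ _ _ _ _ hGm.compl, ← lintegral_indicator hGm.compl]
    refine lintegral_mono fun x => ?_
    by_cases hx : x ∈ Gᶜ
    swap
    · rw [indicator_of_notMem hx]
      exact zero_le
    rw [indicator_of_mem hx]
    refine le_mul_of_one_le_right' ?_
    have hx' : H j₀ n (x, ω) ≠ 0 := fun h0 => hx (by rw [hGH]; exact h0)
    obtain ⟨j, hj, hne⟩ := Finset.exists_ne_zero_of_sum_ne_zero hx'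
    exact (hf1 j n _ hne).trans (Finset.single_le_sum (f := fun j => f j n (x, ω))
      (fun _ _ => zero_le) hj)
  have hsum : chaos κ Y q ν n ω univ ≤ chaos κ Y q ν n ω G + chaos κ Y q ν n ω Gᶜ :=
    (measure_add_measure_compl hGm).ge
  have h1 : ENNReal.ofReal (c / 4) + ENNReal.ofReal (c / 2)
      ≤ chaos κ Y q ν n ω G + ENNReal.ofReal (c / 2) := by
    rw [← ENNReal.ofReal_add (by positivity) (by positivity)]
    refine le_trans (le_of_eq ?_) (hn2.le.trans (hsum.trans (add_le_add le_rfl (hGc.trans hn1.le))))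
    congr 1
    ring
  exact (ENNReal.add_le_add_iff_right ENNReal.ofReal_ne_top).1 h1

/-- The bad events of the multifractal analysis: their probabilities are summable over the scales,
and outside of them the chaos over `ν` is controlled by a power of the chaos over the volume. -/
theorem exists_bad_events (h : IsScaleField P κ Y) (hκ : DyadicKernel L C r₀ κ)
    (hL : L < 4 * Real.log 2) {q t D : ℝ} (hq : q ∈ Ioo 0 1)
    (ht : q * (2 * Real.log 2 + L / 2) - q ^ 2 / 2 * L < t * Real.log 2) (hD : 0 ≤ D)
    (ν : Measure Plane) [IsProbabilityMeasure ν]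
    (hν : ∀ x r, 0 < r → ν (Metric.ball x r) ≤ ENNReal.ofReal (D * r ^ t)) :
    ∃ (a : ℕ) (w : ℕ → ℝ≥0∞) (f : ℕ → ℕ → Plane × Ω → ℝ≥0∞), 1 ≤ a ∧ ∑' j, w j ≠ ∞ ∧
      (∀ j n, Measurable (f j n)) ∧ (∀ j n z, f j n z ≠ 0 → 1 ≤ f j n z) ∧
      (∀ j n x, 1 ≤ j → (a + 1) * (j + 1) ≤ n →
        ∫⁻ ω, expWeight κ Y q n x ω * f j n (x, ω) ∂P ≤ w j) ∧
      ∀ j n x ω, f j n (x, ω) = 0 → ∀ (c : Plane) (ρ : ℝ), r₀ / 2 ^ (a * (j + 1)) ≤ ρ →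
        x ∈ Metric.ball c ρ → chaos κ Y q ν n ω (Metric.ball x (4 * (r₀ / 2 ^ (a * j))))
          ≤ chaos κ Y 1 volume n ω (Metric.ball c ρ) ^ q := by
  obtain ⟨hq0, hq1⟩ := hq
  have hr₀ := hκ.logKernel.r₀_pos
  have hL0 := hκ.logKernel.L_nonneg
  have hlog : 0 < Real.log 2 := Real.log_pos one_lt_two
  -- `β` is an exponent above the typical one of the volume chaos near `x` under the tilt, `2 + L /
  -- (2 log 2) - q L / log 2`. At the same time `q * β` is below the typical exponent of the chaos
  -- over `ν`, `t - q² L / (2 log 2)`. The hypothesis `ht` is exactly the room between them.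
  obtain ⟨β, hβ1, hβ2⟩ : ∃ β, 0 < (β - 2) * Real.log 2 - L / 2 + q * L ∧
      q * β * Real.log 2 < t * Real.log 2 - q ^ 2 / 2 * L := by
    have h1 : (2 * Real.log 2 + L / 2 - q * L) / Real.log 2
        < (t * Real.log 2 - q ^ 2 / 2 * L) / (q * Real.log 2) := by
      rw [div_lt_div_iff₀ hlog (by positivity)]
      nlinarith
    obtain ⟨β, h2, h3⟩ := exists_between h1
    rw [div_lt_iff₀ hlog] at h2
    rw [lt_div_iff₀ (by positivity)] at h3
    exact ⟨β, by linarith, by linarith⟩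
  obtain ⟨θ, hθ, hb1⟩ : ∃ θ ∈ Ioo (0 : ℝ) 1,
      q * β * Real.log 2 < t * Real.log 2 - q ^ 2 * (1 + θ) / 2 * L := by
    have h1 : Tendsto (fun θ : ℝ => t * Real.log 2 - q ^ 2 * (1 + θ) / 2 * L) (𝓝[>] 0)
        (𝓝 (t * Real.log 2 - q ^ 2 * (1 + 0) / 2 * L)) := by
      have : Continuous fun θ : ℝ => t * Real.log 2 - q ^ 2 * (1 + θ) / 2 * L := by fun_prop
      exact this.continuousWithinAt
    have h2 := h1.eventually (lt_mem_nhds (show q * β * Real.log 2 < _ by linarith))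
    obtain ⟨θ, h3, h4⟩ := (h2.and (Ioo_mem_nhdsGT one_pos)).exists
    exact ⟨θ, h4, h3⟩
  set b := t * Real.log 2 - q ^ 2 * (1 + θ) / 2 * L with hb
  have hβ0 : 0 ≤ β * Real.log 2 := by nlinarith
  have hb0 : 0 < b := by nlinarith
  obtain ⟨a, u, ha, hu, hub⟩ := h.exists_summable_smallBall hκ hL hq0.le hβ1
  obtain ⟨U, hU1, hU⟩ := exists_finset_unit_ball_subset
  have ha0 : (1 : ℝ) ≤ a := by exact_mod_cast ha
  have hpos : ∀ k : ℕ, 0 < r₀ / 2 ^ k := fun k => by positivity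
  -- thresholds
  set η : ℕ → ℝ := fun j => Real.exp (-(β * Real.log 2 * (a * (j + 1 : ℕ)))) with hη
  have hη0 : ∀ j, 0 < η j := fun j => Real.exp_pos _
  -- `A₁` (too much `ν`-chaos) is excluded by Markov's inequality at order `θ`, and `A₂` (too little
  -- volume chaos) by the small-ball estimate. The translation by `0` matches the form of
  -- `measurable_chaos_ball`.
  set A₁ : ℕ → ℕ → Set (Plane × Ω) := fun j n => {z | ENNReal.ofReal (η j) ^ q
    < chaos κ Y q ν n z.2 (Metric.ball (z.1 + 0) (4 * (r₀ / 2 ^ (a * j))))} with hA₁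
  set A₂ : ℕ → ℕ → Plane → Set (Plane × Ω) := fun j n v => {z | chaos κ Y 1 volume n z.2
    (Metric.ball (z.1 + (r₀ / 2 ^ (a * (j + 1)) / 2) • v) (r₀ / 2 ^ (a * (j + 1)) / 4))
      ≤ ENNReal.ofReal (η j)} with hA₂
  have hA₁m : ∀ j n, MeasurableSet (A₁ j n) := fun j n =>
    measurableSet_lt measurable_const (h.measurable_chaos_ball q ν n _ _)
  have hA₂m : ∀ j n v, MeasurableSet (A₂ j n v) := fun j n v =>
    measurableSet_le (h.measurable_chaos_ball 1 volume n _ _) measurable_const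
  have hi₁ : ∀ j n, Measurable ((A₁ j n).indicator (1 : Plane × Ω → ℝ≥0∞)) := fun j n =>
    measurable_one.indicator (hA₁m j n)
  have hi₂ : ∀ j n v, Measurable ((A₂ j n v).indicator (1 : Plane × Ω → ℝ≥0∞)) := fun j n v =>
    measurable_one.indicator (hA₂m j n v)
  set K : ℝ := Real.exp (6 * C) * (D * (4 * r₀) ^ t) ^ θ / (1 - Real.exp (-(θ * b))) with hK
  have hK0 : 0 ≤ K := div_nonneg (by positivity) (by
    have : Real.exp (-(θ * b)) < 1 :=
      Real.exp_lt_one_iff.2 (neg_neg_of_pos (mul_pos hθ.1 hb0))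
    linarith)
  set g : ℝ := θ * (b - q * β * Real.log 2) with hg
  have hg0 : 0 < g := mul_pos hθ.1 (by linarith)
  -- The `ν`-chaos is taken at scale `a * j` but the threshold at scale `a * (j + 1)`. This gap
  -- between consecutive scales costs only the constant exponential factor here.
  set K' : ℝ := Real.exp (θ * q * (β * Real.log 2) * a) * K with hK'
  refine ⟨a, fun j => ENNReal.ofReal (K' * Real.exp (-g) ^ j) + U.card * u (j + 1),
    fun j n z => (A₁ j n).indicator 1 z + ∑ v ∈ U, (A₂ j n v).indicator 1 z, ha, ?_, ?_, ?_, ?_, ?_⟩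
  · rw [ENNReal.tsum_add]
    refine ENNReal.add_ne_top.2 ⟨?_, ?_⟩
    · exact ((summable_geometric_of_lt_one (Real.exp_pos _).le
        (Real.exp_lt_one_iff.2 (by linarith))).mul_left K').tsum_ofReal_ne_top
    · rw [ENNReal.tsum_mul_left]
      refine ENNReal.mul_ne_top (ENNReal.natCast_ne_top _) (ne_top_of_le_ne_top hu ?_)
      exact ENNReal.tsum_comp_le_tsum_of_injective (add_left_injective 1) u
  · exact fun j n => (hi₁ j n).add (Finset.measurable_fun_sum _ fun v _ => hi₂ j n v)
  · intro j n z hz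
    beta_reduce at hz ⊢
    by_cases h1 : z ∈ A₁ j n
    · rw [indicator_of_mem h1]
      exact le_self_add
    · rw [indicator_of_notMem h1, zero_add] at hz ⊢
      obtain ⟨v, hv, hne⟩ := Finset.exists_ne_zero_of_sum_ne_zero hz
      have h2 : z ∈ A₂ j n v := by
        by_contra h3
        exact hne (indicator_of_notMem h3 _)
      refine le_trans ?_ (Finset.single_le_sum (f := fun v => (A₂ j n v).indicator 1 z)
        (fun _ _ => zero_le) hv)
      simp only [indicator_of_mem h2, Pi.one_apply, le_refl]
  · intro j n x hj hn
    have hm1 : Measurable fun ω => expWeight κ Y q n x ω * (A₁ j n).indicator 1 (x, ω) :=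
      (h.measurable_expWeight_right q n x).mul ((hi₁ j n).comp measurable_prodMk_left)
    have hm2 : ∀ v, Measurable fun ω => expWeight κ Y q n x ω * (A₂ j n v).indicator 1 (x, ω) :=
      fun v => (h.measurable_expWeight_right q n x).mul ((hi₂ j n v).comp measurable_prodMk_left)
    simp only [mul_add, Finset.mul_sum]
    rw [lintegral_add_left hm1, lintegral_finsetSum _ fun v _ => hm2 v]
    refine add_le_add ?_ ?_
    · have hajn : a * j ≤ n := by nlinarith
      have h1 := h.lintegral_expWeight_mul_chaos_ball_rpow hκ.logKernel ⟨hq0.le, hq1.le⟩ hθ hD ν x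
        (hν x) hb hb0 hajn
      have h2 : ∀ ω, expWeight κ Y q n x ω * (A₁ j n).indicator 1 (x, ω)
          ≤ ENNReal.ofReal (Real.exp (θ * q * (β * Real.log 2 * (a * (j + 1 : ℕ)))))
            * (expWeight κ Y q n x ω
              * chaos κ Y q ν n ω (Metric.ball x (4 * (r₀ / 2 ^ (a * j)))) ^ θ) := by
        intro ω
        rw [mul_left_comm]
        refine mul_le_mul' le_rfl ?_
        by_cases hz : (x, ω) ∈ A₁ j n
        · rw [indicator_of_mem hz, Pi.one_apply]
          have h3 : ENNReal.ofReal (η j) ^ q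
              < chaos κ Y q ν n ω (Metric.ball (x + 0) (4 * (r₀ / 2 ^ (a * j)))) := hz
          rw [add_zero] at h3
          refine le_trans (le_of_eq ?_)
            (mul_le_mul' le_rfl (ENNReal.rpow_le_rpow h3.le hθ.1.le))
          rw [hη, ENNReal.ofReal_exp_rpow, ENNReal.ofReal_exp_rpow, ENNReal.ofReal_exp_mul, eq_comm,
            ENNReal.ofReal_eq_one, Real.exp_eq_one_iff]
          ring
        · rw [indicator_of_notMem hz]
          exact zero_le
      refine (lintegral_mono h2).trans ?_
      rw [lintegral_const_mul' _ _ ENNReal.ofReal_ne_top]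
      refine (mul_le_mul' le_rfl h1).trans ?_
      rw [← ENNReal.ofReal_mul (Real.exp_pos _).le]
      apply ENNReal.ofReal_le_ofReal
      have h4 : Real.exp (6 * C) * (D * (4 * r₀) ^ t) ^ θ * Real.exp (-(θ * b)) ^ (a * j)
          / (1 - Real.exp (-(θ * b))) = K * Real.exp (-(θ * b)) ^ (a * j) := by
        rw [hK]; ring
      have h5 : Real.exp (θ * q * (β * Real.log 2 * (a * (j + 1 : ℕ))))
          * (K * Real.exp (-(θ * b)) ^ (a * j)) = K' * Real.exp (-g * a) ^ j := by
        rw [hK', ← Real.exp_nat_mul, ← Real.exp_nat_mul, mul_left_comm, ← Real.exp_add,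
          mul_comm (Real.exp _) K, mul_assoc K, ← Real.exp_add]
        congr 2
        rw [hg]
        push_cast
        ring
      rw [h4, h5]
      refine mul_le_mul_of_nonneg_left (pow_le_pow_left₀ (Real.exp_pos _).le
        (Real.exp_le_exp.2 ?_) _) (by positivity)
      nlinarith
    · rw [← nsmul_eq_mul]
      refine Finset.sum_le_card_nsmul _ _ _ fun v hv => ?_
      have h1 := hub (j + 1) n x (x + (r₀ / 2 ^ (a * (j + 1)) / 2) • v) (by omega) hn (by
        rw [dist_self_add_right, norm_smul, hU1 v hv, mul_one, Real.norm_of_nonneg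
          (by have := hpos (a * (j + 1)); linarith)])
      exact h1
  · intro j n x ω hz c ρ hρ hx
    rw [add_eq_zero, Finset.sum_eq_zero_iff] at hz
    have hz1 : (x, ω) ∉ A₁ j n := fun h1 => by simp [indicator_of_mem h1] at hz
    have hz2 : ∀ v ∈ U, (x, ω) ∉ A₂ j n v := fun v hv h1 => by
      have := hz.2 v hv
      simp [indicator_of_mem h1] at this
    obtain ⟨v, hv, hsub⟩ := hU x c _ ρ (hpos _) hρ hx
    have h1 : chaos κ Y q ν n ω (Metric.ball (x + 0) (4 * (r₀ / 2 ^ (a * j))))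
        ≤ ENNReal.ofReal (η j) ^ q := not_lt.1 hz1
    rw [add_zero] at h1
    refine h1.trans (ENNReal.rpow_le_rpow ?_ hq0.le)
    exact (not_le.1 (hz2 v hv)).le.trans (measure_mono hsub)

/-- Lower bound for the dimension of a set carrying a Frostman measure. -/
theorem ae_ofReal_le_measureDimH (h : IsScaleField P κ Y) (hκ : DyadicKernel L C r₀ κ)
    (hL : L < 4 * Real.log 2) {q t D : ℝ} (hq : q ∈ Ioo 0 1)
    (ht : q * (2 * Real.log 2 + L / 2) - q ^ 2 / 2 * L < t * Real.log 2) (hD : 0 ≤ D)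
    (ν : Measure Plane) [IsProbabilityMeasure ν]
    (hν : ∀ x r, 0 < r → ν (Metric.ball x r) ≤ ENNReal.ofReal (D * r ^ t))
    {S K : Set Plane} (hS : IsCompact S) (hSK : S ⊆ K) (hS₀ : S ⊆ Metric.closedBall 0 r₀)
    (hνS : ν Sᶜ = 0) :
    ∀ᵐ ω ∂P, ∀ M, IsRadonLimit (fun n => chaos κ Y 1 volume n ω) M →
      ENNReal.ofReal q ≤ measureDimH M K := by
  have hr₀ := hκ.logKernel.r₀_pos
  have hL0 := hκ.logKernel.L_nonneg
  have hlog : 0 < Real.log 2 := Real.log_pos one_lt_two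
  obtain ⟨a, w, f, ha, hw, hf, hf1, hfw, hf0⟩ := h.exists_bad_events hκ hL hq ht hD ν hν
  obtain ⟨θ, hθ, hb0⟩ : ∃ θ ∈ Ioo (0 : ℝ) 1,
      0 < t * Real.log 2 - q ^ 2 * (1 + θ) / 2 * L := by
    have h1 : Tendsto (fun θ : ℝ => t * Real.log 2 - q ^ 2 * (1 + θ) / 2 * L) (𝓝[>] 0)
        (𝓝 (t * Real.log 2 - q ^ 2 * (1 + 0) / 2 * L)) := by
      have : Continuous fun θ : ℝ => t * Real.log 2 - q ^ 2 * (1 + θ) / 2 * L := by fun_prop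
      exact this.continuousWithinAt
    have h0 : (0 : ℝ) < t * Real.log 2 - q ^ 2 * (1 + 0) / 2 * L := by
      have h3 : q * (q * L) ≤ q * (2 * Real.log 2 + L / 2) := by
        refine mul_le_mul_of_nonneg_left ?_ hq.1.le
        nlinarith [hq.1, hq.2]
      linarith
    have h2 := h1.eventually (lt_mem_nhds h0)
    obtain ⟨θ, h3, h4⟩ := (h2.and (Ioo_mem_nhdsGT one_pos)).exists
    exact ⟨θ, h4, h3⟩
  have hZS : ∀ n ω, chaos κ Y q ν n ω Sᶜ = 0 := fun n ω =>
    withDensity_absolutelyContinuous ν _ hνS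
  have hmass : ∀ᵐ ω ∂P, ∃ c : ℝ, 0 < c ∧
      Tendsto (fun n => chaos κ Y q ν n ω univ) atTop (𝓝 (ENNReal.ofReal c)) := by
    have h1 : ∀ n ω, chaos κ Y q ν n ω univ = chaos κ Y q ν n ω S := fun n ω => by
      rw [← measure_add_measure_compl hS.measurableSet, hZS, add_zero]
    have hmom := fun n => h.lintegral_chaos_rpow_one_add hκ.logKernel ⟨hq.1.le, hq.2.le⟩ hθ hD ν
      hS.measurableSet (fun x _ r hr => hν x r hr) rfl hb0 (Nat.zero_le n) (fun x hx y hy => by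
        have h2 : dist x 0 ≤ r₀ := hS₀ hx
        have h3 : dist y 0 ≤ r₀ := hS₀ hy
        have h4 := dist_triangle_right y x 0
        rw [Metric.mem_ball, pow_zero, div_one]
        linarith)
    refine h.ae_exists_pos_tendsto_chaos q ν (IsProbabilityMeasure.ne_zero ν) hS hνS hθ.1
      (ENNReal.mul_ne_top ENNReal.ofReal_ne_top (measure_ne_top ν S))
      (fun n => le_of_eq_of_le (lintegral_congr fun ω => by rw [h1]) (hmom n))
  have hs : ∀ j n, (a + 1) * (j + 1) ≤ n → j < n := fun j n hn => by nlinarith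
  filter_upwards [h.ae_exists_frequently_le_chaos q ν hs hw hf hf1 hfw hmass] with
    ω ⟨j₀, e, he, hfreq⟩ M hM
  obtain ⟨e', he', hcov⟩ := hM.exists_pos_le_tsum_ball_rpow
    (fun n => isFiniteMeasureOnCompacts_chaos 1 volume n ω (h.continuous n ω)) hS
    (fun n => hZS n ω) hr₀ hq.1 ha
    (G := fun n => {x | ∀ j, j₀ ≤ j → (a + 1) * (j + 1) ≤ n → f j n (x, ω) = 0})
    (fun n x hx j hj hn c ρ hρ hxc => hf0 j n x ω (hx j hj hn) c ρ hρ hxc) he hfreq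
  exact ofReal_le_measureDimH hSK he' hcov

end IsScaleField

/-! ### The cutoff covariances as a dyadic kernel. -/

section Kernel

variable {γ R : ℝ}

theorem log_div_two_pow (hR : 0 < R) (n : ℕ) : Real.log (R / (R / 2 ^ n)) = n * Real.log 2 := by
  rw [div_div_cancel₀ hR.ne', Real.log_pow]

theorem cutoffCovariance_dyadic_of_le (hR : 0 < R) {n : ℕ} {d : ℝ} (hd : d ≤ R / 2 ^ n) :
    cutoffCovariance γ R (R / 2 ^ n) d
      = n * (γ ^ 2 * Real.log 2) + 2 * γ ^ 2 * (1 - √(d / (R / 2 ^ n))) := by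
  rw [cutoffCovariance, if_pos hd, log_div_two_pow hR]
  ring

theorem le_cutoffCovariance_dyadic (hR : 0 < R) {n : ℕ} {d : ℝ} (hd : d ≤ R / 2 ^ n) :
    n * (γ ^ 2 * Real.log 2) ≤ cutoffCovariance γ R (R / 2 ^ n) d := by
  rw [cutoffCovariance_dyadic_of_le hR hd]
  have h1 : √(d / (R / 2 ^ n)) ≤ 1 :=
    Real.sqrt_le_one.2 ((div_le_one (by positivity)).2 hd)
  have : 0 ≤ 2 * γ ^ 2 * (1 - √(d / (R / 2 ^ n))) := mul_nonneg (by positivity) (by linarith)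
  linarith

theorem cutoffCovariance_dyadic_le_of_ge (hR : 0 < R) {n : ℕ} {d : ℝ} (hd : R / 2 ^ n ≤ d) :
    cutoffCovariance γ R (R / 2 ^ n) d ≤ n * (γ ^ 2 * Real.log 2) := by
  have hl : 0 < R / 2 ^ n := by positivity
  rcases hd.eq_or_lt with rfl | hd
  · rw [cutoffCovariance_dyadic_of_le hR le_rfl, div_self hl.ne', Real.sqrt_one]
    simp
  · rw [cutoffCovariance, if_neg hd.not_ge]
    have h1 : max 0 (Real.log (R / d)) ≤ n * Real.log 2 := by
      refine max_le (mul_nonneg (Nat.cast_nonneg n) (Real.log_pos one_lt_two).le) ?_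
      rw [← log_div_two_pow hR]
      exact Real.log_le_log (by have := hl.trans hd; positivity)
        (div_le_div_of_nonneg_left hR.le hl hd.le)
    nlinarith [mul_le_mul_of_nonneg_left h1 (sq_nonneg γ)]

theorem cutoffCovariance_dyadic_le (hR : 0 < R) (n : ℕ) (d : ℝ) :
    cutoffCovariance γ R (R / 2 ^ n) d ≤ n * (γ ^ 2 * Real.log 2) + 2 * γ ^ 2 := by
  have hγ := sq_nonneg γ
  rcases le_total d (R / 2 ^ n) with hd | hd
  · rw [cutoffCovariance_dyadic_of_le hR hd]
    have h1 := Real.sqrt_nonneg (d / (R / 2 ^ n))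
    nlinarith
  · linarith [cutoffCovariance_dyadic_le_of_ge (γ := γ) hR hd]

/-- Both covariances are given by the limiting logarithm beyond `R / 2 ^ m`. At `d = R / 2 ^ m` the
two branches agree because the square-root term vanishes. -/
theorem cutoffCovariance_dyadic_eq (hR : 0 < R) {m n : ℕ} {d : ℝ} (hmn : m ≤ n)
    (hd : R / 2 ^ m ≤ d) :
    cutoffCovariance γ R (R / 2 ^ n) d = cutoffCovariance γ R (R / 2 ^ m) d := by
  have hl : 0 < R / 2 ^ m := by positivity
  rcases hmn.eq_or_lt with rfl | hmn
  · rfl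
  have hlt : R / 2 ^ n < d := lt_of_lt_of_le
    (div_lt_div_of_pos_left hR (by positivity) (pow_lt_pow_right₀ one_lt_two hmn)) hd
  rcases hd.eq_or_lt with rfl | hd
  · rw [cutoffCovariance_dyadic_of_le hR le_rfl, cutoffCovariance, if_neg hlt.not_ge,
      log_div_two_pow hR, max_eq_right (by have := Real.log_pos one_lt_two; positivity),
      div_self hl.ne', Real.sqrt_one]
    ring
  · rw [cutoffCovariance, cutoffCovariance, if_neg hlt.not_ge, if_neg hd.not_ge]

theorem le_cutoffCovariance_dyadic_of_lt (hR : 0 < R) {n : ℕ} {d : ℝ}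
    (hd : d < 4 * (R / 2 ^ n)) :
    n * (γ ^ 2 * Real.log 2) - 2 * (γ ^ 2 * Real.log 2)
      ≤ cutoffCovariance γ R (R / 2 ^ n) d := by
  have hlog := Real.log_pos one_lt_two
  rcases le_or_gt d (R / 2 ^ n) with h | h
  · have := le_cutoffCovariance_dyadic (γ := γ) hR h
    have : 0 ≤ γ ^ 2 * Real.log 2 := by positivity
    linarith
  · rw [cutoffCovariance, if_neg h.not_ge]
    have hl : 0 < R / 2 ^ n := by positivity
    have hd0 := hl.trans h
    have h1 : n * Real.log 2 - 2 * Real.log 2 ≤ Real.log (R / d) := by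
      have h2 : Real.log (R / (4 * (R / 2 ^ n))) ≤ Real.log (R / d) :=
        Real.log_le_log (by positivity) (div_le_div_of_nonneg_left hR.le hd0 hd.le)
      have h3 : R / (4 * (R / 2 ^ n)) = (R / (R / 2 ^ n)) / 2 ^ 2 := by
        field_simp
        norm_num
      rw [h3, Real.log_div (by positivity) (by norm_num), log_div_two_pow hR, Real.log_pow] at h2
      exact_mod_cast h2
    have h4 := mul_le_mul_of_nonneg_left (h1.trans (le_max_right 0 _)) (sq_nonneg γ)
    linarith

/-- In the constant, `2 * γ ^ 2` is the excess on the diagonal, and `2 * (γ ^ 2 * Real.log 2)` are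
the two levels lost in reaching distance four times the scale. A lower bound for an increment pays
both, one from each kernel. -/
theorem dyadicKernel_cutoffCovariance (γ : ℝ) (hR : 0 < R) :
    DyadicKernel (γ ^ 2 * Real.log 2) (2 * γ ^ 2 + 2 * (γ ^ 2 * Real.log 2)) R
      (fun n => cutoffCovariance γ R (R / 2 ^ n)) := by
  have hlog := Real.log_pos one_lt_two
  have hγ := sq_nonneg γ
  have hL : 0 ≤ γ ^ 2 * Real.log 2 := by positivity
  refine ⟨⟨hL, by positivity, hR, ?_, ?_, ?_⟩,
    fun m => ⟨hL, by positivity, by positivity, ?_, ?_, ?_⟩, ?_⟩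
  · intro n d _
    linarith [cutoffCovariance_dyadic_le (γ := γ) hR n d]
  · intro j n d hj hd
    rw [cutoffCovariance_dyadic_eq hR hj hd]
    linarith [cutoffCovariance_dyadic_le_of_ge (γ := γ) hR hd]
  · intro j d _ hd
    linarith [le_cutoffCovariance_dyadic_of_lt (γ := γ) hR hd]
  · intro n d _
    rcases le_total d (R / 2 ^ m) with hd | hd
    · have h1 := cutoffCovariance_dyadic_le (γ := γ) hR (n + m) d
      have h2 := le_cutoffCovariance_dyadic (γ := γ) hR hd
      push_cast at h1
      linarith
    · rw [cutoffCovariance_dyadic_eq hR (Nat.le_add_left m n) hd, sub_self]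
      positivity
  · intro j n d hj hd
    rcases le_total d (R / 2 ^ m) with hdm | hdm
    · rw [div_div, ← pow_add, add_comm] at hd
      rw [cutoffCovariance_dyadic_eq hR (Nat.add_le_add_right hj m) hd]
      have h1 := cutoffCovariance_dyadic_le_of_ge (γ := γ) hR hd
      have h2 := le_cutoffCovariance_dyadic (γ := γ) hR hdm
      push_cast at h1
      linarith
    · rw [cutoffCovariance_dyadic_eq hR (Nat.le_add_left m n) hdm, sub_self]
      positivity
  · intro j d _ hd
    rw [div_div, ← pow_add, add_comm] at hd
    have h1 := le_cutoffCovariance_dyadic_of_lt (γ := γ) hR hd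
    have h2 := cutoffCovariance_dyadic_le (γ := γ) hR m d
    push_cast at h1
    linarith
  · intro m n d hmn hd
    exact cutoffCovariance_dyadic_eq hR hmn hd

end Kernel

/-! ### The dimension formula along dyadic scales. -/

/-- The dimension formula for the chaos along dyadic scales. -/
theorem IsScaleField.ae_measureDimH_eq {Ω : Type*} [MeasurableSpace Ω] {P : Measure Ω} {γ R : ℝ}
    {Y : ℕ → Plane → Ω → ℝ} (hR : 0 < R) (hγ : γ ^ 2 < 4)
    (h : IsScaleField P (fun n => cutoffCovariance γ R (R / 2 ^ n)) Y) {K : Set Plane}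
    (hKm : MeasurableSet K) (hK : K ⊆ Metric.closedBall 0 R) {δ : ℝ} (hδ : δ ∈ Icc 0 1)
    (hdim : dimH K = ENNReal.ofReal (scalingExponent γ δ)) :
    ∀ᵐ ω ∂P, ∀ M, IsRadonLimit (fun n => chaos (fun n => cutoffCovariance γ R (R / 2 ^ n)) Y 1
      volume n ω) M → measureDimH M K = ENNReal.ofReal δ := by
  have hκ := dyadicKernel_cutoffCovariance γ hR
  have hlog := Real.log_pos one_lt_two
  have hlow : ∀ q ∈ Ioo 0 δ, ∀ᵐ ω ∂P, ∀ M, IsRadonLimit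
      (fun n => chaos (fun n => cutoffCovariance γ R (R / 2 ^ n)) Y 1 volume n ω) M →
        ENNReal.ofReal q ≤ measureDimH M K := by
    intro q hq
    have hq1 : q < 1 := hq.2.trans_le hδ.2
    have hmono := scalingExponent_strictMonoOn hγ
    have h1 : 0 < scalingExponent γ q := by
      rw [← scalingExponent_zero γ]
      exact hmono ⟨le_rfl, zero_le_one⟩ ⟨hq.1.le, hq1.le⟩ hq.1
    have h2 : scalingExponent γ q < scalingExponent γ δ := hmono ⟨hq.1.le, hq1.le⟩ hδ hq.2
    -- Below the dimension the Hausdorff measure of order `t` is infinite, which feeds Frostman's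
    -- lemma; above `ζ(q)`, `t` satisfies the energy condition of the lower bound.
    obtain ⟨t, ht1, ht2⟩ := exists_between h2
    have ht0 : 0 < t := h1.trans ht1
    have hpos : μH[t] K ≠ 0 := by
      have h3 : ((t.toNNReal : ℝ≥0) : ℝ≥0∞) < dimH K := by
        rw [hdim]
        exact (ENNReal.ofReal_lt_ofReal_iff (ht0.trans ht2)).2 ht2
      have h4 := hausdorffMeasure_of_lt_dimH h3
      rw [Real.coe_toNNReal _ ht0.le] at h4
      rw [h4]
      exact ENNReal.top_ne_zero
    obtain ⟨S, hSK, hS, ν, D, hν, hνS, hD, hball⟩ := exists_frostman hR ht0 hKm hK hpos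
    refine h.ae_ofReal_le_measureDimH hκ (mul_lt_mul_of_pos_right hγ hlog) ⟨hq.1, hq1⟩ ?_ hD ν
      hball hS hSK (hSK.trans hK) hνS
    have h5 := mul_lt_mul_of_pos_right ht1 hlog
    rw [scalingExponent] at h5
    linarith
  have hup := h.ae_measureDimH_le hγ hκ.logKernel hδ hdim
  rcases hδ.1.eq_or_lt with rfl | hδ0
  · filter_upwards [hup] with ω hω M hM
    exact le_antisymm (hω M hM) (by simp)
  · obtain ⟨u, -, hu, hlim⟩ := exists_seq_strictMono_tendsto' hδ0
    filter_upwards [hup, ae_all_iff.2 fun k => hlow (u k) (hu k)] with ω h1 h2 M hM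
    exact le_antisymm (h1 M hM)
      (le_of_tendsto' (ENNReal.tendsto_ofReal hlim) fun k => h2 k M hM)

/-! ### Continuous modifications and arbitrary sequences of scales. -/

/-- A random field with almost surely continuous paths has a modification with continuous paths and
measurable values. -/
theorem exists_continuous_modification {E Ω : Type*} [TopologicalSpace E]
    [FirstCountableTopology E] [TopologicalSpace.SeparableSpace E] [MeasurableSpace Ω] {P : Measure Ω}
    {X : E → Ω → ℝ} (hX : ∀ x, AEMeasurable (X x) P)
    (hc : ∀ᵐ ω ∂P, Continuous fun x => X x ω) :
    ∃ Y : E → Ω → ℝ, (∀ x, Measurable (Y x)) ∧ (∀ ω, Continuous fun x => Y x ω) ∧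
      ∀ᵐ ω ∂P, ∀ x, Y x ω = X x ω := by
  obtain ⟨D, hDc, hD⟩ := TopologicalSpace.exists_countable_dense E
  have h1 : ∀ᵐ ω ∂P, (Continuous fun x => X x ω) ∧ ∀ x ∈ D, X x ω = (hX x).mk (X x) ω :=
    hc.and ((ae_ball_iff hDc).2 fun x _ => (hX x).ae_eq_mk)
  obtain ⟨B, hB, hBm, hB0⟩ := exists_measurable_superset_of_null (ae_iff.1 h1)
  have hgood : ∀ ω ∉ B, (Continuous fun x => X x ω) ∧ ∀ x ∈ D, X x ω = (hX x).mk (X x) ω :=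
    fun ω hω => by
      by_contra hcon
      exact hω (hB hcon)
  -- Off `B` the field agrees with measurable versions on the countable dense set `D`. Continuity
  -- carries measurability to the remaining points by limits along `D`.
  set Y : E → Ω → ℝ := fun x => Bᶜ.indicator (X x) with hY
  have hYc : ∀ ω, Continuous fun x => Y x ω := by
    intro ω
    by_cases hω : ω ∈ Bᶜ
    · simpa only [hY, indicator_of_mem hω] using (hgood ω hω).1
    · simpa only [hY, indicator_of_notMem hω] using continuous_const
  refine ⟨Y, fun x => ?_, hYc, ?_⟩
  · obtain ⟨x', hx'D, hx'⟩ := mem_closure_iff_seq_limit.1 (hD x)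
    refine measurable_of_tendsto_metrizable (f := fun k => Y (x' k)) (fun k => ?_)
      (tendsto_pi_nhds.2 fun ω => ((hYc ω).tendsto x).comp hx')
    have h2 : Y (x' k) = Bᶜ.indicator ((hX (x' k)).mk (X (x' k))) :=
      indicator_congr fun ω hω => (hgood ω hω).2 _ (hx'D k)
    rw [h2]
    exact (hX (x' k)).measurable_mk.indicator hBm.compl
  · filter_upwards [compl_mem_ae_iff.2 hB0] with ω hω x
    exact indicator_of_mem hω _

/-- A set of positive numbers accumulating only at zero can be enumerated decreasingly. -/
theorem exists_strictAnti_range_eq {T : Set ℝ}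
    (hfin : ∀ t ∈ T, (T ∩ Ici t).Finite) (hlow : ∀ t ∈ T, ∃ s ∈ T, s < t)
    (hmax : ∃ b ∈ T, ∀ t ∈ T, t ≤ b) :
    ∃ u : ℕ → ℝ, StrictAnti u ∧ range u = T := by
  -- Finiteness above each element gives every `t` an immediate predecessor. Iterating from the
  -- maximum enumerates `T`, since infinitely many terms cannot stay above an element of `T`.
  have hnext : ∀ t : T, ∃ s : T, s < t ∧ ∀ r : T, r < t → r ≤ s := by
    rintro ⟨t, ht⟩
    obtain ⟨s₀, hs₀, hlt⟩ := hlow t ht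
    obtain ⟨s, hs, hsmax⟩ := Set.exists_max_image ((T ∩ Ici s₀) ∩ Iio t) id
      ((hfin s₀ hs₀).inter_of_left _) ⟨s₀, ⟨hs₀, mem_Ici.2 le_rfl⟩, hlt⟩
    refine ⟨⟨s, hs.1.1⟩, hs.2, fun r hr => ?_⟩
    rcases le_total s₀ (r : ℝ) with h | h
    · exact hsmax r ⟨⟨r.2, h⟩, hr⟩
    · exact h.trans hs.1.2
  choose next hnext1 hnext2 using hnext
  obtain ⟨b, hb, hbmax⟩ := hmax
  set v : ℕ → T := fun n => next^[n] ⟨b, hb⟩ with hv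
  have hvs : ∀ n, v (n + 1) = next (v n) := fun n => Function.iterate_succ_apply' next n _
  have hanti : StrictAnti fun n => (v n : ℝ) := strictAnti_nat_of_succ_lt fun n => by
    rw [hvs]; exact hnext1 (v n)
  refine ⟨fun n => v n, hanti, Subset.antisymm (range_subset_iff.2 fun n => (v n).2) ?_⟩
  intro t ht
  have hex : ∃ n, (v n : ℝ) ≤ t := by
    by_contra! hcon
    exact Set.infinite_of_injective_forall_mem (s := T ∩ Ici t) hanti.injective
      (fun n => ⟨(v n).2, (hcon n).le⟩) (hfin t ht)
  refine ⟨Nat.find hex, le_antisymm (Nat.find_spec hex) ?_⟩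
  rcases Nat.eq_zero_or_eq_succ_pred (Nat.find hex) with h0 | h0
  · rw [h0]
    exact hbmax t ht
  · have h1 := not_le.1 (Nat.find_min hex (Nat.pred_lt_of_lt (Nat.pos_of_ne_zero (by omega))))
    rw [h0, Nat.succ_eq_add_one]
    beta_reduce
    rw [hvs]
    exact hnext2 _ ⟨t, ht⟩ h1

/-- A sequence of scales and the dyadic scales are subsequences of a common decreasing sequence. -/
theorem exists_common_scales {R : ℝ} (hR : 0 < R) {l : ℕ → ℝ} (hl : ∀ n, l n ∈ Ioc 0 R)
    (hlim : Tendsto l atTop (𝓝 0)) :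
    ∃ (u : ℕ → ℝ) (σ τ : ℕ → ℕ), Antitone u ∧ (∀ n, u n ∈ Ioc 0 R) ∧ Tendsto σ atTop atTop ∧
      (∀ n, u (σ n) = l n) ∧ Monotone τ ∧ Tendsto τ atTop atTop ∧ ∀ k, u (τ k) = R / 2 ^ k := by
  have hdlim : Tendsto (fun k : ℕ => R / 2 ^ k) atTop (𝓝 0) := by
    have := (tendsto_pow_atTop_nhds_zero_of_lt_one (r := (1 / 2 : ℝ)) (by norm_num)
      (by norm_num)).const_mul R
    rw [mul_zero] at this
    refine this.congr fun k => ?_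
    rw [one_div, inv_pow, div_eq_mul_inv]
  have hdpos : ∀ k : ℕ, 0 < R / 2 ^ k := fun k => by positivity
  have hdanti : StrictAnti fun k : ℕ => R / 2 ^ k := fun i k hik =>
    div_lt_div_of_pos_left hR (by positivity) (pow_lt_pow_right₀ one_lt_two hik)
  -- The martingale argument needs decreasing scales, while `l` may oscillate and repeat values.
  -- Enumerating the set of all scales removes both defects.
  set T : Set ℝ := range l ∪ range fun k : ℕ => R / 2 ^ k with hT
  have hTpos : ∀ t ∈ T, t ∈ Ioc 0 R := by
    rintro t (⟨n, rfl⟩ | ⟨k, rfl⟩)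
    · exact hl n
    · exact ⟨hdpos k, div_le_self hR.le (one_le_pow₀ one_le_two)⟩
  have hfinite : ∀ s : ℕ → ℝ, Tendsto s atTop (𝓝 0) → ∀ t > 0, (range s ∩ Ici t).Finite := by
    intro s hs t ht
    obtain ⟨N, hN⟩ := eventually_atTop.1 (hs.eventually (gt_mem_nhds ht))
    refine ((Set.finite_Iio N).image s).subset ?_
    rintro _ ⟨⟨n, rfl⟩, hn⟩
    refine ⟨n, ?_, rfl⟩
    by_contra hcon
    exact (hN n (not_lt.1 hcon)).not_ge hn
  obtain ⟨u, hu, hrange⟩ := exists_strictAnti_range_eq (T := T)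
    (fun t ht => by
      rw [hT, union_inter_distrib_right]
      exact (hfinite l hlim t (hTpos t ht).1).union (hfinite _ hdlim t (hTpos t ht).1))
    (fun t ht => by
      obtain ⟨k, hk⟩ := (hdlim.eventually (gt_mem_nhds (hTpos t ht).1)).exists
      exact ⟨_, Or.inr ⟨k, rfl⟩, hk⟩)
    ⟨R, Or.inr ⟨0, by simp⟩, fun t ht => (hTpos t ht).2⟩
  have hmem : ∀ t ∈ T, ∃ n, u n = t := fun t ht => by rwa [← hrange] at ht
  choose σ hσ using fun n => hmem (l n) (Or.inl ⟨n, rfl⟩)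
  choose τ hτ using fun k => hmem (R / 2 ^ k) (Or.inr ⟨k, rfl⟩)
  have huT : ∀ n, u n ∈ Ioc 0 R := fun n => hTpos _ (hrange ▸ mem_range_self n)
  have hτm : StrictMono τ := fun i k hik => hu.lt_iff_gt.1 (by rw [hτ, hτ]; exact hdanti hik)
  refine ⟨u, σ, τ, hu.antitone, huT, tendsto_atTop.2 fun N => ?_, hσ, hτm.monotone,
    hτm.tendsto_atTop, hτ⟩
  filter_upwards [hlim.eventually (gt_mem_nhds (huT N).1)] with n hn
  rw [← hσ] at hn
  exact (hu.lt_iff_gt.1 hn).le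

/-- A cutoff field family, sampled along a decreasing sequence of scales, is a scale field up to
modification. -/
theorem IsCutoffFieldFamily.exists_isScaleField {Ω : Type*} [MeasurableSpace Ω] {P : Measure Ω}
    {γ R : ℝ} {X : ℝ → Plane → Ω → ℝ} (hX : IsCutoffFieldFamily P γ R X) {u : ℕ → ℝ}
    (hu : Antitone u) (huR : ∀ n, u n ∈ Ioc 0 R) :
    ∃ Y : ℕ → Plane → Ω → ℝ, IsScaleField P (fun n => cutoffCovariance γ R (u n)) Y ∧
      ∀ᵐ ω ∂P, ∀ n x, Y n x ω = X (u n) x ω := by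
  have hg : IsGaussianProcess (fun p : ℕ × Plane => X (u p.1) p.2) P :=
    hX.gaussian.comp_right fun p : ℕ × Plane => ((⟨u p.1, huR p.1⟩ : Ioc 0 R), p.2)
  choose Y hYm hYc hYX using fun n => exists_continuous_modification
    (fun x => hg.aemeasurable (n, x)) (hX.continuous_paths (u n) (huR n))
  have hYX' : ∀ n x, Y n x =ᵐ[P] X (u n) x := fun n x => by
    filter_upwards [hYX n] with ω hω using hω x
  refine ⟨Y, ⟨hg.congr fun p => (hYX' p.1 p.2).symm, hYm, hYc, fun n x => ?_, fun m n x y => ?_⟩,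
    ae_all_iff.2 hYX⟩
  · rw [integral_congr_ae (hYX' n x), hX.centered _ (huR n)]
  · rw [hu.map_min]
    exact (integral_congr_ae ((hYX' m x).mul (hYX' n y))).trans
      (hX.covariance _ (huR m) _ (huR n) x y)

/-- The almost sure limit of the chaos along an arbitrary sequence of scales exists and is the limit
along the dyadic scales of a scale field. -/
theorem IsCutoffFieldFamily.exists_dyadic_isScaleField {Ω : Type*} [MeasurableSpace Ω]
    {P : Measure Ω} {γ R : ℝ} (hR : 0 < R) {X : ℝ → Plane → Ω → ℝ}
    (hX : IsCutoffFieldFamily P γ R X) {l : ℕ → ℝ} (hl : ∀ n, l n ∈ Ioc 0 R)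
    (hlim : Tendsto l atTop (𝓝 0)) :
    ∃ Y : ℕ → Plane → Ω → ℝ, IsScaleField P (fun n => cutoffCovariance γ R (R / 2 ^ n)) Y ∧
      ∀ᵐ ω ∂P, ∃ M, IsRadonLimit (fun n => expFieldMeasure P (X (l n)) ω) M ∧
        IsRadonLimit (fun n => chaos (fun n => cutoffCovariance γ R (R / 2 ^ n)) Y 1 volume n ω)
          M := by
  obtain ⟨u, σ, τ, hu, huR, hσ, hσl, hτ, hτlim, hτd⟩ := exists_common_scales hR hl hlim
  obtain ⟨Y, hY, hYX⟩ := hX.exists_isScaleField hu huR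
  refine ⟨fun k => Y (τ k), ?_, ?_⟩
  · have := hY.comp_monotone hτ
    simpa only [hτd] using this
  -- Both families are read off one almost surely convergent sequence, along `σ` and `τ`, so they
  -- share the limit `M`.
  · filter_upwards [hYX, hY.ae_exists_isRadonLimit 1 volume] with ω hω ⟨M, hM⟩
    refine ⟨M, ⟨hM.1, fun f hf hfc => ?_⟩, ⟨hM.1, fun f hf hfc => ?_⟩⟩
    · refine ((hM.2 f hf hfc).comp hσ).congr fun n => ?_
      have h1 : chaos (fun n => cutoffCovariance γ R (u n)) Y 1 volume (σ n) ω
          = expFieldMeasure P (X (l n)) ω := by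
        rw [chaos, expFieldMeasure]
        congr 1
        funext x
        have h2 := hX.covariance (l n) (hl n) (l n) (hl n) x x
        rw [max_self, dist_self] at h2
        simp only [expWeight, hω, hσl, pow_two, h2]
        congr 2
        ring
      rw [Function.comp_apply]
      beta_reduce
      rw [h1]
    · refine ((hM.2 f hf hfc).comp hτlim).congr fun k => ?_
      have h1 : chaos (fun n => cutoffCovariance γ R (u n)) Y 1 volume (τ k) ω
          = chaos (fun n => cutoffCovariance γ R (R / 2 ^ n)) (fun k => Y (τ k)) 1 volume k ω := by
        simp only [chaos, expWeight, hτd]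
      rw [Function.comp_apply]
      beta_reduce
      rw [h1]

theorem existsUnique_dimH_eq_scalingExponent {γ : ℝ} (hγ : γ ^ 2 < 4) (K : Set Plane) :
    ∃! δ : ℝ, δ ∈ Icc (0 : ℝ) 1 ∧ dimH K = ENNReal.ofReal (scalingExponent γ δ) := by
  have hmono := scalingExponent_strictMonoOn hγ
  have h2 : dimH K ≤ 2 := by
    refine (dimH_mono (subset_univ K)).trans ?_
    rw [Real.dimH_univ_eq_finrank, finrank_euclideanSpace, Fintype.card_fin]
    norm_num
  have hcont : ContinuousOn (scalingExponent γ) (Icc 0 1) := by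
    have : Continuous (scalingExponent γ) := by
      unfold scalingExponent
      fun_prop
    exact this.continuousOn
  have hmem : (dimH K).toReal ∈ Icc (scalingExponent γ 0) (scalingExponent γ 1) := by
    rw [scalingExponent_zero, scalingExponent_one]
    exact ⟨ENNReal.toReal_nonneg, ENNReal.toReal_le_of_le_ofReal two_pos.le (by simpa using h2)⟩
  have hfin : dimH K ≠ ∞ := ne_top_of_le_ne_top (by simp) h2
  obtain ⟨δ, hδ, hδK⟩ := intermediate_value_Icc zero_le_one hcont hmem
  refine ⟨δ, ⟨hδ, by rw [hδK, ENNReal.ofReal_toReal hfin]⟩, ?_⟩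
  rintro δ' ⟨hδ', hδ'K⟩
  refine hmono.injOn hδ' hδ ?_
  -- `ENNReal.ofReal` identifies all nonpositive reals, so uniqueness needs the sign of `ζ(δ')`.
  have h0 : 0 ≤ scalingExponent γ δ' := by
    rw [← scalingExponent_zero γ]
    exact hmono.monotoneOn ⟨le_rfl, zero_le_one⟩ hδ' hδ'.1
  rw [hδK, hδ'K, ENNReal.toReal_ofReal h0]

theorem theorem5p1 {Ω : Type*} [MeasurableSpace Ω] (P : Measure Ω) [IsProbabilityMeasure P]
    (γ R : ℝ) (hR : 0 < R) (hγ_pos : 0 < γ ^ 2) (hγ_lt : γ ^ 2 < 4)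
    (X : ℝ → Plane → Ω → ℝ) (hX : IsCutoffFieldFamily P γ R X)
    (l : ℕ → ℝ) (hl : ∀ n, l n ∈ Set.Ioc 0 R) (hl_lim : Tendsto l atTop (𝓝 0))
    (K : Set Plane) (hK_meas : MeasurableSet K) (hK_ne : K.Nonempty)
    (hK_sub : K ⊆ Metric.closedBall 0 R) :
    (∃! δ : ℝ, δ ∈ Set.Icc (0 : ℝ) 1 ∧ dimH K = ENNReal.ofReal (scalingExponent γ δ)) ∧
    ∀ δ ∈ Set.Icc (0 : ℝ) 1, dimH K = ENNReal.ofReal (scalingExponent γ δ) →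
      ∀ᵐ ω ∂P, ∃ M : Measure Plane,
        IsRadonLimit (fun n => expFieldMeasure P (X (l n)) ω) M ∧
        measureDimH M K = ENNReal.ofReal δ := by
  refine ⟨existsUnique_dimH_eq_scalingExponent hγ_lt K, fun δ hδ hdim => ?_⟩
  obtain ⟨Y, hY, hlim⟩ := hX.exists_dyadic_isScaleField hR hl hl_lim
  filter_upwards [hlim, hY.ae_measureDimH_eq hR hγ_lt hK_meas hK_sub hδ hdim] with ω ⟨M, hM, hM'⟩ h
  exact ⟨M, hM, h M hM'⟩
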